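/- **Setting.** Let $Q(y|x)$ be a discrete memoryless channel with finite input alphabet $\mathcal X\cup\{\star\}$ ($\star$ is the idle symbol, which may or may not belong to $\mathcal X$) and finite output alphabet $\mathcal Y$, and let $k:\mathcal X\to[0,\infty]$ be a cost function such that, for $x\in\mathcal X$, $k(x)=0$ if and only if $x=\star$. Fix $\beta>0$; logarithms are to base $2$. A *code* for $B$ bits at timing uncertainty $\beta$ consists of $2^B$ codewords $c(m)\in\mathcal X^n$ (with $n\ge1$ arbitrary), start times $\sigma(\nu,m)$ with $\nu\le\sigma(\nu,m)\le A$, where $A=2^{\beta B}$ (rounded down to an integer), and a receiver. Message $m$ arrives at a time $\nu$ uniform on $\{1,\dots,A\}$; codeword $c(m)$ is sent at times $\sigma,\dots,\sigma+n-1$, and $\star$ is the channel input at all other times in $\{1,\dots,A+n-1\}$. The (possibly randomized) receiver samples the outputs adaptively at times $S_1<S_2<\cdots$ in $\{1,\dots,A+n-1\}$, each $S_j$ being a function of the previously sampled values; it stops at time $S_\tau$, where $\tau\ge 1$ is a stopping time of the sampled sequence, and decodes the message from the $\tau$ samples. Let $\mathbb P_m$ be the law when message $m$ is sent. Write $\mathbb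 P(\mathcal E|\mathcal C)$ for the maximum over $m$ of the error probability under $\mathbb P_m$; $K(\mathcal C)=\max_m\sum_i k(c_i(m))$; $\rho(\mathcal C,\varepsilon)$ for the smallest $r\ge0$ with $\min_m\mathbb P_m(\tau/S_\tau\le r)\ge1-\varepsilon$; and $d(\mathcal C,\varepsilon)$ for the smallest integer $l\geq 0$ with $\min_m\mathbb P_m(S_\tau-\nu\le l-1)\ge1-\varepsilon$. For $\rho>0$ and $R\ge0$, codes $\{\mathcal C_B\}$ *achieve* rate per unit cost $R$ at $(\beta,\rho)$ with tolerances $\varepsilon_B>0$, $\varepsilon_B\to0$, if for all large $B$: $\mathbb P(\mathcal E|\mathcal C_B)\le\varepsilon_B$, $B/K(\mathcal C_B)\ge R-\varepsilon_B$, $\rho(\mathcal C_B,\varepsilon_B)\le\rho+\varepsilon_B$, and $\frac1B\log d(\mathcal C_B,\varepsilon_B)\le\varepsilon_B$. The capacity per unit cost $C(\beta,\rho)\in[0,\infty]$ is the supremum of the rates achieved by some such codes and tolerances ($0$ if there are none); $C(\beta,1)$ is the capacity under full sampling. Let $\mathcal P$ be the set of laws of $X$ on $\mathcal X$ that maximize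 $$\min\left\{\frac{I(X;Y)}{\mathbb E[k(X)]},\ \frac{I(X;Y)+D(Y\|Y_\star)}{\mathbb E[k(X)](1+\beta)}\right\}$$ (with $0/0=0$), where $Y\sim Q(\cdot|X)$ and $Y_\star\sim Q(\cdot|\star)$, and let $n_B^*=\min_{X\in\mathcal P}\frac{B}{C(\beta,1)\,\mathbb E[k(X)]}$ (an infimum if the minimum is not attained). **Theorem (Adaptive sampling).** For every $\beta>0$ and every sampling frequency $\rho>0$: 1. $C(\beta,\rho)=C(\beta,1)$. 2. Suppose $0<C(\beta,1)<\infty$. (a) If $\mathcal P\ne\emptyset$, there are codes $\{\mathcal C_B\}$ and tolerances $\varepsilon_B\to0$ that achieve rate $C(\beta,1)$ at $(\beta,\rho)$ and satisfy $d(\mathcal C_B,\varepsilon_B)=n_B^*(1+o(1))$ as $B\to\infty$. (b) This delay is the minimum possible under full sampling, provided that $Q(y|x)>0$ implies $Q(y|\star)>0$ for every $y$ and every $x\in\mathcal X$ of finite cost: in that case $\mathcal P\neq\emptyset$, and all codes $\{\mathcal C_B\}$ that achieve rate $C(\beta,1)$ at $(\beta,1)$ with tolerances $\varepsilon_B\to0$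 satisfy $d(\mathcal C_B,\varepsilon_B)\ge n_B^*(1-o(1))$ as $B\to\infty$. -/

import Mathlib

open Filter Topology
open scoped ENNReal NNReal

/-- A discrete memoryless channel with an idle symbol and input costs.  Code symbols are taken from
the finite set `alphabet`, which may or may not contain the idle symbol `star`; when nothing is
sent, the channel input is `star`.  The only possible zero-cost code symbol is `star`, and it has
zero cost if it may be used as a code symbol.  (`cost` matters only on `alphabet`.) -/
structure Channel (I Y : Type*) where
  star : I
  alphabet : Finset I
  Q : I → PMF Y
  cost : I → ℝ≥0∞
  cost_eq_zero_iff : ∀ x ∈ alphabet, cost x = 0 ↔ x = star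

/-- The list of the first `j` sampled values when the outputs are `y`, where `next l` is the time
of the next sample once the values `l` have been observed. -/
def observed {Y : Type*} {N : ℕ} (next : List Y → Fin N) (y : Fin N → Y) : ℕ → List Y
  | 0 => []
  | j + 1 => observed next y j ++ [y (next (observed next y j))]

/-- A deterministic receiver for `N` channel outputs and `M` messages: an adaptive sampling
strategy, a stopping rule for the sampled sequence, and a decoding function.  The element `i` of
`Fin N` stands for time `i + 1`.  Sampling times increase strictly until the receiver stops. -/
structure Receiver (Y : Type*) (N M : ℕ) where
  next : List Y → Fin N
  stopSet : Set (List Y)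
  decode : List Y → Fin M
  increasing : ∀ (y : Fin N → Y) (j : ℕ),
    (∀ i, 1 ≤ i → i ≤ j + 1 → observed next y i ∉ stopSet) →
      next (observed next y j) < next (observed next y (j + 1))
  stops : ∀ y : Fin N → Y, ∃ j, 1 ≤ j ∧ observed next y j ∈ stopSet

namespace Receiver

variable {Y : Type*} {N M : ℕ}

open Classical in
/-- The number `τ` of samples taken until the decision. -/
noncomputable def tau (r : Receiver Y N M) (y : Fin N → Y) : ℕ := Nat.find (r.stops y)

/-- The decision time `S_τ`, in `{1, …, N}`. -/
noncomputable def decisionTime (r : Receiver Y N M) (y : Fin N → Y) : ℕ :=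
  (r.next (observed r.next y (r.tau y - 1)) : ℕ) + 1

/-- The decoded message. -/
noncomputable def message (r : Receiver Y N M) (y : Fin N → Y) : Fin M :=
  r.decode (observed r.next y (r.tau y))

end Receiver

/-- A code for `B` bits and asynchronism level `A`: a codebook with `2 ^ B` codewords of length
`n ≥ 1`, a start time `σ(ν, m)` with `ν ≤ σ(ν, m) ≤ A`, and a randomized receiver, i.e. a
probability distribution on deterministic receivers.  The element `t` of `Fin A` stands for
time `t + 1`. -/
structure Code {I Y : Type*} (ch : Channel I Y) (B A : ℕ) where
  n : ℕ
  n_pos : 1 ≤ n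
  codeword : Fin (2 ^ B) → Fin n → ch.alphabet
  start : Fin A → Fin (2 ^ B) → Fin A
  le_start : ∀ t m, t ≤ start t m
  receiver : PMF (Receiver Y (A + n - 1) (2 ^ B))

namespace Code

variable {I Y : Type*} [Fintype Y] {ch : Channel I Y} {B A : ℕ}

/-- The channel inputs when message `m` arrives at time `t`. -/
noncomputable def input (C : Code ch B A) (m : Fin (2 ^ B)) (t : Fin A)
    (i : Fin (A + C.n - 1)) : I :=
  if h : (C.start t m : ℕ) ≤ i ∧ (i : ℕ) < C.start t m + C.n then
    (C.codeword m ⟨(i : ℕ) - C.start t m, by omega⟩ : I)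
  else ch.star

/-- The probability `ℙ_{m,t}` of an event that depends on the receiver's randomness and on the
channel outputs, given that message `m` arrives at time `t`. -/
noncomputable def probAt (C : Code ch B A) (m : Fin (2 ^ B)) (t : Fin A)
    (E : Receiver Y (A + C.n - 1) (2 ^ B) → Set (Fin (A + C.n - 1) → Y)) : ℝ≥0∞ :=
  ∑' r, C.receiver r * ∑ y, (E r).indicator (fun y => ∏ i, ch.Q (C.input m t i) (y i)) y

/-- The probability `ℙ_m`: the arrival time is uniform on the `A` possible times. -/
noncomputable def prob (C : Code ch B A) (m : Fin (2 ^ B))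
    (E : Fin A → Receiver Y (A + C.n - 1) (2 ^ B) → Set (Fin (A + C.n - 1) → Y)) : ℝ≥0∞ :=
  (A : ℝ≥0∞)⁻¹ * ∑ t, C.probAt m t (E t)

/-- Maximum error probability. -/
noncomputable def errorProb (C : Code ch B A) : ℝ≥0∞ :=
  ⨆ m, C.prob m fun _ r => {y | r.message y ≠ m}

/-- Maximum cost of a codeword. -/
noncomputable def maxCost (C : Code ch B A) : ℝ≥0∞ :=
  ⨆ m, ∑ i, ch.cost (C.codeword m i)

/-- Sampling frequency: the smallest `r ≥ 0` such that `τ / S_τ ≤ r` with probability at least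
`1 - ε`, whatever the message. -/
noncomputable def samplingFreq (C : Code ch B A) (ε : ℝ) : ℝ :=
  sInf {r : ℝ | 0 ≤ r ∧ 1 - ENNReal.ofReal ε ≤
    ⨅ m, C.prob m fun _ rc => {y | (rc.tau y : ℝ) / rc.decisionTime y ≤ r}}

/-- Delay: the smallest `l` such that `S_τ - ν ≤ l - 1` with probability at least `1 - ε`, whatever
the message; `ν = t + 1`. -/
noncomputable def delay (C : Code ch B A) (ε : ℝ) : ℕ :=
  sInf {l : ℕ | 1 - ENNReal.ofReal ε ≤
    ⨅ m, C.prob m fun t rc => {y | (rc.decisionTime y : ℤ) - ((t : ℤ) + 1) ≤ (l : ℤ) - 1}}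

end Code

/-- The asynchronism level `A = 2 ^ (β B)`, rounded down to an integer. -/
noncomputable def asyncLevel (β : ℝ) (B : ℕ) : ℕ := ⌊(2 : ℝ) ^ (β * B)⌋₊

namespace Channel

variable {I Y : Type*} [Fintype Y]

/-- The codes `C B` achieve rate per unit cost `R` at timing uncertainty per information bit `β` and
sampling frequency `ρ`, with tolerances `ε B`. -/
structure Achieves (ch : Channel I Y) (β ρ : ℝ) (R : ℝ≥0)
    (C : ∀ B : ℕ, Code ch B (asyncLevel β B)) (ε : ℕ → ℝ) : Prop where
  pos : ∀ B, 0 < ε B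
  tendsto_zero : Tendsto ε atTop (𝓝 0)
  error_le : ∀ᶠ B in atTop, (C B).errorProb ≤ ENNReal.ofReal (ε B)
  rate_ge : ∀ᶠ B in atTop, (R : ℝ≥0∞) - ENNReal.ofReal (ε B) ≤ (B : ℝ≥0∞) / (C B).maxCost
  samplingFreq_le : ∀ᶠ B in atTop, (C B).samplingFreq (ε B) ≤ ρ + ε B
  delay_le : ∀ᶠ B : ℕ in atTop, 1 / (B : ℝ) * Real.logb 2 ((C B).delay (ε B)) ≤ ε B

/-- The asynchronous capacity per unit cost `C(β, ρ)` under adaptive sampling. -/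
noncomputable def capacity (ch : Channel I Y) (β ρ : ℝ) : ℝ≥0∞ :=
  ⨆ (R : ℝ≥0) (_ : ∃ C ε, ch.Achieves β ρ R C ε), (R : ℝ≥0∞)

end Channel

/-- Kullback-Leibler divergence, in bits. -/
noncomputable def divBits {α : Type*} (p q : PMF α) : ℝ≥0∞ :=
  letI : MeasurableSpace α := ⊤
  InformationTheory.klDiv p.toMeasure q.toMeasure / ENNReal.ofReal (Real.log 2)

namespace Channel

variable {I Y : Type*}

/-- The law of the output `Y` for an input `X` of law `P`. -/
noncomputable def outputLaw (ch : Channel I Y) (P : PMF ch.alphabet) : PMF Y :=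
  P.bind fun x => ch.Q x

/-- The mutual information `I(X; Y)` in bits: the divergence of the joint law from the product of
the marginals. -/
noncomputable def mutualInfo (ch : Channel I Y) (P : PMF ch.alphabet) : ℝ≥0∞ :=
  divBits (P.bind fun x => (ch.Q x).map fun y => (x, y))
    (P.bind fun x => (ch.outputLaw P).map fun y => (x, y))

/-- The expected cost `𝔼[k(X)]`. -/
noncomputable def expCost (ch : Channel I Y) (P : PMF ch.alphabet) : ℝ≥0∞ :=
  ∑ x, P x * ch.cost x

/-- `min {I(X;Y) / 𝔼[k(X)], (I(X;Y) + D(Y‖Y⋆)) / (𝔼[k(X)] (1 + β))}`. -/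
noncomputable def objective (ch : Channel I Y) (β : ℝ) (P : PMF ch.alphabet) : ℝ≥0∞ :=
  min (ch.mutualInfo P / ch.expCost P)
    ((ch.mutualInfo P + divBits (ch.outputLaw P) (ch.Q ch.star)) /
      (ch.expCost P * ENNReal.ofReal (1 + β)))

/-- The set of input laws that maximize `objective`. -/
def maximizers (ch : Channel I Y) (β : ℝ) : Set (PMF ch.alphabet) :=
  {P | ∀ P', ch.objective β P' ≤ ch.objective β P}

/-- `n*_B`, the minimum of `B / (C(β, 1) 𝔼[k(X)])` over the maximizing input laws. -/
noncomputable def nStar [Fintype Y] (ch : Channel I Y) (β : ℝ) (B : ℕ) : ℝ≥0∞ :=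
  ⨅ P ∈ ch.maximizers β, (B : ℝ≥0∞) / (ch.capacity β 1 * ch.expCost P)

end Channel

/-!
The capacity per unit cost at every sampling frequency equals the supremum over input laws `P` of
`Channel.objective`, and the delay `nStar` is forced by the cost of the maximizing laws.

*Converse.* Suppose that a code has small errors and a subexponential delay `D`. Under pure noise
the decisions for all messages and arrival times share a probability budget of about `D`
(`Code.sum_noise_le`), and decisions before the arrival are guesses. Averaging over the arrival
time and a pigeonhole argument over the start times give an arrival time and about `2 ^ B / D`
messages with the same start time, which are decided correctly and within the delay, although
under noise these decisions have total probability at most `2 D / A` (`Code.exists_common_start`).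
Let `P` be the law of a random symbol among the first `n'` symbols of these codewords, where `n' ≤
D` is the number of symbols that a timely decision can see. A change of measure
(`Code.window_test`) from the true outputs to independent outputs of the output law of `P` gives
`n' I ≥ B`, and one to pure noise gives `n' (I + D(Y‖Y⋆)) ≥ (1 + β) B`, up to factors that tend to
`1`. Both hold at a cost `n' 𝔼[k(X)]` within that of the code (`Code.exists_law`), so the rate is
at most the objective of `P` (`Channel.capacity_le_iSup_objective`). If the rate is the capacity,
then `P` approaches the set of maximizers by compactness, and `n' ≤ D` becomes the lower bound on
the delay (`Channel.Achieves.eventually_nStar_le`).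

*Existence of maximizers.* When every code symbol has positive cost, the objective is continuous
on a compact set. When the idle symbol is itself a free code symbol, the objective is at most
`max_x D(Q(·|x)‖Q(·|⋆)) / k(x) / (1 + β)`, and a law that uses the best `x` rarely enough attains
this bound, since `D(Y‖Y⋆)` is then negligible against `I` (`Channel.exists_law_of_star`).

*Achievability.* Feinstein's greedy construction gives codebooks of a given law whose decoding
sets are rarely hit by noise (`Channel.exists_codebook`). A codeword is preceded by a short
preamble that repeats a symbol distinguishable from `⋆`, and it starts at the beginning of a slot.
The receiver samples only the beginning of each slot, a small fraction of the outputs, until a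
preamble is detected; it then samples a whole word, and resumes its search if no message fits
(`SlotScheme.decision_of_slot`). Slots and preambles are short in comparison with the words, yet
long enough for false alarms to be rare, so that neither cost nor delay suffers and the number of
samples is dominated by the search (`SlotCode.le_prob_code`, `Channel.exists_code`). Letting the
tolerances vanish with `B` gives codes that achieve the objective of any law
(`Channel.capacity_eq_iSup_objective`), with delay `nStar` if the laws approach the cheapest delay
among the maximizers (`Channel.exists_achieves_nStar`).
-/


/-! ### Finite product laws -/

theorem PMF.sum_coe {α : Type*} [Fintype α] (p : PMF α) : ∑ a, p a = 1 :=
  (tsum_fintype (fun a => p a)).symm.trans p.tsum_coe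

section ProductLaws

variable {ι κ Y : Type*} [Fintype ι] [DecidableEq ι] [Fintype κ] [DecidableEq κ] [Fintype Y]

/-- The law of a finite family of independent random variables with laws `p i`. -/
noncomputable def prodPMF (p : ι → PMF Y) : PMF (ι → Y) :=
  PMF.ofFintype (fun y => ∏ i, p i (y i)) (by
    rw [← Fintype.prod_sum]
    exact Finset.prod_eq_one fun i _ => (p _).sum_coe)

theorem prodPMF_apply (p : ι → PMF Y) (y : ι → Y) : prodPMF p y = ∏ i, p i (y i) := rfl

/-- The marginal law of the coordinates selected by an injective map. -/
theorem prodPMF_map_comp (p : ι → PMF Y) {e : κ → ι} (he : Function.Injective e) :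
    (prodPMF p).map (fun y => y ∘ e) = prodPMF (p ∘ e) := by
  classical
  ext z
  rw [PMF.map_apply, tsum_fintype, prodPMF_apply]
  let f : κ ⊕ ((Set.range e)ᶜ : Set ι) ≃ ι :=
    ((Equiv.ofInjective e he).sumCongr (Equiv.refl _)).trans (Equiv.Set.sumCompl (Set.range e))
  have fl : ∀ k, f (Sum.inl k) = e k := fun k => by simp [f]
  have fr : ∀ k : ((Set.range e)ᶜ : Set ι), f (Sum.inr k) = k := fun k => by simp [f]
  rw [← ((Equiv.sumArrowEquivProdArrow κ ((Set.range e)ᶜ : Set ι) Y).symm.trans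
    (f.arrowCongr (Equiv.refl Y))).sum_comp, Fintype.sum_prod_type]
  have h1 : ∀ (u : κ → Y) (v : ((Set.range e)ᶜ : Set ι) → Y),
      (((Equiv.sumArrowEquivProdArrow κ ((Set.range e)ᶜ : Set ι) Y).symm.trans
        (f.arrowCongr (Equiv.refl Y))) (u, v)) ∘ e = u := by
    intro u v
    ext k
    have : f.symm (e k) = Sum.inl k := by rw [Equiv.symm_apply_eq, fl]
    simp [Equiv.arrowCongr, this]
  have h2 : ∀ (u : κ → Y) (v : ((Set.range e)ᶜ : Set ι) → Y),
      (∏ i, p i ((((Equiv.sumArrowEquivProdArrow κ ((Set.range e)ᶜ : Set ι) Y).symm.trans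
        (f.arrowCongr (Equiv.refl Y))) (u, v)) i)) =
      (∏ k, p (e k) (u k)) * ∏ k, p (f (Sum.inr k)) (v k) := by
    intro u v
    rw [← f.prod_comp, Fintype.prod_sum_type]
    have : ∀ k, f.symm (e k) = Sum.inl k := fun k => by rw [Equiv.symm_apply_eq, fl]
    simp [Equiv.arrowCongr, fl, this, Equiv.sumArrowEquivProdArrow]
  simp only [h1, prodPMF_apply, h2]
  rw [Finset.sum_eq_single z]
  · simp only [if_true]
    rw [← Finset.mul_sum, ← Fintype.prod_sum,
      Finset.prod_eq_one (s := (Finset.univ : Finset ((Set.range e)ᶜ : Set ι)))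
        (fun i _ => (p _).sum_coe), mul_one]
    rfl
  · intro b _ hb
    simp [Ne.symm hb]
  · simp

/-- The probability of an event that depends on the coordinates in `S` only is determined by the
laws of these coordinates. -/
theorem prodPMF_congr {p q : ι → PMF Y} {E : Set (ι → Y)} (S : Set ι)
    (hE : ∀ y z, (∀ i ∈ S, y i = z i) → y ∈ E → z ∈ E) (h : ∀ i ∈ S, p i = q i) :
    (prodPMF p).toOuterMeasure E = (prodPMF q).toOuterMeasure E := by
  classical
  have key : ∀ r : ι → PMF Y, (prodPMF r).toOuterMeasure E =
      (prodPMF (r ∘ ((↑) : S → ι))).toOuterMeasure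
        {u | ∃ y ∈ E, y ∘ ((↑) : S → ι) = u} := by
    intro r
    rw [← prodPMF_map_comp r Subtype.val_injective, PMF.toOuterMeasure_map_apply]
    congr 1
    ext z
    constructor
    · exact fun hz => ⟨z, hz, rfl⟩
    · rintro ⟨y, hy, hyz⟩
      exact hE y z (fun i hi => congrFun hyz ⟨i, hi⟩) hy
  rw [key p, key q]
  congr 3
  ext1 i
  exact h i i.2

theorem prodPMF_single (p : ι → PMF Y) (i : ι) : (prodPMF p).map (fun y => y i) = p i := by
  classical
  have h := congrArg (PMF.map (fun u : Unit → Y => u ()))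
    (prodPMF_map_comp p (e := fun _ : Unit => i) (fun _ _ _ => rfl))
  rw [PMF.map_comp] at h
  refine Eq.trans h ?_
  ext a
  rw [PMF.map_apply, tsum_fintype, ← (Equiv.funUnique Unit Y).symm.sum_comp]
  simp only [Equiv.funUnique_symm_apply, uniqueElim_const, prodPMF_apply, Function.comp_apply,
    Finset.univ_unique, Finset.prod_singleton]
  exact (Finset.sum_ite_eq Finset.univ a fun x => p i x).trans (by simp)

end ProductLaws

/-! ### Events, expectations and the weak law of large numbers -/

section Expectation

theorem PMF.toOuterMeasure_univ {α : Type*} (p : PMF α) : p.toOuterMeasure Set.univ = 1 := by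
  rw [PMF.toOuterMeasure_apply, Set.indicator_univ, p.tsum_coe]

theorem PMF.toOuterMeasure_le_one {α : Type*} (p : PMF α) (s : Set α) :
    p.toOuterMeasure s ≤ 1 := by
  rw [← p.toOuterMeasure_univ]; exact MeasureTheory.measure_mono (Set.subset_univ _)

variable {α : Type*} [Fintype α]

theorem PMF.sum_toReal (p : PMF α) : ∑ a, (p a).toReal = 1 := by
  rw [← ENNReal.toReal_sum (fun a _ => p.apply_ne_top a), p.sum_coe]; rfl

theorem PMF.toOuterMeasure_add_compl (p : PMF α) (s : Set α) :
    p.toOuterMeasure s + p.toOuterMeasure sᶜ = 1 := by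
  rw [PMF.toOuterMeasure_apply_fintype, PMF.toOuterMeasure_apply_fintype,
    ← Finset.sum_add_distrib, ← p.sum_coe]
  exact Finset.sum_congr rfl fun a _ => congrFun (Set.indicator_self_add_compl s p) a

/-- Markov's inequality for a finite law. -/
theorem PMF.mul_toOuterMeasure_le (p : PMF α) (f : α → ℝ≥0∞) (c : ℝ≥0∞) :
    c * p.toOuterMeasure {a | c ≤ f a} ≤ ∑ a, p a * f a := by
  rw [PMF.toOuterMeasure_apply_fintype, Finset.mul_sum]
  refine Finset.sum_le_sum fun a _ => ?_
  by_cases h : a ∈ {a | c ≤ f a}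
  · rw [Set.indicator_of_mem h, mul_comm]
    exact mul_le_mul_right h _
  · simp [Set.indicator_of_notMem h]

theorem sum_map_mul {β : Type*} [Fintype β] (p : PMF α) (g : α → β) (f : β → ℝ) :
    ∑ b, ((p.map g) b).toReal * f b = ∑ a, (p a).toReal * f (g a) := by
  classical
  have : ∀ b, ((p.map g) b).toReal = ∑ a, if b = g a then (p a).toReal else 0 := by
    intro b
    rw [PMF.map_apply, tsum_fintype, ENNReal.toReal_sum]
    · exact Finset.sum_congr rfl fun a _ => by split_ifs <;> simp
    · intro a _; split_ifs <;> simp [p.apply_ne_top]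
  simp only [this, Finset.sum_mul]
  rw [Finset.sum_comm]
  refine Finset.sum_congr rfl fun a _ => ?_
  simp

/-- The weak law of large numbers for a function of finitely many values. -/
theorem weak_law (p : PMF α) (f : α → ℝ) {η δ : ℝ} (hη : 0 < η) (hδ : 0 < δ) :
    ∀ᶠ n : ℕ in atTop, (prodPMF fun _ : Fin n => p).toOuterMeasure
      {z | η * n ≤ |∑ i, f (z i) - n * ∑ a, (p a).toReal * f a|} ≤ ENNReal.ofReal δ := by
  classical
  let _ : MeasurableSpace α := ⊤
  set V := ProbabilityTheory.variance f p.toMeasure with hV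
  have hmem : MeasureTheory.MemLp f 2 p.toMeasure := by
    refine MeasureTheory.MemLp.of_bound (C := ∑ a, |f a|)
      (by exact Measurable.aestronglyMeasurable (fun _ _ => trivial)) ?_
    refine Filter.Eventually.of_forall fun a => ?_
    exact Finset.single_le_sum (f := fun a => |f a|) (fun _ _ => abs_nonneg _) (Finset.mem_univ a)
  have hlaw : ∀ n : ℕ, MeasureTheory.Measure.pi (fun _ : Fin n => p.toMeasure) =
      (prodPMF fun _ : Fin n => p).toMeasure := by
    intro n
    refine MeasureTheory.Measure.ext_of_singleton fun z => ?_
    rw [MeasureTheory.Measure.pi_singleton,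
      PMF.toMeasure_apply_singleton _ _ (MeasurableSet.singleton z), prodPMF_apply]
    refine Finset.prod_congr rfl fun i _ => ?_
    rw [PMF.toMeasure_apply_singleton _ _ (MeasurableSet.singleton _)]
  have hmean : ∫ a, f a ∂p.toMeasure = ∑ a, (p a).toReal * f a := by
    rw [PMF.integral_eq_sum]; rfl
  have hlim : Tendsto (fun n : ℕ => V / η ^ 2 / n) atTop (𝓝 0) :=
    tendsto_const_div_atTop_nhds_zero_nat _
  filter_upwards [hlim.eventually (gt_mem_nhds hδ), eventually_gt_atTop 0] with n hn hn0
  have hn0' : (0 : ℝ) < n := by exact_mod_cast hn0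
  have hmem' : ∀ i : Fin n, MeasureTheory.MemLp (fun z : Fin n → α => f (z i)) 2
      (MeasureTheory.Measure.pi fun _ : Fin n => p.toMeasure) := fun i =>
    hmem.comp_measurePreserving (MeasureTheory.measurePreserving_eval _ i)
  have hch := ProbabilityTheory.meas_ge_le_variance_div_sq
    (μ := MeasureTheory.Measure.pi fun _ : Fin n => p.toMeasure)
    (X := ∑ i : Fin n, fun z => f (z i)) (MeasureTheory.memLp_finsetSum' _ fun i _ => hmem' i)
    (c := η * n) (by positivity)
  rw [ProbabilityTheory.variance_sum_pi (X := fun _ => f) (fun _ => hmem)] at hch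
  have hE : ∫ z, (∑ i : Fin n, fun z : Fin n → α => f (z i)) z
      ∂(MeasureTheory.Measure.pi fun _ : Fin n => p.toMeasure) = n * ∑ a, (p a).toReal * f a := by
    simp only [Finset.sum_apply]
    rw [MeasureTheory.integral_finsetSum _
      (fun i _ => (hmem' i).integrable (by norm_num))]
    have : ∀ i : Fin n, ∫ z, f (z i) ∂(MeasureTheory.Measure.pi fun _ : Fin n => p.toMeasure) =
        ∑ a, (p a).toReal * f a := by
      intro i
      rw [← hmean, MeasureTheory.integral_comp_eval (μ := fun _ : Fin n => p.toMeasure)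
        (hmem.aestronglyMeasurable)]
    simp [this]
  rw [hE, hlaw, PMF.toMeasure_apply_eq_toOuterMeasure] at hch
  simp only [Finset.sum_apply, Finset.sum_const, Finset.card_univ, Fintype.card_fin,
    nsmul_eq_mul] at hch
  refine hch.trans (ENNReal.ofReal_le_ofReal ?_)
  refine le_trans (le_of_eq ?_) hn.le
  rw [← hV]
  field_simp

end Expectation

/-! ### Divergence on finite types -/

section Divergence

/-- Kullback-Leibler divergence of laws on a finite type, in nats, as a finite real sum.  It is the
divergence only when `p` is supported in the support of `q`. -/
noncomputable def klReal {α : Type*} [Fintype α] (p q : PMF α) : ℝ :=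
  ∑ a, (p a).toReal * Real.log ((p a).toReal / (q a).toReal)

variable {α : Type*}

theorem PMF.toReal_pos {p : PMF α} {a : α} (h : a ∈ p.support) : 0 < (p a).toReal :=
  ENNReal.toReal_pos h (p.apply_ne_top a)

theorem divBits_of_not_support_subset {p q : PMF α} (h : ¬ p.support ⊆ q.support) :
    divBits p q = ⊤ := by
  let _ : MeasurableSpace α := ⊤
  unfold divBits
  rw [InformationTheory.klDiv_of_not_ac]
  · exact ENNReal.top_div_of_ne_top ENNReal.ofReal_ne_top
  · intro hac
    obtain ⟨a, ha, hb⟩ := Set.not_subset.1 h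
    have := hac (s := {a}) (by
      rw [PMF.toMeasure_apply_singleton _ _ (by trivial)]; exact (q.apply_eq_zero_iff a).2 hb)
    rw [PMF.toMeasure_apply_singleton _ _ (by trivial)] at this
    exact (p.mem_support_iff a).1 ha this

variable [Fintype α]

theorem divBits_of_support_subset {p q : PMF α} (h : p.support ⊆ q.support) :
    divBits p q = ENNReal.ofReal (klReal p q / Real.log 2) := by
  let _ : MeasurableSpace α := ⊤
  have hac : p.toMeasure.AbsolutelyContinuous q.toMeasure := by
    intro s hs
    rw [PMF.toMeasure_apply_eq_zero_iff _ (by trivial)] at hs ⊢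
    exact hs.mono_left h
  have hint : MeasureTheory.Integrable (MeasureTheory.llr p.toMeasure q.toMeasure) p.toMeasure :=
    MeasureTheory.Integrable.of_finite
  have hrn : ∀ a ∈ q.support, p.toMeasure.rnDeriv q.toMeasure a = p a / q a := by
    intro a ha
    have h1 := congrArg (fun m => m {a}) (MeasureTheory.Measure.withDensity_rnDeriv_eq _ _ hac)
    rw [MeasureTheory.withDensity_apply _ (by trivial), MeasureTheory.lintegral_singleton,
      PMF.toMeasure_apply_singleton _ _ (by trivial),
      PMF.toMeasure_apply_singleton _ _ (by trivial)] at h1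
    rw [← h1, ENNReal.mul_div_cancel_right ((q.mem_support_iff a).1 ha) (q.apply_ne_top a)]
  have hlog2 : 0 < Real.log 2 := Real.log_pos one_lt_two
  unfold divBits
  rw [InformationTheory.klDiv_of_ac_of_integrable hac hint]
  simp only [MeasureTheory.probReal_univ, add_sub_cancel_right]
  rw [ENNReal.ofReal_div_of_pos hlog2, PMF.integral_eq_sum]
  congr 2
  refine Finset.sum_congr rfl fun a _ => ?_
  by_cases ha : a ∈ p.support
  · simp only [MeasureTheory.llr, hrn a (h ha), ENNReal.toReal_div, smul_eq_mul]
  · rw [(p.apply_eq_zero_iff a).2 ha]; simp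

/-- The change-of-measure inequality: a bounded test that is rarely passed under `q` is passed under
`p` only as often as the divergence of `p` from `q` permits. -/
theorem test_le_klReal {p q : PMF α} (h : p.support ⊆ q.support) (φ : α → ℝ)
    (h0 : ∀ a, 0 ≤ φ a) (h1 : ∀ a, φ a ≤ 1) (c : ℝ) :
    c * ∑ a, (p a).toReal * φ a ≤
      klReal p q + Real.exp c * ∑ a, (q a).toReal * φ a := by
  have hpt : ∀ a, (p a).toReal * (c * φ a) ≤
      (p a).toReal * Real.log ((p a).toReal / (q a).toReal) +
        ((q a).toReal * (1 + Real.exp c * φ a) - (p a).toReal) := by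
    intro a
    -- the chord of `exp` over `[0, c]`, then `log x ≤ x - 1` at `x = exp (c * φ a) * q a / p a`
    have hexp : Real.exp (c * φ a) ≤ 1 + Real.exp c * φ a := by
      have := convexOn_exp.2 (Set.mem_univ 0) (Set.mem_univ c) (sub_nonneg.2 (h1 a)) (h0 a)
        (by ring)
      simp only [smul_eq_mul, mul_zero, zero_add, Real.exp_zero, mul_one] at this
      rw [mul_comm (φ a) c, mul_comm (φ a)] at this
      linarith [h0 a]
    by_cases ha : a ∈ p.support
    · have hp := PMF.toReal_pos ha
      have hq := PMF.toReal_pos (h ha)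
      have hx : 0 < Real.exp (c * φ a) * ((q a).toReal / (p a).toReal) := by positivity
      have := Real.log_le_sub_one_of_pos hx
      rw [Real.log_mul (Real.exp_ne_zero _) (by positivity), Real.log_exp,
        Real.log_div hq.ne' hp.ne'] at this
      rw [Real.log_div hp.ne' hq.ne']
      have h2 := mul_le_mul_of_nonneg_left this hp.le
      have h3 : (p a).toReal * (Real.exp (c * φ a) * ((q a).toReal / (p a).toReal) - 1) =
          (q a).toReal * Real.exp (c * φ a) - (p a).toReal := by field_simp
      have h4 := mul_le_mul_of_nonneg_left hexp hq.le
      nlinarith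
    · rw [(p.apply_eq_zero_iff a).2 ha]
      simp only [ENNReal.toReal_zero, zero_mul, zero_add, sub_zero]
      have := h0 a
      positivity
  have hs := Finset.sum_le_sum fun a (_ : a ∈ Finset.univ) => hpt a
  simp only [Finset.sum_add_distrib, Finset.sum_sub_distrib, mul_add, mul_one, PMF.sum_toReal] at hs
  rw [Finset.mul_sum, Finset.mul_sum]
  unfold klReal
  calc ∑ a, c * ((p a).toReal * φ a) = ∑ a, (p a).toReal * (c * φ a) :=
        Finset.sum_congr rfl fun a _ => by ring
    _ ≤ _ := hs
    _ = _ := by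
      rw [add_sub_cancel_left]
      congr 1
      exact Finset.sum_congr rfl fun a _ => by ring

theorem klReal_nonneg {p q : PMF α} (h : p.support ⊆ q.support) : 0 ≤ klReal p q := by
  have := test_le_klReal h (fun _ => 0) (fun _ => le_rfl) (fun _ => zero_le_one) 0
  simpa using this

/-- Divergence is additive on products. -/
theorem klReal_prodPMF {ι : Type*} [Fintype ι] [DecidableEq ι] {p q : ι → PMF α}
    (h : ∀ i, (p i).support ⊆ (q i).support) :
    klReal (prodPMF p) (prodPMF q) = ∑ i, klReal (p i) (q i) := by
  have h1 : klReal (prodPMF p) (prodPMF q) = ∑ y, (prodPMF p y).toReal *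
      ∑ i, Real.log ((p i (y i)).toReal / (q i (y i)).toReal) := by
    refine Finset.sum_congr rfl fun y _ => ?_
    by_cases hy : ∀ i, y i ∈ (p i).support
    · rw [← Real.log_prod]
      · simp [prodPMF_apply, ENNReal.toReal_prod]
      · intro i _
        exact (div_pos (PMF.toReal_pos (hy i)) (PMF.toReal_pos (h i (hy i)))).ne'
    · push Not at hy
      obtain ⟨i, hi⟩ := hy
      have : prodPMF p y = 0 := by
        rw [prodPMF_apply]
        exact Finset.prod_eq_zero (Finset.mem_univ i) (((p i).apply_eq_zero_iff _).2 hi)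
      rw [this]; simp
  rw [h1]
  simp only [Finset.mul_sum]
  rw [Finset.sum_comm]
  refine Finset.sum_congr rfl fun i _ => ?_
  rw [← sum_map_mul (prodPMF p) (fun y => y i)
    (fun b => Real.log ((p i b).toReal / (q i b).toReal)), prodPMF_single]
  rfl

theorem prodPMF_support_subset {ι : Type*} [Fintype ι] [DecidableEq ι] {p q : ι → PMF α}
    (h : ∀ i, (p i).support ⊆ (q i).support) : (prodPMF p).support ⊆ (prodPMF q).support := by
  intro y hy
  rw [PMF.mem_support_iff, prodPMF_apply, Finset.prod_ne_zero_iff] at hy ⊢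
  exact fun i hi => h i (hy i hi)

end Divergence

/-! ### Mutual information of a channel -/

namespace Channel

variable {I Y : Type*} (ch : Channel I Y)

theorem outputLaw_apply (P : PMF ch.alphabet) (y : Y) :
    ch.outputLaw P y = ∑ x, P x * ch.Q x y := by
  rw [outputLaw, PMF.bind_apply, tsum_fintype]

theorem support_subset_outputLaw {P : PMF ch.alphabet} {x : ch.alphabet} (hx : x ∈ P.support) :
    (ch.Q x).support ⊆ (ch.outputLaw P).support := by
  intro y hy
  rw [outputLaw, PMF.mem_support_bind_iff]
  exact ⟨x, hx, hy⟩

theorem outputLaw_support_subset_iff {P : PMF ch.alphabet} {S : Set Y} :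
    (ch.outputLaw P).support ⊆ S ↔ ∀ x ∈ P.support, (ch.Q x).support ⊆ S := by
  constructor
  · exact fun h x hx => (ch.support_subset_outputLaw hx).trans h
  · intro h y hy
    rw [outputLaw, PMF.mem_support_bind_iff] at hy
    obtain ⟨x, hx, hy⟩ := hy
    exact h x hx hy

theorem outputLaw_apply_toReal (P : PMF ch.alphabet) (y : Y) :
    (ch.outputLaw P y).toReal = ∑ x, (P x).toReal * (ch.Q x y).toReal := by
  rw [outputLaw_apply, ENNReal.toReal_sum]
  · simp
  · exact fun x _ => ENNReal.mul_ne_top (P.apply_ne_top x) ((ch.Q x).apply_ne_top y)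

theorem mutualInfo_add_divBits_eq_top {P : PMF ch.alphabet} {r : PMF Y}
    (h : ¬ ∀ x ∈ P.support, (ch.Q x).support ⊆ r.support) :
    ch.mutualInfo P + divBits (ch.outputLaw P) r = ⊤ := by
  rw [← outputLaw_support_subset_iff] at h
  rw [divBits_of_not_support_subset h, add_top]

variable [Fintype Y]

/-- The mutual information in nats, as a finite real sum. -/
noncomputable def infoReal (P : PMF ch.alphabet) : ℝ :=
  ∑ x, (P x).toReal * klReal (ch.Q x) (ch.outputLaw P)

theorem infoReal_nonneg (P : PMF ch.alphabet) : 0 ≤ ch.infoReal P := by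
  refine Finset.sum_nonneg fun x _ => ?_
  by_cases hx : x ∈ P.support
  · exact mul_nonneg ENNReal.toReal_nonneg (klReal_nonneg (ch.support_subset_outputLaw hx))
  · rw [(P.apply_eq_zero_iff x).2 hx]; simp

theorem bind_map_mk_apply {X : Type*} [Fintype X] (P : PMF X) (W : X → PMF Y) (x : X) (y : Y) :
    (P.bind fun x => (W x).map fun y => (x, y)) (x, y) = P x * W x y := by
  classical
  rw [PMF.bind_apply, tsum_fintype, Finset.sum_eq_single x]
  · rw [PMF.map_apply, tsum_fintype]
    simp
  · intro b _ hb
    rw [PMF.map_apply, tsum_fintype]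
    simp [Ne.symm hb]
  · simp

theorem mutualInfo_eq (P : PMF ch.alphabet) :
    ch.mutualInfo P = ENNReal.ofReal (ch.infoReal P / Real.log 2) := by
  rw [mutualInfo, divBits_of_support_subset]
  · congr 2
    rw [klReal, Fintype.sum_prod_type]
    refine Finset.sum_congr rfl fun x _ => ?_
    rw [klReal, Finset.mul_sum]
    refine Finset.sum_congr rfl fun y _ => ?_
    have h1 := bind_map_mk_apply P (fun x => ch.Q x) x y
    have h2 := bind_map_mk_apply P (fun _ => ch.outputLaw P) x y
    rw [h1, h2]
    by_cases hx : x ∈ P.support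
    · have := PMF.toReal_pos hx
      rw [ENNReal.toReal_mul, ENNReal.toReal_mul, mul_div_mul_left _ _ this.ne', mul_assoc]
    · rw [(P.apply_eq_zero_iff x).2 hx]; simp
  · rintro ⟨x, y⟩ h
    rw [PMF.mem_support_iff, bind_map_mk_apply P (fun x => ch.Q x) x y, mul_ne_zero_iff] at h
    rw [PMF.mem_support_iff, bind_map_mk_apply P (fun _ => ch.outputLaw P) x y, mul_ne_zero_iff]
    exact ⟨h.1, ch.support_subset_outputLaw h.1 h.2⟩

theorem mutualInfo_ne_top (P : PMF ch.alphabet) : ch.mutualInfo P ≠ ⊤ := by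
  rw [mutualInfo_eq]; exact ENNReal.ofReal_ne_top

/-- `I(X; Y) + D(Y‖Z)` is the mean divergence of the output laws from the law of `Z`. -/
theorem infoReal_add_klReal {P : PMF ch.alphabet} {r : PMF Y}
    (h : ∀ x ∈ P.support, (ch.Q x).support ⊆ r.support) :
    ch.infoReal P + klReal (ch.outputLaw P) r = ∑ x, (P x).toReal * klReal (ch.Q x) r := by
  have h1 : klReal (ch.outputLaw P) r = ∑ x, (P x).toReal * ∑ y, (ch.Q x y).toReal *
      Real.log ((ch.outputLaw P y).toReal / (r y).toReal) := by
    rw [klReal]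
    simp only [Finset.mul_sum]
    rw [Finset.sum_comm]
    refine Finset.sum_congr rfl fun y _ => ?_
    conv_lhs => rw [outputLaw_apply_toReal, Finset.sum_mul]
    exact Finset.sum_congr rfl fun x _ => by rw [outputLaw_apply_toReal]; ring
  rw [h1, infoReal, ← Finset.sum_add_distrib]
  refine Finset.sum_congr rfl fun x _ => ?_
  rw [← mul_add]
  by_cases hx : x ∈ P.support
  · congr 1
    rw [klReal, klReal, ← Finset.sum_add_distrib]
    refine Finset.sum_congr rfl fun y _ => ?_
    by_cases hy : y ∈ (ch.Q x).support
    · have a1 := PMF.toReal_pos hy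
      have a2 := PMF.toReal_pos (ch.support_subset_outputLaw hx hy)
      have a3 := PMF.toReal_pos (h x hx hy)
      rw [Real.log_div a1.ne' a2.ne', Real.log_div a2.ne' a3.ne', Real.log_div a1.ne' a3.ne']
      ring
    · rw [((ch.Q x).apply_eq_zero_iff y).2 hy]; simp
  · rw [(P.apply_eq_zero_iff x).2 hx]; simp

theorem mutualInfo_add_divBits {P : PMF ch.alphabet} {r : PMF Y}
    (h : ∀ x ∈ P.support, (ch.Q x).support ⊆ r.support) :
    ch.mutualInfo P + divBits (ch.outputLaw P) r =
      ENNReal.ofReal ((∑ x, (P x).toReal * klReal (ch.Q x) r) / Real.log 2) := by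
  have hs := ch.outputLaw_support_subset_iff.2 h
  rw [mutualInfo_eq, divBits_of_support_subset hs, ← infoReal_add_klReal ch h, add_div,
    ENNReal.ofReal_add (div_nonneg (ch.infoReal_nonneg P) (Real.log_nonneg one_le_two))
      (div_nonneg (klReal_nonneg hs) (Real.log_nonneg one_le_two))]

end Channel

/-! ### Receivers do not anticipate -/

namespace Receiver

variable {Y : Type*} {N M : ℕ} (r : Receiver Y N M)

theorem one_le_tau (y : Fin N → Y) : 1 ≤ r.tau y := by
  classical
  exact (Nat.find_spec (r.stops y)).1

theorem observed_tau_mem (y : Fin N → Y) : observed r.next y (r.tau y) ∈ r.stopSet := by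
  classical
  exact (Nat.find_spec (r.stops y)).2

theorem observed_notMem {y : Fin N → Y} {j : ℕ} (h1 : 1 ≤ j) (h : j < r.tau y) :
    observed r.next y j ∉ r.stopSet := by
  classical
  exact fun hm => Nat.find_min (r.stops y) h ⟨h1, hm⟩

theorem tau_eq {y : Fin N → Y} {k : ℕ} (h1 : 1 ≤ k) (h : observed r.next y k ∈ r.stopSet)
    (hlt : ∀ j, 1 ≤ j → j < k → observed r.next y j ∉ r.stopSet) : r.tau y = k := by
  classical
  exact (Nat.find_eq_iff (r.stops y)).2 ⟨⟨h1, h⟩, fun j hj hh => hlt j hh.1 hj hh.2⟩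

theorem next_lt {y : Fin N → Y} {j : ℕ} (h : j + 1 < r.tau y) :
    r.next (observed r.next y j) < r.next (observed r.next y (j + 1)) :=
  r.increasing y j fun _ h1 h2 => r.observed_notMem h1 (by omega)

theorem next_lt_decisionTime {y : Fin N → Y} {j : ℕ} (h : j < r.tau y) :
    (r.next (observed r.next y j) : ℕ) < r.decisionTime y := by
  unfold decisionTime
  obtain ⟨d, hd⟩ := Nat.exists_eq_add_of_lt h
  have key : ∀ e, j + e < r.tau y →
      (r.next (observed r.next y j) : ℕ) ≤ r.next (observed r.next y (j + e)) := by
    intro e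
    induction e with
    | zero => intro _; simp
    | succ e ih =>
      intro he
      have h2 : (r.next (observed r.next y (j + e)) : ℕ) <
          r.next (observed r.next y (j + e + 1)) := r.next_lt (by omega)
      have := ih (by omega)
      rw [← add_assoc]
      omega
  have := key d (by omega)
  rw [hd, Nat.add_sub_cancel]
  omega

theorem decisionTime_le (y : Fin N → Y) : r.decisionTime y ≤ N := by
  unfold decisionTime
  omega

theorem observed_congr {y z : Fin N → Y} {T : ℕ}
    (hyz : ∀ i : Fin N, (i : ℕ) < T → y i = z i) (hT : r.decisionTime y ≤ T) {j : ℕ}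
    (hj : j ≤ r.tau y) :
    observed r.next z j = observed r.next y j := by
  induction j with
  | zero => rfl
  | succ j ih =>
    have h1 := ih (by omega)
    have h2 := r.next_lt_decisionTime (y := y) (j := j) (by omega)
    simp only [observed, h1]
    rw [hyz _ (by omega)]

/-- The receiver does not anticipate: its decision, if taken by time `T`, depends on the outputs up
to time `T` only. -/
theorem congr_of_decisionTime_le {y z : Fin N → Y} {T : ℕ}
    (hyz : ∀ i : Fin N, (i : ℕ) < T → y i = z i) (hT : r.decisionTime y ≤ T) :
    r.tau z = r.tau y ∧ r.decisionTime z = r.decisionTime y ∧ r.message z = r.message y := by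
  have h : r.tau z = r.tau y := by
    refine r.tau_eq (r.one_le_tau y) ?_ fun j h1 h2 => ?_
    · rw [r.observed_congr hyz hT le_rfl]; exact r.observed_tau_mem y
    · rw [r.observed_congr hyz hT h2.le]; exact r.observed_notMem h1 h2
  refine ⟨h, ?_, ?_⟩
  · unfold decisionTime
    rw [h, r.observed_congr hyz hT (Nat.sub_le _ _)]
  · unfold message
    rw [h, r.observed_congr hyz hT le_rfl]

end Receiver

/-! ### Independent randomization -/

section Mixture

variable {R ι Y : Type*} [Fintype ι] [DecidableEq ι] [Fintype Y]

/-- The probability of an event that depends on a random element of law `w` and, independently, on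
random variables with laws `p i`. -/
noncomputable def mixProb (w : PMF R) (p : ι → PMF Y) (E : R → Set (ι → Y)) : ℝ≥0∞ :=
  ∑' r, w r * (prodPMF p).toOuterMeasure (E r)

variable (w : PMF R) (p : ι → PMF Y)

theorem mixProb_eq_sum (E : R → Set (ι → Y)) :
    mixProb w p E = ∑ y, prodPMF p y * w.toOuterMeasure {r | y ∈ E r} := by
  classical
  simp only [mixProb, PMF.toOuterMeasure_apply_fintype, PMF.toOuterMeasure_apply, Finset.mul_sum,
    ← ENNReal.tsum_mul_left]
  rw [Summable.tsum_finsetSum (fun _ _ => ENNReal.summable)]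
  refine Finset.sum_congr rfl fun y _ => tsum_congr fun r => ?_
  by_cases h : y ∈ E r
  · rw [Set.indicator_of_mem h, Set.indicator_of_mem (by exact h), mul_comm]
  · rw [Set.indicator_of_notMem h, Set.indicator_of_notMem (by exact h)]; simp

theorem mixProb_mono {E F : R → Set (ι → Y)} (h : ∀ r, E r ⊆ F r) :
    mixProb w p E ≤ mixProb w p F :=
  ENNReal.tsum_le_tsum fun r => by gcongr; exact h r

theorem mixProb_add_compl (E : R → Set (ι → Y)) :
    mixProb w p E + mixProb w p (fun r => (E r)ᶜ) = 1 := by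
  rw [mixProb, mixProb, ← ENNReal.tsum_add]
  simp only [← mul_add, PMF.toOuterMeasure_add_compl, mul_one, PMF.tsum_coe]

theorem mixProb_le_one (E : R → Set (ι → Y)) : mixProb w p E ≤ 1 := by
  rw [← mixProb_add_compl w p E]; exact le_self_add

theorem mixProb_ne_top (E : R → Set (ι → Y)) : mixProb w p E ≠ ⊤ :=
  ne_top_of_le_ne_top ENNReal.one_ne_top (mixProb_le_one w p E)

theorem mixProb_univ : mixProb w p (fun _ => Set.univ) = 1 := by
  simp only [mixProb, PMF.toOuterMeasure_univ, mul_one, PMF.tsum_coe]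

theorem mixProb_union_le (E F : R → Set (ι → Y)) :
    mixProb w p (fun r => E r ∪ F r) ≤ mixProb w p E + mixProb w p F := by
  rw [mixProb, mixProb, mixProb, ← ENNReal.tsum_add]
  refine ENNReal.tsum_le_tsum fun r => ?_
  rw [← mul_add]
  gcongr
  exact MeasureTheory.measure_union_le _ _

/-- If at most `K` of the events can occur simultaneously, their probabilities sum to at most `K`.
-/
theorem mixProb_sum_le {κ : Type*} (T : Finset κ) (E : κ → R → Set (ι → Y)) (K : ℕ)
    (h : ∀ r y, Set.encard {k | k ∈ T ∧ y ∈ E k r} ≤ K) :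
    ∑ k ∈ T, mixProb w p (E k) ≤ K := by
  classical
  simp only [mixProb]
  rw [← Summable.tsum_finsetSum (fun _ _ => ENNReal.summable)]
  calc ∑' r, ∑ k ∈ T, w r * (prodPMF p).toOuterMeasure (E k r)
      ≤ ∑' r, w r * K := by
        refine ENNReal.tsum_le_tsum fun r => ?_
        rw [← Finset.mul_sum]
        gcongr
        simp only [PMF.toOuterMeasure_apply_fintype]
        rw [Finset.sum_comm]
        calc ∑ y, ∑ k ∈ T, (E k r).indicator (prodPMF p) y
            ≤ ∑ y, prodPMF p y * K := by
              refine Finset.sum_le_sum fun y _ => ?_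
              simp only [Set.indicator_apply]
              rw [← Finset.sum_filter, Finset.sum_const, nsmul_eq_mul, mul_comm]
              gcongr
              have := h r y
              have hs : {k | k ∈ T ∧ y ∈ E k r} =
                  ((T.filter fun k => y ∈ E k r : Finset κ) : Set κ) := by
                ext k; simp
              rw [hs, Set.encard_coe_eq_coe_finsetCard] at this
              exact_mod_cast this
          _ = K := by rw [← Finset.sum_mul, PMF.sum_coe, one_mul]
    _ = K := by rw [ENNReal.tsum_mul_right, PMF.tsum_coe, one_mul]

theorem mixProb_congr {p q : ι → PMF Y} {E : R → Set (ι → Y)} (S : Set ι)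
    (hE : ∀ r y z, (∀ i ∈ S, y i = z i) → y ∈ E r → z ∈ E r) (h : ∀ i ∈ S, p i = q i) :
    mixProb w p E = mixProb w q E :=
  tsum_congr fun r => by rw [prodPMF_congr S (hE r) h]

/-- The change-of-measure inequality for a randomized event and independent random variables. -/
theorem mixProb_test_le {p q : ι → PMF Y} (h : ∀ i, (p i).support ⊆ (q i).support)
    (E : R → Set (ι → Y)) (c : ℝ) :
    c * (mixProb w p E).toReal ≤
      ∑ i, klReal (p i) (q i) + Real.exp c * (mixProb w q E).toReal := by
  have hr : ∀ p : ι → PMF Y, (mixProb w p E).toReal =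
      ∑ y, (prodPMF p y).toReal * (w.toOuterMeasure {r | y ∈ E r}).toReal := by
    intro p
    rw [mixProb_eq_sum, ENNReal.toReal_sum]
    · simp
    · exact fun y _ => ENNReal.mul_ne_top (PMF.apply_ne_top _ _)
        (ne_top_of_le_ne_top ENNReal.one_ne_top (PMF.toOuterMeasure_le_one _ _))
  rw [hr, hr, ← klReal_prodPMF h]
  refine test_le_klReal (prodPMF_support_subset h) _ (fun _ => ENNReal.toReal_nonneg)
    (fun y => ?_) c
  exact ENNReal.toReal_le_of_le_ofReal zero_le_one (by simpa using PMF.toOuterMeasure_le_one _ _)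

end Mixture

/-! ### Probabilities and performance measures of a code -/

namespace Code

variable {I Y : Type*} {ch : Channel I Y} {B A : ℕ} (C : Code ch B A)

theorem input_of_lt_start {m : Fin (2 ^ B)} {t : Fin A} {i : Fin (A + C.n - 1)}
    (h : (i : ℕ) < C.start t m) : C.input m t i = ch.star := by
  rw [input, dif_neg (by omega)]

variable [Fintype Y]

theorem probAt_eq (m : Fin (2 ^ B)) (t : Fin A)
    (E : Receiver Y (A + C.n - 1) (2 ^ B) → Set (Fin (A + C.n - 1) → Y)) :
    C.probAt m t E = mixProb C.receiver (fun i => ch.Q (C.input m t i)) E := by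
  simp only [probAt, mixProb, PMF.toOuterMeasure_apply_fintype]
  rfl

theorem prob_univ (hA : 0 < A) (m : Fin (2 ^ B)) : C.prob m (fun _ _ => Set.univ) = 1 := by
  simp only [prob, probAt_eq, mixProb_univ, Finset.sum_const, Finset.card_univ, Fintype.card_fin,
    nsmul_eq_mul, mul_one]
  exact ENNReal.inv_mul_cancel (by exact_mod_cast hA.ne') (ENNReal.natCast_ne_top A)

theorem sum_probAt (hA : 0 < A) (m : Fin (2 ^ B))
    (E : Fin A → Receiver Y (A + C.n - 1) (2 ^ B) → Set (Fin (A + C.n - 1) → Y)) :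
    ∑ t, C.probAt m t (E t) = A * C.prob m E := by
  rw [prob, ← mul_assoc, ENNReal.mul_inv_cancel (by exact_mod_cast hA.ne')
    (ENNReal.natCast_ne_top A), one_mul]

theorem prob_mono (m : Fin (2 ^ B))
    {E F : Fin A → Receiver Y (A + C.n - 1) (2 ^ B) → Set (Fin (A + C.n - 1) → Y)}
    (h : ∀ t r, E t r ⊆ F t r) : C.prob m E ≤ C.prob m F := by
  unfold prob
  gcongr with t
  rw [probAt_eq, probAt_eq]
  exact mixProb_mono _ _ (h t)

theorem prob_add_compl (hA : 0 < A) (m : Fin (2 ^ B))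
    (E : Fin A → Receiver Y (A + C.n - 1) (2 ^ B) → Set (Fin (A + C.n - 1) → Y)) :
    C.prob m E + C.prob m (fun t r => (E t r)ᶜ) = 1 := by
  rw [← C.prob_univ hA m, prob, prob, prob, ← mul_add, ← Finset.sum_add_distrib]
  congr 1
  refine Finset.sum_congr rfl fun t _ => ?_
  rw [probAt_eq, probAt_eq, probAt_eq, mixProb_add_compl, mixProb_univ]

/-- The delay is attained: it is the minimum of a nonempty set of natural numbers. -/
theorem delay_spec (hA : 0 < A) (ε : ℝ) (m : Fin (2 ^ B)) :
    1 - ENNReal.ofReal ε ≤ C.prob m fun t r =>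
      {y | (r.decisionTime y : ℤ) - ((t : ℤ) + 1) ≤ (C.delay ε : ℤ) - 1} := by
  have hne : {l : ℕ | 1 - ENNReal.ofReal ε ≤ ⨅ m, C.prob m fun t rc =>
      {y | (rc.decisionTime y : ℤ) - ((t : ℤ) + 1) ≤ (l : ℤ) - 1}}.Nonempty := by
    refine ⟨A + C.n, ?_⟩
    rw [Set.mem_ofPred_eq]
    refine le_iInf fun m => ?_
    rw [show (fun (t : Fin A) (rc : Receiver Y (A + C.n - 1) (2 ^ B)) =>
      {y | (rc.decisionTime y : ℤ) - ((t : ℤ) + 1) ≤ ((A + C.n : ℕ) : ℤ) - 1}) =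
        fun _ _ => Set.univ from ?_, C.prob_univ hA]
    · exact tsub_le_self
    · funext t r
      ext y
      have := r.decisionTime_le y
      simp only [Set.mem_ofPred_eq, Set.mem_univ, iff_true]
      omega
  exact (Nat.sInf_mem hne).trans (iInf_le _ m)

theorem samplingFreq_le_of_forall {ε ρ : ℝ} (hρ : 0 ≤ ρ)
    (h : ∀ m, 1 - ENNReal.ofReal ε ≤
      C.prob m fun _ r => {y | (r.tau y : ℝ) / r.decisionTime y ≤ ρ}) :
    C.samplingFreq ε ≤ ρ :=
  csInf_le ⟨0, fun _ h => h.1⟩ ⟨hρ, le_iInf h⟩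

end Code

/-! ### Converse: change of measure for messages with a common start time -/

theorem PMF.sum_map_mul_ennreal {α β : Type*} [Fintype α] [Fintype β] (p : PMF α) (g : α → β)
    (f : β → ℝ≥0∞) : ∑ b, (p.map g) b * f b = ∑ a, p a * f (g a) := by
  classical
  simp only [PMF.map_apply, tsum_fintype, Finset.sum_mul]
  rw [Finset.sum_comm]
  refine Finset.sum_congr rfl fun a _ => ?_
  simp

namespace Code

variable {I Y : Type*} {ch : Channel I Y} {B A : ℕ} (C : Code ch B A)

/-- The law of a code symbol drawn uniformly from the first `n'` symbols of the codewords of the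
messages in `G`. -/
noncomputable def symbolLaw (G : Finset (Fin (2 ^ B))) (hG : G.Nonempty) {n' : ℕ} (hn : 0 < n')
    (hn' : n' ≤ C.n) : PMF ch.alphabet :=
  (PMF.uniformOfFinset (G ×ˢ (Finset.univ : Finset (Fin n')))
    (hG.product ⟨⟨0, hn⟩, Finset.mem_univ _⟩)).map fun mi => C.codeword mi.1 (Fin.castLE hn' mi.2)

section

variable {G : Finset (Fin (2 ^ B))} (hG : G.Nonempty) {n' : ℕ} (hn : 0 < n') (hn' : n' ≤ C.n)

theorem mem_support_symbolLaw {m : Fin (2 ^ B)} (hm : m ∈ G) (j : Fin n') :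
    C.codeword m (Fin.castLE hn' j) ∈ (C.symbolLaw G hG hn hn').support := by
  rw [symbolLaw, PMF.mem_support_map_iff]
  exact ⟨(m, j), by simpa using hm, rfl⟩

theorem sum_symbolLaw (f : ch.alphabet → ℝ) :
    (G.card : ℝ) * (n' * ∑ x, (C.symbolLaw G hG hn hn' x).toReal * f x) =
      ∑ m ∈ G, ∑ j : Fin n', f (C.codeword m (Fin.castLE hn' j)) := by
  classical
  rw [symbolLaw, sum_map_mul]
  have h : ∀ mi : Fin (2 ^ B) × Fin n', (PMF.uniformOfFinset
      (G ×ˢ (Finset.univ : Finset (Fin n'))) (hG.product ⟨⟨0, hn⟩, Finset.mem_univ _⟩) mi).toReal =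
      if mi.1 ∈ G then ((G.card : ℝ) * n')⁻¹ else 0 := by
    intro mi
    rw [PMF.uniformOfFinset_apply]
    split_ifs with h1 h2 h2
    · simp
    · simp at h1; exact absurd h1 h2
    · simp at h1; exact absurd h2 h1
    · simp
  simp only [h, Fintype.sum_prod_type, ite_mul, zero_mul]
  have hG0 : (G.card : ℝ) ≠ 0 := by exact_mod_cast hG.card_pos.ne'
  have hn0 : (n' : ℝ) ≠ 0 := by exact_mod_cast hn.ne'
  rw [← mul_assoc, Finset.mul_sum, ← Finset.sum_filter_add_sum_filter_not Finset.univ (· ∈ G)]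
  rw [Finset.sum_eq_zero (s := Finset.univ.filter fun m => ¬ m ∈ G), add_zero,
    Finset.filter_univ_mem]
  · refine Finset.sum_congr rfl fun m hm => ?_
    simp only [if_pos hm]
    rw [← Finset.mul_sum]
    field_simp
  · intro m hm
    rw [Finset.mem_filter] at hm
    simp [hm.2]

theorem expCost_symbolLaw_le [Fintype Y] :
    n' * ch.expCost (C.symbolLaw G hG hn hn') ≤ C.maxCost := by
  classical
  rw [Channel.expCost, symbolLaw, PMF.sum_map_mul_ennreal]
  have h : ∀ mi : Fin (2 ^ B) × Fin n', PMF.uniformOfFinset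
      (G ×ˢ (Finset.univ : Finset (Fin n'))) (hG.product ⟨⟨0, hn⟩, Finset.mem_univ _⟩) mi =
      if mi.1 ∈ G then ((G.card : ℝ≥0∞) * n')⁻¹ else 0 := by
    intro mi
    rw [PMF.uniformOfFinset_apply]
    split_ifs with h1 h2 h2
    · simp
    · simp at h1; exact absurd h1 h2
    · simp at h1; exact absurd h2 h1
    · simp
  simp only [h, Fintype.sum_prod_type, ite_mul, zero_mul]
  have hG0 : (G.card : ℝ≥0∞) ≠ 0 := by exact_mod_cast hG.card_pos.ne'
  have hn0 : (n' : ℝ≥0∞) ≠ 0 := by exact_mod_cast hn.ne'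
  have hG1 : (G.card : ℝ≥0∞) ≠ ⊤ := ENNReal.natCast_ne_top _
  have hn1 : (n' : ℝ≥0∞) ≠ ⊤ := ENNReal.natCast_ne_top _
  calc (n' : ℝ≥0∞) * ∑ m, ∑ j : Fin n', (if m ∈ G then
        ((G.card : ℝ≥0∞) * n')⁻¹ * ch.cost (C.codeword m (Fin.castLE hn' j)) else 0)
      = n' * ∑ m ∈ G, ((G.card : ℝ≥0∞) * n')⁻¹ *
          ∑ j : Fin n', ch.cost (C.codeword m (Fin.castLE hn' j)) := by
        congr 1
        rw [← Finset.filter_univ_mem G, Finset.sum_filter]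
        refine Finset.sum_congr rfl fun m _ => ?_
        simp only [Finset.filter_univ_mem]
        split_ifs
        · rw [Finset.mul_sum]
        · simp
    _ ≤ n' * ∑ m ∈ G, ((G.card : ℝ≥0∞) * n')⁻¹ * C.maxCost := by
        gcongr with m hm
        refine le_trans ?_ (le_iSup (fun m => ∑ i, ch.cost (C.codeword m i)) m)
        rw [← Finset.sum_image (s := Finset.univ) (g := Fin.castLE hn')
          (f := fun i => ch.cost (C.codeword m i))]
        · exact Finset.sum_le_sum_of_subset (Finset.subset_univ _)
        · exact fun a _ b _ h => Fin.castLE_injective hn' h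
    _ = C.maxCost := by
        rw [Finset.sum_const, nsmul_eq_mul, ← mul_assoc, ← mul_assoc, mul_comm (n' : ℝ≥0∞),
          ENNReal.mul_inv_cancel (mul_ne_zero hG0 hn0) (ENNReal.mul_ne_top hG1 hn1), one_mul]

end

/-- The decision for message `m` falls within the `D` times that follow its arrival. -/
def timelyDecision (m : Fin (2 ^ B)) (t : Fin A) (D : ℕ)
    (r : Receiver Y (A + C.n - 1) (2 ^ B)) : Set (Fin (A + C.n - 1) → Y) :=
  {y | r.message y = m ∧ (t : ℕ) < r.decisionTime y ∧ r.decisionTime y ≤ t + D}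

theorem timelyDecision_congr {m : Fin (2 ^ B)} {t : Fin A} {D : ℕ}
    (r : Receiver Y (A + C.n - 1) (2 ^ B)) (y z : Fin (A + C.n - 1) → Y)
    (h : ∀ i ∈ {i : Fin (A + C.n - 1) | (i : ℕ) < t + D}, y i = z i)
    (hy : y ∈ C.timelyDecision m t D r) : z ∈ C.timelyDecision m t D r := by
  obtain ⟨h1, h2, h3⟩ := hy
  obtain ⟨_, e2, e3⟩ := r.congr_of_decisionTime_le (z := z) (fun i hi => h i hi) h3
  exact ⟨e3.trans h1, by rw [e2]; exact h2, by rw [e2]; exact h3⟩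

variable [Fintype Y]

/-- Change of measure for messages with a common start time: when the symbols sent before time
`t + D` are replaced by symbols of output law `q`, timely decisions for the messages in `G` must
become rare if they are to be told apart, or from noise. -/
theorem window_test {t : Fin A} {D : ℕ} {G : Finset (Fin (2 ^ B))} (hG : G.Nonempty) {s : ℕ}
    (hs : ∀ m ∈ G, (C.start t m : ℕ) = s)
    {n' : ℕ} (hn : 0 < n') (hn' : n' ≤ C.n) (hn'' : s + n' ≤ t + D) (hw : n' = C.n ∨ s + n' = t + D)
    (q : PMF Y) (hq : ∀ x ∈ (C.symbolLaw G hG hn hn').support, (ch.Q x).support ⊆ q.support)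
    {δ a : ℝ} (ha : 0 ≤ a)
    (hgood : ∀ m ∈ G, 1 - δ ≤ (C.probAt m t (C.timelyDecision m t D)).toReal)
    (href : Real.exp a * ∑ m ∈ G, (mixProb C.receiver
      (fun i : Fin (A + C.n - 1) => if s ≤ (i : ℕ) ∧ (i : ℕ) < s + n' then q else ch.Q ch.star)
      (C.timelyDecision m t D)).toReal ≤ G.card) :
    a * (1 - δ) ≤ n' * ∑ x, (C.symbolLaw G hG hn hn' x).toReal * klReal (ch.Q x) q + 1 := by
  set ref : Fin (A + C.n - 1) → PMF Y :=
    fun i => if s ≤ (i : ℕ) ∧ (i : ℕ) < s + n' then q else ch.Q ch.star with href'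
  have hGc : (0 : ℝ) < G.card := by exact_mod_cast hG.card_pos
  have hsA : s < A := by
    obtain ⟨m, hm⟩ := hG
    rw [← hs m hm]; exact (C.start t m).2
  have key : ∀ m ∈ G, a * (1 - δ) ≤
      ∑ j : Fin n', klReal (ch.Q (C.codeword m (Fin.castLE hn' j))) q +
        Real.exp a * (mixProb C.receiver ref (C.timelyDecision m t D)).toReal := by
    intro m hm
    have hsm := hs m hm
    -- the true law, with the inputs after the window silenced: a timely decision ignores them
    set tr : Fin (A + C.n - 1) → PMF Y :=
      fun i => if (i : ℕ) < t + D then ch.Q (C.input m t i) else ch.Q ch.star with htr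
    have e1 : C.probAt m t (C.timelyDecision m t D) =
        mixProb C.receiver tr (C.timelyDecision m t D) := by
      rw [probAt_eq]
      refine mixProb_congr _ {i | (i : ℕ) < t + D} C.timelyDecision_congr fun i hi => ?_
      rw [htr]
      exact (if_pos hi).symm
    have hin : ∀ j : Fin n', ∀ h : s + (j : ℕ) < A + C.n - 1,
        tr ⟨s + j, h⟩ = ch.Q (C.codeword m (Fin.castLE hn' j)) := by
      intro j h
      have hj := j.2
      simp only [htr]
      rw [if_pos (by omega), input, dif_pos (by constructor <;> simp only [] <;> omega)]
      congr 3
      ext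
      simp [hsm]
    have hout : ∀ i : Fin (A + C.n - 1), ¬ (s ≤ (i : ℕ) ∧ (i : ℕ) < s + n') →
        tr i = ch.Q ch.star := by
      intro i hi
      simp only [htr]
      split_ifs with h
      · rw [input, dif_neg]
        omega
      · rfl
    -- outside the `n'` symbols, the true law and the reference law agree
    have hsupp : ∀ i, (tr i).support ⊆ (ref i).support := by
      intro i
      by_cases hi : s ≤ (i : ℕ) ∧ (i : ℕ) < s + n'
      · have e := hin ⟨(i : ℕ) - s, by omega⟩ (by simp only []; omega)
        have e2 : (⟨s + ((⟨(i : ℕ) - s, by omega⟩ : Fin n') : ℕ), by simp only []; omega⟩ :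
            Fin (A + C.n - 1)) = i := by ext; simp only []; omega
        rw [e2] at e
        simp only [href', if_pos hi, e]
        exact hq _ (C.mem_support_symbolLaw hG hn hn' hm _)
      · rw [hout i hi]
        simp only [href', if_neg hi, subset_refl]
    have hkl : ∑ i, klReal (tr i) (ref i) =
        ∑ j : Fin n', klReal (ch.Q (C.codeword m (Fin.castLE hn' j))) q := by
      symm
      refine Finset.sum_of_injOn (fun j : Fin n' => (⟨s + j, by omega⟩ : Fin (A + C.n - 1)))
        ?_ (fun _ _ => by simp) ?_ ?_
      · intro i _ j _ h
        simp only [Fin.mk.injEq] at h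
        ext; omega
      · intro i _ hi
        have : ¬ (s ≤ (i : ℕ) ∧ (i : ℕ) < s + n') := by
          intro h
          refine hi ⟨⟨(i : ℕ) - s, by omega⟩, by simp, ?_⟩
          ext; simp only []; omega
        rw [hout i this]
        simp only [href', if_neg this]
        refine Finset.sum_eq_zero fun y _ => ?_
        by_cases hy : (ch.Q ch.star y).toReal = 0
        · simp [hy]
        · rw [div_self hy]; simp
      · intro j _
        have hj := j.2
        rw [hin j]
        simp only [href']
        rw [if_pos (by constructor <;> omega)]
    have := mixProb_test_le C.receiver hsupp (C.timelyDecision m t D) a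
    rw [hkl, ← e1] at this
    exact (mul_le_mul_of_nonneg_left (hgood m hm) ha).trans this
  have hsum := Finset.sum_le_sum key
  rw [Finset.sum_const, nsmul_eq_mul, Finset.sum_add_distrib, ← Finset.mul_sum,
    ← C.sum_symbolLaw hG hn hn' (fun x => klReal (ch.Q x) q)] at hsum
  refine le_of_mul_le_mul_left ?_ hGc
  rw [mul_add, mul_one]
  exact hsum.trans (add_le_add le_rfl href)

end Code

/-! ### Converse: messages with a common start time -/

namespace Code

variable {I Y : Type*} {ch : Channel I Y} {B A : ℕ} (C : Code ch B A) [Fintype Y]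

/-- Timely decisions are rare under pure noise. -/
theorem sum_noise_le (D : ℕ) :
    ∑ t : Fin A, ∑ m, (mixProb C.receiver (fun _ => ch.Q ch.star)
      (C.timelyDecision m t D)).toReal ≤ D := by
  classical
  have h := mixProb_sum_le C.receiver (fun _ => ch.Q ch.star)
    (Finset.univ : Finset (Fin A × Fin (2 ^ B))) (fun k => C.timelyDecision k.2 k.1 D) D ?_
  · have h2 := ENNReal.toReal_mono (ENNReal.natCast_ne_top D) h
    rw [ENNReal.toReal_sum (fun _ _ => mixProb_ne_top _ _ _), Fintype.sum_prod_type] at h2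
    simpa using h2
  · intro r y
    -- the decision time and the message leave at most `D` possible arrival times
    have hinj : Set.InjOn (fun k : Fin A × Fin (2 ^ B) => (k.1 : ℕ))
        {k | k ∈ (Finset.univ : Finset (Fin A × Fin (2 ^ B))) ∧
          y ∈ C.timelyDecision k.2 k.1 D r} := by
      rintro ⟨t, m⟩ ⟨_, h1, _⟩ ⟨t', m'⟩ ⟨_, h1', _⟩ h
      exact Prod.ext (Fin.ext h) (h1.symm.trans h1')
    rw [← hinj.encard_image]
    calc _ ≤ (Set.Ico (r.decisionTime y - D) (r.decisionTime y)).encard := by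
          refine Set.encard_le_encard ?_
          rintro _ ⟨⟨t, m⟩, ⟨_, _, h2, h3⟩, rfl⟩
          simp only [Set.mem_Ico]
          simp only at h2 h3
          omega
      _ ≤ D := by
          rw [← Finset.coe_Ico, Set.encard_coe_eq_coe_finsetCard, Nat.card_Ico]
          exact_mod_cast (by omega)

/-- A reliable receiver with small delay usually takes a timely decision: being right before the
message has arrived is a matter of luck. -/
theorem sum_one_sub_timely_le (hA : 0 < A) {ε : ℝ} (hε : 0 ≤ ε) {D : ℕ}
    (herr : C.errorProb ≤ ENNReal.ofReal ε)
    (hdel : ∀ m, 1 - ENNReal.ofReal ε ≤ C.prob m fun t r => {y | r.decisionTime y ≤ t + D}) :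
    ∑ t, ∑ m, (1 - (C.probAt m t (C.timelyDecision m t D)).toReal) ≤
      A * (2 * ε * 2 ^ B + 1) := by
  classical
  have hne : ∀ m t E, C.probAt m t E ≠ ⊤ := fun m t E => by
    rw [probAt_eq]; exact mixProb_ne_top _ _ _
  set early : Fin (2 ^ B) → Fin A → Receiver Y (A + C.n - 1) (2 ^ B) →
    Set (Fin (A + C.n - 1) → Y) := fun m t r => {y | r.message y = m ∧ r.decisionTime y ≤ t}
    with hearly
  have hsplit : ∀ m t, 1 - (C.probAt m t (C.timelyDecision m t D)).toReal ≤
      (C.probAt m t (fun r => {y | r.message y ≠ m})).toReal +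
      (C.probAt m t (fun r => {y | r.decisionTime y ≤ t + D}ᶜ)).toReal +
      (C.probAt m t (early m t)).toReal := by
    intro m t
    have h : 1 ≤ C.probAt m t (C.timelyDecision m t D) +
        (C.probAt m t (fun r => {y | r.message y ≠ m}) +
        C.probAt m t (fun r => {y | r.decisionTime y ≤ t + D}ᶜ) + C.probAt m t (early m t)) := by
      simp only [probAt_eq]
      rw [← mixProb_univ C.receiver (fun i => ch.Q (C.input m t i))]
      refine le_trans (mixProb_mono _ _ fun r => ?_) ((mixProb_union_le _ _ _ _).trans
        (add_le_add le_rfl ((mixProb_union_le _ _ _ _).trans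
          (add_le_add (mixProb_union_le _ _ _ _) le_rfl))))
      intro y _
      simp only [hearly, timelyDecision, Set.mem_union, Set.mem_ofPred_eq, Set.mem_compl_iff]
      by_cases h1 : r.message y = m
      · by_cases h2 : r.decisionTime y ≤ t + D
        · by_cases h3 : (t : ℕ) < r.decisionTime y
          · exact Or.inl ⟨h1, h3, h2⟩
          · exact Or.inr (Or.inr ⟨h1, by omega⟩)
        · exact Or.inr (Or.inl (Or.inr h2))
      · exact Or.inr (Or.inl (Or.inl h1))
    have h' := ENNReal.toReal_mono (ENNReal.add_ne_top.2 ⟨hne _ _ _, ENNReal.add_ne_top.2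
      ⟨ENNReal.add_ne_top.2 ⟨hne _ _ _, hne _ _ _⟩, hne _ _ _⟩⟩) h
    rw [ENNReal.toReal_add (hne _ _ _) (ENNReal.add_ne_top.2
      ⟨ENNReal.add_ne_top.2 ⟨hne _ _ _, hne _ _ _⟩, hne _ _ _⟩), ENNReal.toReal_add
      (ENNReal.add_ne_top.2 ⟨hne _ _ _, hne _ _ _⟩) (hne _ _ _),
      ENNReal.toReal_add (hne _ _ _) (hne _ _ _), ENNReal.toReal_one] at h'
    linarith
  have hA0 : (0 : ℝ) ≤ A := Nat.cast_nonneg A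
  have hp : ∀ m E, C.prob m E ≤ ENNReal.ofReal ε →
      ∑ t, (C.probAt m t (E t)).toReal ≤ A * ε := by
    intro m E hE
    rw [← ENNReal.toReal_sum (fun t _ => hne _ _ _), C.sum_probAt hA, ENNReal.toReal_mul,
      ENNReal.toReal_natCast]
    exact mul_le_mul_of_nonneg_left (ENNReal.toReal_le_of_le_ofReal hε hE) hA0
  have h1 : ∀ m, ∑ t, (C.probAt m t (fun r => {y | r.message y ≠ m})).toReal ≤ A * ε :=
    fun m => hp m (fun _ r => {y | r.message y ≠ m}) ((le_iSup (fun m => C.prob m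
      fun _ r => {y | r.message y ≠ m}) m).trans herr)
  have h2 : ∀ m, ∑ t : Fin A, (C.probAt m t
      (fun r => {y | r.decisionTime y ≤ t + D}ᶜ)).toReal ≤ A * ε := by
    intro m
    refine hp m (fun t r => {y | r.decisionTime y ≤ t + D}ᶜ) ?_
    have e := C.prob_add_compl hA m fun t r => {y | r.decisionTime y ≤ t + D}
    have hle : C.prob m (fun t r => {y | r.decisionTime y ≤ t + D}) ≠ ⊤ :=
      ne_top_of_le_ne_top ENNReal.one_ne_top (e ▸ le_self_add)
    have h3 : C.prob m (fun t r => {y | r.decisionTime y ≤ t + D}ᶜ) =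
        1 - C.prob m (fun t r => {y | r.decisionTime y ≤ t + D}) :=
      ENNReal.eq_sub_of_add_eq hle (by rw [add_comm]; exact e)
    rw [h3]
    refine tsub_le_iff_right.2 ?_
    rw [add_comm]
    exact tsub_le_iff_right.1 (hdel m)
  -- before the arrival the outputs are noise for all messages, so at most one of them is guessed
  have h3 : ∀ t : Fin A, ∑ m, (C.probAt m t (early m t)).toReal ≤ 1 := by
    intro t
    have e : ∀ m, C.probAt m t (early m t) =
        mixProb C.receiver (fun _ => ch.Q ch.star) (early m t) := by
      intro m
      rw [probAt_eq]
      refine mixProb_congr _ {i | (i : ℕ) < t} ?_ fun i hi => ?_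
      · rintro r y z h ⟨hy1, hy2⟩
        obtain ⟨_, e2, e3⟩ := r.congr_of_decisionTime_le (z := z) (fun i hi => h i hi) hy2
        exact ⟨e3.trans hy1, by rw [e2]; exact hy2⟩
      · rw [C.input_of_lt_start (lt_of_lt_of_le hi (C.le_start t m))]
    simp only [e]
    have h := mixProb_sum_le C.receiver (fun _ => ch.Q ch.star) Finset.univ
      (fun m => early m t) 1 ?_
    · have h2 := ENNReal.toReal_mono (ENNReal.natCast_ne_top 1) h
      rw [ENNReal.toReal_sum (fun _ _ => mixProb_ne_top _ _ _)] at h2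
      simpa using h2
    · intro r y
      rw [Nat.cast_one, Set.encard_le_one_iff]
      rintro m m' ⟨_, h, _⟩ ⟨_, h', _⟩
      exact h.symm.trans h'
  calc ∑ t, ∑ m, (1 - (C.probAt m t (C.timelyDecision m t D)).toReal)
      ≤ ∑ t : Fin A, ∑ m, ((C.probAt m t (fun r => {y | r.message y ≠ m})).toReal +
        (C.probAt m t (fun r => {y | r.decisionTime y ≤ t + D}ᶜ)).toReal +
        (C.probAt m t (early m t)).toReal) :=
        Finset.sum_le_sum fun t _ => Finset.sum_le_sum fun m _ => hsplit m t
    _ = ∑ m, ∑ t, (C.probAt m t (fun r => {y | r.message y ≠ m})).toReal +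
        ∑ m, ∑ t : Fin A, (C.probAt m t (fun r => {y | r.decisionTime y ≤ t + D}ᶜ)).toReal +
        ∑ t, ∑ m, (C.probAt m t (early m t)).toReal := by
        simp only [Finset.sum_add_distrib]
        congr 2 <;> exact Finset.sum_comm
    _ ≤ ∑ m : Fin (2 ^ B), A * ε + ∑ m : Fin (2 ^ B), A * ε + ∑ t : Fin A, 1 :=
        add_le_add (add_le_add (Finset.sum_le_sum fun m _ => h1 m)
          (Finset.sum_le_sum fun m _ => h2 m)) (Finset.sum_le_sum fun t _ => h3 t)
    _ = A * (2 * ε * 2 ^ B + 1) := by simp; ring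

/-- Many messages share, for some arrival time, a start time within the delay, are decided
correctly and in time with high probability, and are jointly rarely decided under noise. -/
theorem exists_common_start (hA : 0 < A) {ε δ : ℝ} (hε : 0 ≤ ε) {D : ℕ} (hD : 0 < D)
    (herr : C.errorProb ≤ ENNReal.ofReal ε)
    (hdel : ∀ m, 1 - ENNReal.ofReal ε ≤ C.prob m fun t r => {y | r.decisionTime y ≤ t + D})
    (hδ0 : 0 < δ) (hδ : δ ≤ 1 / 2) (hεδ : 4 * ε + 2 / 2 ^ B ≤ δ ^ 2) (hDA : 4 * D < A) :
    ∃ (t : Fin A) (s : ℕ) (G : Finset (Fin (2 ^ B))), (2 : ℝ) ^ B / (2 * D) ≤ G.card ∧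
      (t : ℕ) ≤ s ∧ s < t + D ∧ (∀ m ∈ G, (C.start t m : ℕ) = s) ∧
      (∀ m ∈ G, 1 - δ ≤ (C.probAt m t (C.timelyDecision m t D)).toReal) ∧
      ∑ m ∈ G, (mixProb C.receiver (fun _ => ch.Q ch.star) (C.timelyDecision m t D)).toReal ≤
        2 * D / A := by
  classical
  have hA' : (0 : ℝ) < A := by exact_mod_cast hA
  have hD' : (0 : ℝ) < D := by exact_mod_cast hD
  have hDA' : 4 * (D : ℝ) < A := by exact_mod_cast hDA
  set e : Fin A → Fin (2 ^ B) → ℝ :=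
    fun t m => 1 - (C.probAt m t (C.timelyDecision m t D)).toReal with he
  set g : Fin A → Fin (2 ^ B) → ℝ := fun t m =>
    (mixProb C.receiver (fun _ => ch.Q ch.star) (C.timelyDecision m t D)).toReal with hg
  have he0 : ∀ t m, 0 ≤ e t m := by
    intro t m
    simp only [he, probAt_eq, sub_nonneg]
    exact ENNReal.toReal_le_of_le_ofReal zero_le_one (by simpa using mixProb_le_one _ _ _)
  have hg0 : ∀ t m, 0 ≤ g t m := fun t m => ENNReal.toReal_nonneg
  set c : ℝ := 2 * ε * 2 ^ B + 1 with hc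
  have hc0 : 0 < c := by positivity
  -- by averaging, some arrival time is good for the error and for the false decisions at once
  obtain ⟨t, -, ht⟩ : ∃ t ∈ (Finset.univ : Finset (Fin A)),
      (∑ m, e t m) / c + (∑ m, g t m) * (A / D) ≤ 2 := by
    refine Finset.exists_le_of_sum_le ⟨⟨0, hA⟩, Finset.mem_univ _⟩ ?_
    rw [Finset.sum_add_distrib, ← Finset.sum_div, ← Finset.sum_mul]
    have h1 := C.sum_one_sub_timely_le hA hε herr hdel
    have h2 := C.sum_noise_le D
    have h3 : (∑ t, ∑ m, e t m) / c ≤ A := by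
      rw [div_le_iff₀ hc0]; exact h1
    have h4 : (∑ t, ∑ m, g t m) * (A / D) ≤ A := by
      calc _ ≤ (D : ℝ) * (A / D) := by gcongr
        _ = A := by field_simp
    simp only [Finset.sum_const, Finset.card_univ, Fintype.card_fin, nsmul_eq_mul]
    linarith
  have hes : ∑ m, e t m ≤ 2 * c := by
    have : 0 ≤ (∑ m, g t m) * (A / D) :=
      mul_nonneg (Finset.sum_nonneg fun m _ => hg0 t m) (by positivity)
    rw [← div_le_iff₀ hc0]; linarith
  have hgs : ∑ m, g t m ≤ 2 * D / A := by
    have : 0 ≤ (∑ m, e t m) / c :=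
      div_nonneg (Finset.sum_nonneg fun m _ => he0 t m) hc0.le
    have h : (∑ m, g t m) * (A / D) ≤ 2 := by linarith
    rw [le_div_iff₀ hA']
    rw [mul_div_assoc', div_le_iff₀ hD'] at h
    exact h
  set good : Finset (Fin (2 ^ B)) := Finset.univ.filter fun m => e t m ≤ δ with hgood
  -- by Markov's inequality at least half of the messages are received reliably
  have hcard : (2 : ℝ) ^ B / 2 ≤ good.card := by
    have hbad : δ * ((Finset.univ.filter fun m => ¬ e t m ≤ δ).card : ℝ) ≤ 2 * c := by
      refine le_trans ?_ hes
      calc δ * ((Finset.univ.filter fun m => ¬ e t m ≤ δ).card : ℝ)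
          = ∑ m ∈ Finset.univ.filter fun m => ¬ e t m ≤ δ, δ := by
            rw [Finset.sum_const, nsmul_eq_mul, mul_comm]
        _ ≤ ∑ m ∈ Finset.univ.filter fun m => ¬ e t m ≤ δ, e t m :=
            Finset.sum_le_sum fun m hm => by
              rw [Finset.mem_filter] at hm; exact (not_le.1 hm.2).le
        _ ≤ ∑ m, e t m := Finset.sum_le_sum_of_subset_of_nonneg (Finset.subset_univ _)
            fun m _ _ => he0 t m
    have htot := Finset.card_filter_add_card_filter_not (s := (Finset.univ : Finset (Fin (2 ^ B))))
      (fun m => e t m ≤ δ)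
    rw [Finset.card_univ, Fintype.card_fin] at htot
    have htot' : (good.card : ℝ) + ((Finset.univ.filter fun m => ¬ e t m ≤ δ).card : ℝ) =
        2 ^ B := by exact_mod_cast htot
    have hp : (0 : ℝ) < 2 ^ B := by positivity
    have h2c : 2 * c ≤ δ ^ 2 * 2 ^ B := by
      have := mul_le_mul_of_nonneg_right hεδ hp.le
      rw [add_mul, div_mul_cancel₀ _ hp.ne'] at this
      rw [hc]; linarith
    have : ((Finset.univ.filter fun m => ¬ e t m ≤ δ).card : ℝ) ≤ δ * 2 ^ B := by
      refine le_of_mul_le_mul_left ?_ hδ0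
      calc _ ≤ 2 * c := hbad
        _ ≤ _ := h2c
        _ = _ := by ring
    nlinarith
  -- a start after the delay would make a timely decision a decision under pure noise
  have hstart : ∀ m ∈ good, (C.start t m : ℕ) ∈ Finset.Ico (t : ℕ) (t + D) := by
    intro m hm
    rw [Finset.mem_Ico]
    refine ⟨C.le_start t m, ?_⟩
    by_contra! hlt
    have h1 : C.probAt m t (C.timelyDecision m t D) =
        mixProb C.receiver (fun _ => ch.Q ch.star) (C.timelyDecision m t D) := by
      rw [probAt_eq]
      refine mixProb_congr _ {i | (i : ℕ) < t + D} C.timelyDecision_congr fun i hi => ?_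
      rw [C.input_of_lt_start (lt_of_lt_of_le hi hlt)]
    have h2 : e t m ≤ δ := (Finset.mem_filter.1 hm).2
    have h3 : g t m ≤ 2 * D / A :=
      (Finset.single_le_sum (fun m _ => hg0 t m) (Finset.mem_univ m)).trans hgs
    have h4 : 2 * (D : ℝ) / A < 1 / 2 := by
      rw [div_lt_iff₀ hA']; linarith
    simp only [he, h1] at h2
    simp only [hg] at h3
    linarith
  -- the reliable messages have at most `D` start times, one of which is common to many
  obtain ⟨s, hs, hsc⟩ := Finset.exists_le_card_fiber_of_nsmul_le_card_of_maps_to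
    (b := (2 : ℝ) ^ B / (2 * D)) hstart (Finset.nonempty_Ico.2 (by omega)) (by
      rw [Nat.card_Ico, nsmul_eq_mul]
      refine le_trans (le_of_eq ?_) hcard
      rw [Nat.add_sub_cancel_left]
      field_simp)
  rw [Finset.mem_Ico] at hs
  refine ⟨t, s, good.filter fun m => (C.start t m : ℕ) = s, hsc, hs.1, hs.2,
    fun m hm => (Finset.mem_filter.1 hm).2, fun m hm => ?_, ?_⟩
  · have : e t m ≤ δ := (Finset.mem_filter.1 (Finset.mem_filter.1 hm).1).2
    simp only [he] at this
    linarith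
  · exact (Finset.sum_le_sum_of_subset_of_nonneg (Finset.subset_univ _)
      fun m _ _ => hg0 t m).trans hgs

/-- The converse for a single code: some input law `P` and some number `n'` of channel uses, no
larger than the delay, satisfy both information constraints at a cost within that of the code. -/
theorem exists_law (hA : 0 < A) {ε δ : ℝ} (hε : 0 ≤ ε) {D : ℕ} (hD : 0 < D)
    (herr : C.errorProb ≤ ENNReal.ofReal ε)
    (hdel : ∀ m, 1 - ENNReal.ofReal ε ≤ C.prob m fun t r => {y | r.decisionTime y ≤ t + D})
    (hδ0 : 0 < δ) (hδ : δ ≤ 1 / 2) (hεδ : 4 * ε + 2 / 2 ^ B ≤ δ ^ 2) (hDA : 4 * D < A)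
    (hDB : 2 * D ≤ 2 ^ B) :
    ∃ (P : PMF ch.alphabet) (n' : ℕ), 0 < n' ∧ n' ≤ D ∧ n' * ch.expCost P ≤ C.maxCost ∧
      Real.log (2 ^ B / (2 * D)) * (1 - δ) ≤ n' * ch.infoReal P + 1 ∧
      ((∀ x ∈ P.support, (ch.Q x).support ⊆ (ch.Q ch.star).support) →
        Real.log (2 ^ B / (2 * D) * (A / (2 * D))) * (1 - δ) ≤
          n' * ∑ x, (P x).toReal * klReal (ch.Q x) (ch.Q ch.star) + 1) := by
  have hA' : (0 : ℝ) < A := by exact_mod_cast hA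
  have hD' : (0 : ℝ) < D := by exact_mod_cast hD
  have hDA' : 4 * (D : ℝ) < A := by exact_mod_cast hDA
  have hDB' : 2 * (D : ℝ) ≤ 2 ^ B := by exact_mod_cast hDB
  have hb1 : 1 ≤ (2 : ℝ) ^ B / (2 * D) := by rw [le_div_iff₀ (by positivity)]; linarith
  have hb2 : 1 ≤ (A : ℝ) / (2 * D) := by rw [le_div_iff₀ (by positivity)]; linarith
  obtain ⟨t, s, G, hG, hts, hsD, hs, hgood, hnoise⟩ :=
    C.exists_common_start hA hε hD herr hdel hδ0 hδ hεδ hDA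
  have hGp : (0 : ℝ) < G.card := by linarith
  have hGne : G.Nonempty := Finset.card_pos.1 (by exact_mod_cast hGp)
  have hnpos := C.n_pos
  have hn0 : 0 < min C.n (t + D - s) := by
    rw [lt_min_iff]; omega
  have hn1 : min C.n (t + D - s) ≤ C.n := min_le_left _ _
  have hn2 : s + min C.n (t + D - s) ≤ t + D := by
    have := min_le_right C.n (t + D - s); omega
  have hw : min C.n (t + D - s) = C.n ∨ s + min C.n (t + D - s) = t + D := by
    rcases min_choice C.n (t + D - s) with h | h
    · exact Or.inl h
    · right; omega
  -- the reference law is the output law for the message constraint, pure noise for the timing one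
  refine ⟨C.symbolLaw G hGne hn0 hn1, min C.n (t + D - s), hn0, by omega,
    C.expCost_symbolLaw_le hGne hn0 hn1, ?_, fun hsupp => ?_⟩
  · refine C.window_test hGne hs hn0 hn1 hn2 hw _ (fun x hx => ch.support_subset_outputLaw hx)
      (Real.log_nonneg hb1) hgood ?_
    rw [Real.exp_log (by linarith)]
    have h := mixProb_sum_le C.receiver (fun i : Fin (A + C.n - 1) =>
      if s ≤ (i : ℕ) ∧ (i : ℕ) < s + min C.n (t + D - s) then
        ch.outputLaw (C.symbolLaw G hGne hn0 hn1) else ch.Q ch.star) G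
      (fun m => C.timelyDecision m t D) 1 ?_
    · have h2 := ENNReal.toReal_mono (ENNReal.natCast_ne_top 1) h
      rw [ENNReal.toReal_sum (fun _ _ => mixProb_ne_top _ _ _)] at h2
      simp only [Nat.cast_one, ENNReal.toReal_one] at h2
      refine le_trans ?_ hG
      exact mul_le_of_le_one_right (by positivity) h2
    · intro r y
      rw [Nat.cast_one, Set.encard_le_one_iff]
      rintro m m' ⟨_, h, _⟩ ⟨_, h', _⟩
      exact h.symm.trans h'
  · refine C.window_test hGne hs hn0 hn1 hn2 hw _ hsupp
      (Real.log_nonneg (one_le_mul_of_one_le_of_one_le hb1 hb2)) hgood ?_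
    rw [Real.exp_log (mul_pos (by linarith) (by linarith))]
    simp only [ite_self]
    calc _ ≤ (2 : ℝ) ^ B / (2 * D) * (A / (2 * D)) * (2 * D / A) := by gcongr
      _ = 2 ^ B / (2 * D) := by field_simp
      _ ≤ _ := hG

end Code

/-! ### Converse: the capacity -/

theorem half_rpow_le_asyncLevel {β : ℝ} (hβ : 0 < β) (B : ℕ) :
    (2 : ℝ) ^ (β * B) / 2 ≤ asyncLevel β B := by
  have h1 : (1 : ℝ) ≤ 2 ^ (β * B) := Real.one_le_rpow one_le_two (by positivity)
  have h2 : (1 : ℝ) ≤ asyncLevel β B := by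
    exact_mod_cast (Nat.one_le_floor_iff _).2 h1
  have h3 : (2 : ℝ) ^ (β * B) < asyncLevel β B + 1 := Nat.lt_floor_add_one _
  linarith

theorem asyncLevel_pos {β : ℝ} (hβ : 0 < β) (B : ℕ) : 0 < asyncLevel β B :=
  Nat.floor_pos.2 (Real.one_le_rpow one_le_two (by positivity))

namespace Channel

variable {I Y : Type*} {ch : Channel I Y}

/-- The information constraints for `b` bits at cost `K` bound `b / K` by the objective. -/
theorem le_objective_of_constraints {β : ℝ} (hβ : 0 < β) {P : PMF ch.alphabet} {n' : ℕ}
    (hn : 0 < n') {K : ℝ≥0∞} {b : ℝ} (hcost : n' * ch.expCost P ≤ K)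
    (h1 : ENNReal.ofReal b ≤ n' * ch.mutualInfo P)
    (h2 : ENNReal.ofReal (b * (1 + β)) ≤
      n' * (ch.mutualInfo P + divBits (ch.outputLaw P) (ch.Q ch.star))) :
    ENNReal.ofReal b / K ≤ ch.objective β P := by
  have hn0 : (n' : ℝ≥0∞) ≠ 0 := by exact_mod_cast hn.ne'
  have hn1 : (n' : ℝ≥0∞) ≠ ⊤ := ENNReal.natCast_ne_top _
  have hβ0 : ENNReal.ofReal (1 + β) ≠ 0 := by
    rw [Ne, ENNReal.ofReal_eq_zero]; linarith
  refine le_min ?_ ?_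
  · rw [← ENNReal.mul_div_mul_left (ch.mutualInfo P) _ hn0 hn1]
    exact ENNReal.div_le_div h1 hcost
  · rw [← ENNReal.mul_div_mul_left (ch.mutualInfo P + _) _ hn0 hn1,
      ← ENNReal.mul_div_mul_right (ENNReal.ofReal b) K hβ0 ENNReal.ofReal_ne_top,
      ← ENNReal.ofReal_mul' (by linarith), ← mul_assoc]
    exact ENNReal.div_le_div h2 (by gcongr)

variable [Fintype Y]

/-- The converse: codes that achieve some rate satisfy, with a suitable input law and a number of
channel uses within the delay, the information constraints for `B` bits of message and `β B` bits
of timing. -/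
theorem Achieves.exists_law {β ρ : ℝ} (hβ : 0 < β) {R : ℝ≥0}
    {C : ∀ B : ℕ, Code ch B (asyncLevel β B)} {ε : ℕ → ℝ} (h : ch.Achieves β ρ R C ε)
    {η : ℝ} (hη : 0 < η) (hη1 : η ≤ 1) :
    ∀ᶠ B : ℕ in atTop, ∃ (P : PMF ch.alphabet) (n' : ℕ), 0 < n' ∧
      n' ≤ (C B).delay (ε B) + 1 ∧ n' * ch.expCost P ≤ (C B).maxCost ∧
      ENNReal.ofReal ((1 - η) * B) ≤ n' * ch.mutualInfo P ∧
      ENNReal.ofReal ((1 - η) * (1 + β) * B) ≤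
        n' * (ch.mutualInfo P + divBits (ch.outputLaw P) (ch.Q ch.star)) := by
  set δ : ℝ := η / 4 with hδ
  set γ : ℝ := min (η / 8) (β / 2) with hγ
  have hγ0 : 0 < γ := by rw [hγ]; positivity
  have hγη : γ ≤ η / 8 := min_le_left _ _
  have hγβ : γ ≤ β / 2 := min_le_right _ _
  clear_value γ
  have hδ0 : 0 < δ := by rw [hδ]; positivity
  have hlim : Tendsto (fun B : ℕ => 4 * ε B + 2 / 2 ^ B) atTop (𝓝 (4 * 0 + 2 * 0)) := by
    refine (h.tendsto_zero.const_mul 4).add ?_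
    have : Tendsto (fun B : ℕ => ((1 : ℝ) / 2) ^ B) atTop (𝓝 0) :=
      tendsto_pow_atTop_nhds_zero_of_lt_one (by norm_num) (by norm_num)
    refine (this.const_mul 2).congr fun B => ?_
    rw [one_div, inv_pow]; rfl
  have hB1 : ∀ c : ℝ, ∀ᶠ B : ℕ in atTop, c ≤ (B : ℝ) := fun c =>
    tendsto_natCast_atTop_atTop.eventually_ge_atTop c
  filter_upwards [h.error_le, h.delay_le, h.tendsto_zero.eventually_lt_const hγ0,
    hlim.eventually_lt_const (show 4 * 0 + 2 * 0 < δ ^ 2 by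
      rw [mul_zero, mul_zero, add_zero]; positivity), hB1 1, hB1 (14 / η),
    hB1 (10 / β)] with B herr hdel hεγ hεδ hBone hBη hBβ
  have hB0 : (0 : ℝ) < B := by linarith
  -- the delay is subexponential, so decisions within it hardly change the exponents
  set D := (C B).delay (ε B) + 1 with hD
  have hDpos : 0 < D := Nat.succ_pos _
  have hD0 : (0 : ℝ) < D := by exact_mod_cast hDpos
  have hDle : (D : ℝ) ≤ 2 * 2 ^ (γ * B) := by
    have h1 : (1 : ℝ) ≤ 2 ^ (γ * B) := Real.one_le_rpow one_le_two (by positivity)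
    rcases Nat.eq_zero_or_pos ((C B).delay (ε B)) with h0 | h0
    · rw [hD, h0]; push_cast; linarith
    · have hd : (0 : ℝ) < (C B).delay (ε B) := by exact_mod_cast h0
      have h2 : Real.logb 2 ((C B).delay (ε B)) ≤ γ * B := by
        have := mul_le_mul_of_nonneg_left hdel hB0.le
        rw [← mul_assoc, mul_one_div_cancel hB0.ne', one_mul] at this
        linarith [mul_le_mul_of_nonneg_right hεγ.le hB0.le, mul_comm (ε B) B]
      have h3 : ((C B).delay (ε B) : ℝ) ≤ 2 ^ (γ * B) :=
        (Real.logb_le_iff_le_rpow one_lt_two hd).1 h2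
      rw [hD]; push_cast; linarith
  have hl2 : 0 < Real.log 2 := Real.log_pos one_lt_two
  have hl2' : 1 / 2 ≤ Real.log 2 := by have := Real.log_two_gt_d9; linarith
  have hlogD : Real.log (2 * D) ≤ (2 + γ * B) * Real.log 2 := by
    calc Real.log (2 * D) ≤ Real.log (2 * (2 * 2 ^ (γ * B))) :=
          Real.log_le_log (by positivity) (by linarith)
      _ = _ := by
          rw [Real.log_mul two_ne_zero (by positivity), Real.log_mul two_ne_zero (by positivity),
            Real.log_rpow two_pos]; ring
  have hA := half_rpow_le_asyncLevel hβ B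
  have hApos := asyncLevel_pos hβ B
  have hA0 : (0 : ℝ) < asyncLevel β B := by exact_mod_cast hApos
  have hlogA : (β * B - 1) * Real.log 2 ≤ Real.log (asyncLevel β B) := by
    calc (β * B - 1) * Real.log 2 = Real.log (2 ^ (β * B) / 2) := by
          rw [Real.log_div (by positivity) two_ne_zero, Real.log_rpow two_pos]; ring
      _ ≤ _ := Real.log_le_log (by positivity) hA
  have hηB : 14 ≤ η * B := by rw [div_le_iff₀ hη] at hBη; linarith
  have hβB : 10 ≤ β * B := by rw [div_le_iff₀ hβ] at hBβ; linarith
  have hγB : γ * B ≤ β * B / 2 := by linarith [mul_le_mul_of_nonneg_right hγβ hB0.le]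
  have hγB' : γ * B ≤ η * B / 8 := by linarith [mul_le_mul_of_nonneg_right hγη hB0.le]
  have hDA : 4 * D < asyncLevel β B := by
    have : Real.log (2 * D) + Real.log 2 < Real.log (asyncLevel β B) := by
      have := mul_lt_mul_of_pos_right (show 2 + γ * B + 1 < β * B - 1 by linarith) hl2
      linarith
    rw [← Real.log_mul (by positivity) two_ne_zero] at this
    have := (Real.log_lt_log_iff (by positivity) hA0).1 this
    have h4 : (4 * D : ℝ) < asyncLevel β B := by linarith
    exact_mod_cast h4
  have hDB : 2 * D ≤ 2 ^ B := by
    have : Real.log (2 * D) ≤ Real.log (2 ^ B) := by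
      rw [Real.log_pow]
      refine hlogD.trans ?_
      gcongr
      linarith [mul_le_mul_of_nonneg_right hη1 hB0.le]
    have := (Real.log_le_log_iff (by positivity) (by positivity)).1 this
    exact_mod_cast this
  obtain ⟨P, n', hn0, hnD, hcost, hinfo, hdiv⟩ := (C B).exists_law hApos (h.pos B).le hDpos herr
    (fun m => ((C B).delay_spec hApos (ε B) m).trans ((C B).prob_mono m fun t r y hy => by
      have hy' : (r.decisionTime y : ℤ) - ((t : ℤ) + 1) ≤ ((C B).delay (ε B) : ℤ) - 1 := hy
      change r.decisionTime y ≤ t + D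
      omega)) hδ0 (by rw [hδ]; linarith) hεδ.le hDA hDB
  have hb1 : ((1 - γ) * B - 2) * Real.log 2 ≤ Real.log (2 ^ B / (2 * D)) := by
    rw [Real.log_div (by positivity) (by positivity), Real.log_pow]
    linarith
  have hb2 : ((1 + β - 2 * γ) * B - 5) * Real.log 2 ≤
      Real.log (2 ^ B / (2 * D) * (asyncLevel β B / (2 * D))) := by
    rw [Real.log_mul (by positivity) (by positivity), Real.log_div hA0.ne' (by positivity)]
    linarith
  have hn0' : (0 : ℝ) < n' := by exact_mod_cast hn0
  refine ⟨P, n', hn0, hnD, hcost, ?_, ?_⟩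
  · rw [mutualInfo_eq, ← ENNReal.ofReal_natCast n', ← ENNReal.ofReal_mul (Nat.cast_nonneg _)]
    refine ENNReal.ofReal_le_ofReal ?_
    rw [mul_div_assoc', le_div_iff₀ hl2]
    have h1 := mul_le_mul_of_nonneg_right hb1 (show 0 ≤ 1 - δ by linarith)
    have h2 : (1 - η) * B + 2 ≤ ((1 - γ) * B - 2) * (1 - δ) := by
      have : 0 ≤ γ * B * δ := by positivity
      have e : δ * B = η * B / 4 := by rw [hδ]; ring
      linarith
    have h3 := mul_le_mul_of_nonneg_right h2 hl2.le
    linarith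
  · by_cases hs : ∀ x ∈ P.support, (ch.Q x).support ⊆ (ch.Q ch.star).support
    · rw [mutualInfo_add_divBits ch hs, ← ENNReal.ofReal_natCast n',
        ← ENNReal.ofReal_mul (Nat.cast_nonneg _)]
      refine ENNReal.ofReal_le_ofReal ?_
      rw [mul_div_assoc', le_div_iff₀ hl2]
      have h1 := mul_le_mul_of_nonneg_right hb2 (show 0 ≤ 1 - δ by linarith)
      have h2 : (1 - η) * (1 + β) * B + 2 ≤ ((1 + β - 2 * γ) * B - 5) * (1 - δ) := by
        have : 0 ≤ γ * B * δ := by positivity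
        have e : δ * B = η * B / 4 := by rw [hδ]; ring
        have e2 : δ * β * B = β * (η * B) / 4 := by rw [hδ]; ring
        have : 0 ≤ β * (η * B) := by positivity
        linarith
      have h3 := hdiv hs
      have h4 := mul_le_mul_of_nonneg_right h2 hl2.le
      linarith
    · rw [mutualInfo_add_divBits_eq_top ch hs, ENNReal.mul_top (by exact_mod_cast hn0.ne')]
      exact le_top

/-- The laws of the converse have an objective close to the rate, and at least so many channel uses
that `n' * 𝔼[k(X)]` is nearly `B` divided by the objective. -/
theorem Achieves.le_iSup_objective {β ρ : ℝ} (hβ : 0 < β) {R : ℝ≥0}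
    {C : ∀ B : ℕ, Code ch B (asyncLevel β B)} {ε : ℕ → ℝ} (h : ch.Achieves β ρ R C ε)
    {η : ℝ} (hη : 0 < η) (hη1 : η ≤ 1) :
    ∀ᶠ B : ℕ in atTop, ∃ (P : PMF ch.alphabet) (n' : ℕ), 0 < n' ∧
      n' ≤ (C B).delay (ε B) + 1 ∧
      ENNReal.ofReal ((1 - η) * B) / (n' * ch.expCost P) ≤ ch.objective β P ∧
      ENNReal.ofReal (1 - η) * (R - ENNReal.ofReal (ε B)) ≤ ch.objective β P := by
  filter_upwards [h.exists_law hβ hη hη1, h.rate_ge] with B ⟨P, n', hn, hnd, hc, h1, h2⟩ hr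
  have h2' : ENNReal.ofReal ((1 - η) * B * (1 + β)) ≤
      n' * (ch.mutualInfo P + divBits (ch.outputLaw P) (ch.Q ch.star)) := by
    convert h2 using 2; ring
  refine ⟨P, n', hn, hnd, le_objective_of_constraints hβ hn le_rfl h1 h2', ?_⟩
  calc _ ≤ ENNReal.ofReal (1 - η) * (B / (C B).maxCost) := by gcongr
    _ = ENNReal.ofReal ((1 - η) * B) / (C B).maxCost := by
        rw [ENNReal.ofReal_mul (by linarith), ENNReal.ofReal_natCast, mul_div_assoc]
    _ ≤ _ := le_objective_of_constraints hβ hn hc h1 h2'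

theorem capacity_le_iSup_objective {β : ℝ} (hβ : 0 < β) (ρ : ℝ) :
    ch.capacity β ρ ≤ ⨆ P, ch.objective β P := by
  refine iSup₂_le fun R ⟨C, ε, h⟩ => ?_
  have key : ∀ η : ℝ, 0 < η → η ≤ 1 →
      ENNReal.ofReal (1 - η) * R ≤ ⨆ P, ch.objective β P := by
    intro η hη hη1
    have hlim : Tendsto (fun B => ENNReal.ofReal (1 - η) * ((R : ℝ≥0∞) - ENNReal.ofReal (ε B)))
        atTop (𝓝 (ENNReal.ofReal (1 - η) * ((R : ℝ≥0∞) - ENNReal.ofReal 0))) := by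
      refine ENNReal.Tendsto.const_mul ?_ (Or.inr ENNReal.ofReal_ne_top)
      refine ENNReal.Tendsto.sub tendsto_const_nhds
        (ENNReal.tendsto_ofReal h.tendsto_zero) (Or.inl ENNReal.coe_ne_top)
    rw [ENNReal.ofReal_zero, tsub_zero] at hlim
    refine le_of_tendsto hlim ?_
    filter_upwards [h.le_iSup_objective hβ hη hη1] with B ⟨P, _, _, _, _, hP⟩
    exact hP.trans (le_iSup (ch.objective β) P)
  have hlim : Tendsto (fun k : ℕ => ENNReal.ofReal (1 - 1 / ((k : ℝ) + 1)) * R) atTop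
      (𝓝 (ENNReal.ofReal (1 - 0) * R)) := by
    refine ENNReal.Tendsto.mul_const ?_ (Or.inr ENNReal.coe_ne_top)
    exact ENNReal.tendsto_ofReal (tendsto_one_div_add_atTop_nhds_zero_nat.const_sub 1)
  rw [sub_zero, ENNReal.ofReal_one, one_mul] at hlim
  refine le_of_tendsto hlim (Eventually.of_forall fun k => key _ (by positivity) ?_)
  rw [div_le_one (by positivity)]
  linarith [(Nat.cast_nonneg k : (0 : ℝ) ≤ k)]

end Channel

/-! ### Cost, information and divergence as functions of the input law -/

/-- Laws on a finite type form a sequentially compact set. -/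
theorem PMF.exists_tendsto_subseq {X : Type*} [Fintype X] (P : ℕ → PMF X) :
    ∃ (L : PMF X) (φ : ℕ → ℕ), StrictMono φ ∧
      ∀ x, Tendsto (fun j => (P (φ j) x).toReal) atTop (𝓝 (L x).toReal) := by
  have hmem : ∀ j, (fun x => (P j x).toReal) ∈ stdSimplex ℝ X := fun j =>
    ⟨fun _ => ENNReal.toReal_nonneg, (P j).sum_toReal⟩
  obtain ⟨p, hp, φ, hφ, hlim⟩ := (isCompact_stdSimplex ℝ X).tendsto_subseq hmem
  refine ⟨PMF.ofFintype (fun x => ENNReal.ofReal (p x)) ?_, φ, hφ, fun x => ?_⟩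
  · rw [← ENNReal.ofReal_sum_of_nonneg fun x _ => hp.1 x, hp.2, ENNReal.ofReal_one]
  · rw [PMF.ofFintype_apply, ENNReal.toReal_ofReal (hp.1 x)]
    exact tendsto_pi_nhds.1 hlim x

namespace Channel

variable {I Y : Type*} {ch : Channel I Y}

/-- The expected cost as a real number; infinite costs are replaced by `0`, which is harmless for
laws that give them no mass. -/
noncomputable def costReal (ch : Channel I Y) (P : PMF ch.alphabet) : ℝ :=
  ∑ x, (P x).toReal * (ch.cost x).toReal

theorem cost_ne_top_of_mem_support {P : PMF ch.alphabet} (hP : ch.expCost P ≠ ⊤) {x : ch.alphabet}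
    (hx : x ∈ P.support) : ch.cost x ≠ ⊤ := by
  intro h
  refine hP (ENNReal.sum_eq_top.2 ⟨x, Finset.mem_univ _, ?_⟩)
  rw [h, ENNReal.mul_top hx]

theorem expCost_eq_ofReal {P : PMF ch.alphabet} (hP : ch.expCost P ≠ ⊤) :
    ch.expCost P = ENNReal.ofReal (ch.costReal P) := by
  rw [costReal, ENNReal.ofReal_sum_of_nonneg fun x _ => by positivity, expCost]
  refine Finset.sum_congr rfl fun x _ => ?_
  by_cases hx : x ∈ P.support
  · rw [ENNReal.ofReal_mul ENNReal.toReal_nonneg, ENNReal.ofReal_toReal (P.apply_ne_top x),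
      ENNReal.ofReal_toReal (cost_ne_top_of_mem_support hP hx)]
  · rw [(P.apply_eq_zero_iff x).2 hx]; simp

theorem costReal_nonneg (P : PMF ch.alphabet) : 0 ≤ ch.costReal P :=
  Finset.sum_nonneg fun x _ => by positivity

theorem expCost_ne_top_of_objective {β : ℝ} {P : PMF ch.alphabet} (h : ch.objective β P ≠ 0) :
    ch.expCost P ≠ ⊤ := by
  intro ht
  refine h (le_antisymm ((min_le_left _ _).trans ?_) bot_le)
  rw [ht, ENNReal.div_top]

theorem tendsto_costReal {P : ℕ → PMF ch.alphabet} {L : PMF ch.alphabet}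
    (hlim : ∀ x, Tendsto (fun j => (P j x).toReal) atTop (𝓝 (L x).toReal)) :
    Tendsto (fun j => ch.costReal (P j)) atTop (𝓝 (ch.costReal L)) :=
  tendsto_finsetSum _ fun x _ => (hlim x).mul_const _

theorem expCost_ne_top_of_tendsto {P : ℕ → PMF ch.alphabet} {L : PMF ch.alphabet}
    (hlim : ∀ x, Tendsto (fun j => (P j x).toReal) atTop (𝓝 (L x).toReal))
    (hP : ∀ j, ch.expCost (P j) ≠ ⊤) : ch.expCost L ≠ ⊤ := by
  rw [expCost, Ne, ENNReal.sum_eq_top]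
  rintro ⟨x, -, hx⟩
  rcases eq_or_ne (ch.cost x) ⊤ with h | h
  · have h0 : ∀ j, (P j x).toReal = 0 := by
      intro j
      by_contra h1
      refine cost_ne_top_of_mem_support (hP j) (x := x) ?_ h
      rw [PMF.mem_support_iff]
      rintro h2
      rw [h2] at h1
      exact h1 rfl
    have h1 : (L x).toReal = 0 := tendsto_nhds_unique (hlim x) (by
      simp only [h0]; exact tendsto_const_nhds)
    rw [ENNReal.toReal_eq_zero_iff, or_iff_left (L.apply_ne_top x)] at h1
    rw [h1, zero_mul] at hx
    exact ENNReal.zero_ne_top hx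
  · exact ENNReal.mul_ne_top (L.apply_ne_top x) h hx

variable [Fintype Y]

/-- The mean divergence of the outputs from pure noise, in nats. -/
noncomputable def divReal (ch : Channel I Y) (P : PMF ch.alphabet) : ℝ :=
  ∑ x, (P x).toReal * klReal (ch.Q x) (ch.Q ch.star)

theorem infoReal_pos_of_objective {β : ℝ} {P : PMF ch.alphabet} (h : ch.objective β P ≠ 0) :
    0 < ch.infoReal P := by
  refine lt_of_le_of_ne (ch.infoReal_nonneg P) fun h0 => h ?_
  refine le_antisymm ((min_le_left _ _).trans ?_) bot_le
  rw [mutualInfo_eq, ← h0]; simp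

/-- A law that uses only the zero-cost symbol carries no information. -/
theorem infoReal_eq_zero_of_costReal {P : PMF ch.alphabet} (hP : ch.expCost P ≠ ⊤)
    (h : ch.costReal P = 0) : ch.infoReal P = 0 := by
  have hstar : ∀ x ∈ P.support, (x : I) = ch.star := by
    intro x hx
    rw [costReal, Finset.sum_eq_zero_iff_of_nonneg fun x _ => by positivity] at h
    have := h x (Finset.mem_univ _)
    rw [mul_eq_zero, or_iff_right (PMF.toReal_pos hx).ne', ENNReal.toReal_eq_zero_iff,
      or_iff_left (cost_ne_top_of_mem_support hP hx)] at this
    exact (ch.cost_eq_zero_iff x x.2).1 this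
  obtain ⟨x0, hx0⟩ := P.support_nonempty
  have hall : ∀ x ∈ P.support, ch.Q x = ch.Q x0 := fun x hx => by
    rw [hstar x hx, hstar x0 hx0]
  have hout : ch.outputLaw P = ch.Q x0 := by
    ext y
    rw [outputLaw_apply]
    calc ∑ x, P x * ch.Q x y = ∑ x, P x * ch.Q x0 y := by
          refine Finset.sum_congr rfl fun x _ => ?_
          by_cases hx : x ∈ P.support
          · rw [hall x hx]
          · rw [(P.apply_eq_zero_iff x).2 hx]; simp
      _ = _ := by rw [← Finset.sum_mul, PMF.sum_coe, one_mul]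
  refine Finset.sum_eq_zero fun x _ => ?_
  by_cases hx : x ∈ P.support
  · rw [hout, hall x hx, klReal]
    rw [Finset.sum_eq_zero, mul_zero]
    intro y _
    by_cases hy : (ch.Q x0 y).toReal = 0
    · rw [hy, zero_mul]
    · rw [div_self hy, Real.log_one, mul_zero]
  · rw [(P.apply_eq_zero_iff x).2 hx]; simp

theorem costReal_pos_of_objective {β : ℝ} {P : PMF ch.alphabet} (h : ch.objective β P ≠ 0) :
    0 < ch.costReal P := by
  refine lt_of_le_of_ne (costReal_nonneg P) fun h0 => ?_
  exact (infoReal_pos_of_objective h).ne'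
    (infoReal_eq_zero_of_costReal (expCost_ne_top_of_objective h) h0.symm)

theorem objective_eq_ofReal {β : ℝ} (hβ : 0 < β) {P : PMF ch.alphabet} (hP : ch.expCost P ≠ ⊤)
    (hK : 0 < ch.costReal P)
    (hs : ∀ x ∈ P.support, (ch.Q x).support ⊆ (ch.Q ch.star).support) :
    ch.objective β P = ENNReal.ofReal (min (ch.infoReal P / Real.log 2 / ch.costReal P)
      (ch.divReal P / Real.log 2 / (ch.costReal P * (1 + β)))) := by
  rw [objective, mutualInfo_add_divBits ch hs, mutualInfo_eq, expCost_eq_ofReal hP,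
    ← ENNReal.ofReal_mul hK.le, ← ENNReal.ofReal_div_of_pos hK,
    ← ENNReal.ofReal_div_of_pos (by positivity)]
  exact (ENNReal.ofReal_mono.map_min).symm

theorem infoReal_eq (P : PMF ch.alphabet) : ch.infoReal P =
    ∑ x, (P x).toReal * ∑ y, (ch.Q x y).toReal * Real.log (ch.Q x y).toReal +
      ∑ y, Real.negMulLog (∑ x, (P x).toReal * (ch.Q x y).toReal) := by
  have h1 : ∑ y, Real.negMulLog (∑ x, (P x).toReal * (ch.Q x y).toReal) =
      - ∑ x, (P x).toReal * ∑ y, (ch.Q x y).toReal * Real.log (ch.outputLaw P y).toReal := by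
    simp only [Real.negMulLog, ← outputLaw_apply_toReal, neg_mul, Finset.sum_neg_distrib,
      Finset.mul_sum]
    rw [Finset.sum_comm]
    congr 1
    refine Finset.sum_congr rfl fun y _ => ?_
    conv_lhs => rw [outputLaw_apply_toReal, Finset.sum_mul]
    exact Finset.sum_congr rfl fun x _ => by rw [outputLaw_apply_toReal]; ring
  rw [h1, ← sub_eq_add_neg, ← Finset.sum_sub_distrib, infoReal]
  refine Finset.sum_congr rfl fun x _ => ?_
  by_cases hx : x ∈ P.support
  · rw [← mul_sub, klReal, ← Finset.sum_sub_distrib]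
    congr 1
    refine Finset.sum_congr rfl fun y _ => ?_
    by_cases hy : y ∈ (ch.Q x).support
    · rw [Real.log_div (PMF.toReal_pos hy).ne'
        (PMF.toReal_pos (ch.support_subset_outputLaw hx hy)).ne']
      ring
    · rw [((ch.Q x).apply_eq_zero_iff y).2 hy]; simp
  · rw [(P.apply_eq_zero_iff x).2 hx]; simp

section Limits

variable {P : ℕ → PMF ch.alphabet} {L : PMF ch.alphabet}

theorem tendsto_infoReal
    (hlim : ∀ x, Tendsto (fun j => (P j x).toReal) atTop (𝓝 (L x).toReal)) :
    Tendsto (fun j => ch.infoReal (P j)) atTop (𝓝 (ch.infoReal L)) := by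
  simp only [infoReal_eq]
  refine (tendsto_finsetSum _ fun x _ => (hlim x).mul_const _).add
    (tendsto_finsetSum _ fun y _ => ?_)
  exact (Real.continuous_negMulLog.tendsto _).comp
    (tendsto_finsetSum _ fun x _ => (hlim x).mul_const _)

theorem tendsto_divReal
    (hlim : ∀ x, Tendsto (fun j => (P j x).toReal) atTop (𝓝 (L x).toReal)) :
    Tendsto (fun j => ch.divReal (P j)) atTop (𝓝 (ch.divReal L)) :=
  tendsto_finsetSum _ fun x _ => (hlim x).mul_const _

/-- Away from zero cost, the objective is continuous along laws of finite cost. -/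
theorem tendsto_objective {β : ℝ} (hβ : 0 < β)
    (hlim : ∀ x, Tendsto (fun j => (P j x).toReal) atTop (𝓝 (L x).toReal))
    (hP : ∀ j, ch.expCost (P j) ≠ ⊤)
    (hK : ∀ j, 0 < ch.costReal (P j)) (hL : 0 < ch.costReal L)
    (hs : ∀ x ∈ ch.alphabet, ch.cost x ≠ ⊤ → (ch.Q x).support ⊆ (ch.Q ch.star).support) :
    Tendsto (fun j => ch.objective β (P j)) atTop (𝓝 (ch.objective β L)) := by
  have hLt := expCost_ne_top_of_tendsto hlim hP
  have hs' : ∀ {P : PMF ch.alphabet}, ch.expCost P ≠ ⊤ →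
      ∀ x ∈ P.support, (ch.Q x).support ⊆ (ch.Q ch.star).support :=
    fun hP x hx => hs x x.2 (cost_ne_top_of_mem_support hP hx)
  rw [objective_eq_ofReal hβ hLt hL (hs' hLt)]
  simp only [fun j => objective_eq_ofReal hβ (hP j) (hK j) (hs' (hP j))]
  refine ENNReal.tendsto_ofReal (Tendsto.min ?_ ?_)
  · exact ((tendsto_infoReal hlim).div_const _).div (tendsto_costReal hlim) hL.ne'
  · exact ((tendsto_divReal hlim).div_const _).div ((tendsto_costReal hlim).mul_const _)
      (by positivity)

end Limits

end Channel

/-! ### Laws that maximize the objective -/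

theorem klReal_self {α : Type*} [Fintype α] (p : PMF α) : klReal p p = 0 := by
  refine Finset.sum_eq_zero fun y _ => ?_
  by_cases hy : (p y).toReal = 0
  · simp [hy]
  · rw [div_self hy]; simp

/-- Divergence is at most the `χ²`-distance. -/
theorem klReal_le_chiSq {α : Type*} [Fintype α] {p q : PMF α} (h : p.support ⊆ q.support) :
    klReal p q ≤ ∑ a, (p a).toReal ^ 2 / (q a).toReal - 1 := by
  have : ∑ a, (p a).toReal ^ 2 / (q a).toReal - 1 =
      ∑ a, ((p a).toReal ^ 2 / (q a).toReal - (p a).toReal) := by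
    rw [Finset.sum_sub_distrib, p.sum_toReal]
  rw [this]
  refine Finset.sum_le_sum fun a _ => ?_
  by_cases ha : a ∈ p.support
  · have hp := PMF.toReal_pos ha
    have hq := PMF.toReal_pos (h ha)
    calc (p a).toReal * Real.log ((p a).toReal / (q a).toReal)
        ≤ (p a).toReal * ((p a).toReal / (q a).toReal - 1) :=
          mul_le_mul_of_nonneg_left (Real.log_le_sub_one_of_pos (by positivity)) hp.le
      _ = _ := by ring
  · rw [(p.apply_eq_zero_iff a).2 ha]; simp

namespace Channel

variable {I Y : Type*} {ch : Channel I Y}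

theorem objective_eq_iSup_of_mem {β : ℝ} {P : PMF ch.alphabet} (hP : P ∈ ch.maximizers β) :
    ch.objective β P = ⨆ P, ch.objective β P :=
  le_antisymm (le_iSup _ P) (iSup_le hP)

variable [Fintype Y]

theorem infoReal_le_divReal {P : PMF ch.alphabet}
    (hs : ∀ x ∈ P.support, (ch.Q x).support ⊆ (ch.Q ch.star).support) :
    ch.infoReal P ≤ ch.divReal P := by
  have := ch.infoReal_add_klReal hs
  rw [divReal, ← this]
  exact le_add_of_nonneg_right (klReal_nonneg (ch.outputLaw_support_subset_iff.2 hs))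

/-- When the idle symbol may be used for free, sending a symbol `x` rarely conveys almost
`D(Q(·|x)‖Q(·|⋆))` per use of `x`: the information lost, `D(Y‖Y⋆)`, is of second order in the
probability of `x`. -/
theorem exists_law_of_star (hstar : ch.star ∈ ch.alphabet) (x : ch.alphabet)
    (hxs : (ch.Q x).support ⊆ (ch.Q ch.star).support) {θ : ℝ} (hθ : θ < 1)
    (hd : 0 < klReal (ch.Q x) (ch.Q ch.star)) :
    ∃ (P : PMF ch.alphabet) (p : ℝ), 0 < p ∧
      (∀ z ∈ P.support, z = x ∨ (z : I) = ch.star) ∧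
      ch.costReal P = p * (ch.cost x).toReal ∧
      ch.divReal P = p * klReal (ch.Q x) (ch.Q ch.star) ∧
      θ * (p * klReal (ch.Q x) (ch.Q ch.star)) ≤ ch.infoReal P := by
  classical
  set r := ch.Q ch.star with hr
  set d := klReal (ch.Q x) r with hd'
  set c : ℝ := ∑ y, (ch.Q x y).toReal ^ 2 / (r y).toReal with hc
  have hc0 : 0 ≤ c := Finset.sum_nonneg fun y _ => by positivity
  set p : ℝ≥0 := min 1 (Real.toNNReal ((1 - θ) * d / (c + 1))) with hp
  have hp1 : p ≤ 1 := min_le_left _ _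
  have hp0 : 0 < (p : ℝ) := by
    have : 0 < p := lt_min one_pos
      (Real.toNNReal_pos.2 (div_pos (mul_pos (by linarith) hd) (by linarith)))
    exact_mod_cast this
  have hpc : (p : ℝ) * c ≤ (1 - θ) * d := by
    have h1 : (p : ℝ) ≤ (1 - θ) * d / (c + 1) := by
      have : (p : ℝ) ≤ ((1 - θ) * d / (c + 1)).toNNReal := by exact_mod_cast min_le_right _ _
      rwa [Real.coe_toNNReal _ (div_nonneg (mul_nonneg (by linarith) hd.le) (by linarith))] at this
    rw [le_div_iff₀ (by linarith)] at h1
    nlinarith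
  let xs : ch.alphabet := ⟨ch.star, hstar⟩
  let coin : PMF Bool := PMF.ofFintype (fun b => if b then (p : ℝ≥0∞) else 1 - p) (by
    simpa using add_tsub_cancel_of_le (show (p : ℝ≥0∞) ≤ 1 by exact_mod_cast hp1))
  let P : PMF ch.alphabet := coin.map fun b => if b then x else xs
  have hsum : ∀ f : ch.alphabet → ℝ,
      ∑ z, (P z).toReal * f z = p * f x + (1 - p) * f xs := by
    intro f
    rw [sum_map_mul, Fintype.sum_bool]
    have e1 : (coin true).toReal = p := by simp [coin]
    have e2 : (coin false).toReal = 1 - p := by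
      simp [coin, ENNReal.toReal_sub_of_le (show (p : ℝ≥0∞) ≤ 1 by exact_mod_cast hp1)]
    rw [e1, e2]
    simp
  have hsupp : ∀ z ∈ P.support, z = x ∨ (z : I) = ch.star := by
    intro z hz
    rw [PMF.mem_support_map_iff] at hz
    obtain ⟨b, -, rfl⟩ := hz
    cases b
    · exact Or.inr rfl
    · exact Or.inl rfl
  have hs : ∀ z ∈ P.support, (ch.Q z).support ⊆ r.support := by
    intro z hz
    rcases hsupp z hz with rfl | h
    · exact hxs
    · rw [h]
  have hxsstar : (xs : I) = ch.star := rfl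
  have hcost : (ch.cost ch.star).toReal = 0 := by
    rw [(ch.cost_eq_zero_iff _ hstar).2 rfl]; rfl
  have hdiv : ch.divReal P = p * d := by
    rw [divReal, hsum]
    simp only [hxsstar, klReal_self, mul_zero, add_zero, ← hr, ← hd']
  refine ⟨P, p, hp0, hsupp, ?_, hdiv, ?_⟩
  · rw [costReal, hsum]
    simp only [hxsstar, hcost, mul_zero, add_zero]
  · have h1 := ch.infoReal_add_klReal hs
    have h2 := klReal_le_chiSq (ch.outputLaw_support_subset_iff.2 hs)
    have h3 : ∑ y, (ch.outputLaw P y).toReal ^ 2 / (r y).toReal - 1 = p ^ 2 * (c - 1) := by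
      have e : ∀ y, (ch.outputLaw P y).toReal ^ 2 / (r y).toReal =
          p ^ 2 * ((ch.Q x y).toReal ^ 2 / (r y).toReal) +
            (2 * p * (1 - p) * (ch.Q x y).toReal + (1 - p) ^ 2 * (r y).toReal) := by
        intro y
        rw [outputLaw_apply_toReal, hsum]
        simp only [hxsstar, ← hr]
        by_cases hy : y ∈ r.support
        · have := PMF.toReal_pos hy
          field_simp
          ring
        · have : y ∉ (ch.Q x).support := fun h => hy (hxs h)
          rw [(r.apply_eq_zero_iff y).2 hy, ((ch.Q x).apply_eq_zero_iff y).2 this]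
          simp
      simp only [e, Finset.sum_add_distrib, ← Finset.mul_sum, PMF.sum_toReal, ← hc]
      ring
    rw [h3] at h2
    have h4 : ch.divReal P = ∑ z, (P z).toReal * klReal (ch.Q z) r := rfl
    rw [← h4, hdiv] at h1
    have : (p : ℝ) * (p * c) ≤ p * ((1 - θ) * d) := mul_le_mul_of_nonneg_left hpc hp0.le
    nlinarith [sq_nonneg (p : ℝ)]

/-- If the outputs of all symbols of finite cost can be produced by noise, the objective attains its
supremum. -/
theorem maximizers_nonempty {β : ℝ} (hβ : 0 < β)
    (hs : ∀ x ∈ ch.alphabet, ch.cost x ≠ ⊤ → (ch.Q x).support ⊆ (ch.Q ch.star).support)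
    {P₀ : PMF ch.alphabet} (hP₀ : ch.objective β P₀ ≠ 0) : (ch.maximizers β).Nonempty := by
  classical
  have hs' : ∀ {P : PMF ch.alphabet}, ch.expCost P ≠ ⊤ →
      ∀ x ∈ P.support, (ch.Q x).support ⊆ (ch.Q ch.star).support :=
    fun hP x hx => hs x x.2 (cost_ne_top_of_mem_support hP hx)
  have hl2 : 0 < Real.log 2 := Real.log_pos one_lt_two
  have hP₀t := expCost_ne_top_of_objective hP₀
  have hP₀K := costReal_pos_of_objective hP₀
  have hP₀I := infoReal_pos_of_objective hP₀
  have hP₀D := hP₀I.trans_le (infoReal_le_divReal (hs' hP₀t))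
  by_cases hstar : ch.star ∈ ch.alphabet
  -- with a free symbol, the timing constraint is the binding one for rare uses of the symbol of
  -- largest divergence per unit cost
  · set F : Finset ch.alphabet :=
      Finset.univ.filter fun x => ch.cost x ≠ ⊤ ∧ (x : I) ≠ ch.star with hF
    have hk : ∀ x ∈ F, 0 < (ch.cost x).toReal := by
      intro x hx
      rw [hF, Finset.mem_filter] at hx
      exact ENNReal.toReal_pos (fun h => hx.2.2 ((ch.cost_eq_zero_iff x x.2).1 h)) hx.2.1
    have hFne : F.Nonempty := by
      by_contra hF0
      rw [Finset.not_nonempty_iff_eq_empty] at hF0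
      refine hP₀K.ne' (Finset.sum_eq_zero fun x _ => ?_)
      have hx : x ∉ F := by rw [hF0]; simp
      rw [hF, Finset.mem_filter, not_and, not_and, not_not] at hx
      by_cases h : ch.cost x = ⊤
      · rw [h]; simp
      · rw [(ch.cost_eq_zero_iff x x.2).2 (hx (Finset.mem_univ _) h)]; simp
    obtain ⟨x, hxF, hmax⟩ := Finset.exists_max_image F
      (fun x => klReal (ch.Q x) (ch.Q ch.star) / (ch.cost x).toReal) hFne
    have hkx := hk x hxF
    have hxF' := hxF
    rw [hF, Finset.mem_filter] at hxF'
    set d := klReal (ch.Q x) (ch.Q ch.star) with hd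
    set k := (ch.cost x).toReal with hkdef
    have hbound : ∀ P : PMF ch.alphabet, ch.expCost P ≠ ⊤ →
        ch.divReal P ≤ d / k * ch.costReal P := by
      intro P hP
      rw [divReal, costReal, Finset.mul_sum]
      refine Finset.sum_le_sum fun z _ => ?_
      by_cases hz : z ∈ P.support
      · rw [mul_left_comm]
        refine mul_le_mul_of_nonneg_left ?_ ENNReal.toReal_nonneg
        by_cases hzs : (z : I) = ch.star
        · rw [hzs, klReal_self, (ch.cost_eq_zero_iff _ hstar).2 rfl]; simp
        · have hzF : z ∈ F := by
            rw [hF, Finset.mem_filter]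
            exact ⟨Finset.mem_univ _, cost_ne_top_of_mem_support hP hz, hzs⟩
          have := hmax z hzF
          rwa [div_le_iff₀ (hk z hzF)] at this
      · rw [(P.apply_eq_zero_iff z).2 hz]; simp
    have hdk : 0 < d / k := by
      have := hP₀D.trans_le (hbound P₀ hP₀t)
      exact pos_of_mul_pos_left this hP₀K.le
    have hd0 : 0 < d := by
      have := mul_pos hdk hkx
      rwa [div_mul_cancel₀ _ hkx.ne'] at this
    obtain ⟨P, p, hp, hsupp, hcost, hdiv, hinfo⟩ := exists_law_of_star hstar x
      (hs x x.2 hxF'.2.1) (θ := 1 / (1 + β)) (by rw [div_lt_one (by linarith)]; linarith) hd0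
    have hPt : ch.expCost P ≠ ⊤ := by
      rw [expCost, Ne, ENNReal.sum_eq_top]
      rintro ⟨z, -, hz⟩
      by_cases hzP : z ∈ P.support
      · rcases hsupp z hzP with rfl | h
        · exact ENNReal.mul_ne_top (P.apply_ne_top _) hxF'.2.1 hz
        · rw [h, (ch.cost_eq_zero_iff _ hstar).2 rfl, mul_zero] at hz
          exact ENNReal.zero_ne_top hz
      · rw [(P.apply_eq_zero_iff z).2 hzP, zero_mul] at hz
        exact ENNReal.zero_ne_top hz
    have hPK : 0 < ch.costReal P := by rw [hcost]; positivity
    refine ⟨P, fun P' => ?_⟩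
    by_cases hP' : ch.objective β P' = 0
    · rw [hP']; exact bot_le
    have hP't := expCost_ne_top_of_objective hP'
    have hP'K := costReal_pos_of_objective hP'
    rw [objective_eq_ofReal hβ hP't hP'K (hs' hP't), objective_eq_ofReal hβ hPt hPK (hs' hPt)]
    refine ENNReal.ofReal_le_ofReal ((min_le_right _ _).trans ?_)
    have h1 : ch.divReal P' / Real.log 2 / (ch.costReal P' * (1 + β)) ≤
        d / k / Real.log 2 / (1 + β) := by
      rw [div_div, div_div, div_le_div_iff₀ (by positivity) (by positivity)]
      have := mul_le_mul_of_nonneg_right (hbound P' hP't)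
        (show 0 ≤ Real.log 2 * (1 + β) by positivity)
      calc _ ≤ _ := this
        _ = _ := by ring
    refine h1.trans (le_min ?_ ?_)
    · rw [hcost, div_div, div_div, div_div, div_le_div_iff₀ (by positivity) (by positivity)]
      rw [div_mul_eq_mul_div, one_mul, div_le_iff₀ (by linarith)] at hinfo
      have := mul_le_mul_of_nonneg_right hinfo (show 0 ≤ k * Real.log 2 by positivity)
      linarith
    · rw [hcost, hdiv, ← hkdef, ← hd]
      apply le_of_eq
      field_simp
  -- otherwise all costs are positive, the objective is continuous and compactness applies
  · have hsup0 : (⨆ P, ch.objective β P) ≠ 0 := fun h =>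
      hP₀ (le_antisymm (h ▸ le_iSup (ch.objective β) P₀) bot_le)
    obtain ⟨u, -, hu, hur⟩ := exists_seq_tendsto_sSup (S := Set.range (ch.objective β))
      ⟨_, P₀, rfl⟩ (OrderTop.bddAbove _)
    choose P hP using hur
    obtain ⟨N, hN⟩ := eventually_atTop.1 (hu.eventually (isOpen_ne.mem_nhds hsup0))
    obtain ⟨L, φ, hφ, hlim⟩ := PMF.exists_tendsto_subseq fun j => P (N + j)
    have hne : ∀ j, ch.objective β (P (N + φ j)) ≠ 0 := fun j => by
      rw [hP]; exact hN _ (Nat.le_add_right _ _)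
    have hLt := expCost_ne_top_of_tendsto hlim fun j => expCost_ne_top_of_objective (hne j)
    have hL : 0 < ch.costReal L := by
      obtain ⟨x, hx⟩ := L.support_nonempty
      refine Finset.sum_pos' (fun x _ => by positivity) ⟨x, Finset.mem_univ _, ?_⟩
      refine mul_pos (PMF.toReal_pos hx) (ENNReal.toReal_pos (fun h => hstar ?_)
        (cost_ne_top_of_mem_support hLt hx))
      rw [← (ch.cost_eq_zero_iff x x.2).1 h]; exact x.2
    have hlimobj := tendsto_objective hβ hlim (fun j => expCost_ne_top_of_objective (hne j))
      (fun j => costReal_pos_of_objective (hne j)) hL hs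
    have h2 : Tendsto (fun j => ch.objective β (P (N + φ j))) atTop
        (𝓝 (sSup (Set.range (ch.objective β)))) := by
      simp only [hP]
      refine hu.comp (tendsto_atTop_mono (fun j => ?_) hφ.tendsto_atTop)
      exact Nat.le_add_left _ _
    refine ⟨L, fun P' => ?_⟩
    rw [tendsto_nhds_unique hlimobj h2]
    exact le_sSup ⟨P', rfl⟩

theorem nStar_eq_mul (ch : Channel I Y) (β : ℝ) {B : ℕ} (hB : 0 < B) :
    ch.nStar β B = B * ch.nStar β 1 := by
  have h0 : (B : ℝ≥0∞) ≠ 0 := by exact_mod_cast hB.ne'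
  rw [nStar, nStar, ENNReal.mul_iInf_of_ne h0 (ENNReal.natCast_ne_top B)]
  refine iInf_congr fun P => ?_
  rw [ENNReal.mul_iInf_of_ne h0 (ENNReal.natCast_ne_top B)]
  refine iInf_congr fun _ => ?_
  rw [Nat.cast_one, mul_div_assoc', mul_one]

theorem nStar_one_le {β : ℝ} {P : PMF ch.alphabet} (hP : P ∈ ch.maximizers β) :
    ch.nStar β 1 ≤ (ch.capacity β 1 * ch.expCost P)⁻¹ := by
  refine (iInf₂_le P hP).trans ?_
  rw [Nat.cast_one, one_div]

theorem nStar_one_ne_zero {β : ℝ} (h0 : (⨆ P, ch.objective β P) ≠ 0)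
    (hcap : ch.capacity β 1 ≠ ⊤) : ch.nStar β 1 ≠ 0 := by
  set k : ℝ≥0∞ := ∑ x : ch.alphabet, (if ch.cost x = ⊤ then 0 else ch.cost x) with hk
  have hkt : k ≠ ⊤ := ENNReal.sum_ne_top.2 fun x _ => by split_ifs with h <;> simp [h]
  have : (ch.capacity β 1 * k)⁻¹ ≤ ch.nStar β 1 := by
    refine le_iInf₂ fun P hP => ?_
    rw [Nat.cast_one, one_div, ENNReal.inv_le_inv]
    gcongr
    have hPt : ch.expCost P ≠ ⊤ :=
      expCost_ne_top_of_objective (by rw [objective_eq_iSup_of_mem hP]; exact h0)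
    rw [hk, expCost]
    refine Finset.sum_le_sum fun x _ => ?_
    by_cases hx : x ∈ P.support
    · rw [if_neg (cost_ne_top_of_mem_support hPt hx)]
      exact mul_le_of_le_one_left' (P.coe_le_one x)
    · rw [(P.apply_eq_zero_iff x).2 hx, zero_mul]; exact bot_le
  intro h
  rw [h] at this
  exact ENNReal.inv_ne_zero.2 (ENNReal.mul_ne_top hcap hkt) (le_antisymm this bot_le)

theorem nStar_one_ne_top {β : ℝ} (h0 : (⨆ P, ch.objective β P) ≠ 0)
    (hcap : ch.capacity β 1 ≠ 0) (hne : (ch.maximizers β).Nonempty) : ch.nStar β 1 ≠ ⊤ := by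
  obtain ⟨P, hP⟩ := hne
  have hP0 : ch.objective β P ≠ 0 := by rw [objective_eq_iSup_of_mem hP]; exact h0
  refine ne_top_of_le_ne_top ?_ (nStar_one_le hP)
  rw [ENNReal.inv_ne_top, expCost_eq_ofReal (expCost_ne_top_of_objective hP0)]
  exact mul_ne_zero hcap (ENNReal.ofReal_pos.2 (costReal_pos_of_objective hP0)).ne'

end Channel

/-! ### Converse: the delay -/

namespace Channel

variable {I Y : Type*} [Fintype Y] {ch : Channel I Y}

/-- The converse for the delay: the input laws extracted from the codes approach the maximizers of
the objective, whose mean cost bounds the number of channel uses from below. -/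
theorem Achieves.eventually_nStar_le {β ρ : ℝ} (hβ : 0 < β)
    (hcap : ch.capacity β 1 = ⨆ P, ch.objective β P) (h0 : 0 < ch.capacity β 1)
    (ht : ch.capacity β 1 < ⊤)
    (hs : ∀ x ∈ ch.alphabet, ch.cost x ≠ ⊤ → (ch.Q x).support ⊆ (ch.Q ch.star).support)
    {C : ∀ B : ℕ, Code ch B (asyncLevel β B)} {ε : ℕ → ℝ}
    (h : ch.Achieves β ρ (ch.capacity β 1).toNNReal C ε) {δ : ℝ} (hδ : 0 < δ) :
    ∀ᶠ B : ℕ in atTop, (1 - δ) * (ch.nStar β B).toReal ≤ ((C B).delay (ε B) : ℝ) := by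
  rcases le_or_gt 1 δ with hδ1 | hδ1
  · refine Eventually.of_forall fun B => le_trans ?_ (Nat.cast_nonneg _)
    exact mul_nonpos_of_nonpos_of_nonneg (by linarith) ENNReal.toReal_nonneg
  have hsup0 : (⨆ P, ch.objective β P) ≠ 0 := hcap ▸ h0.ne'
  set S := (ch.capacity β 1).toReal with hS
  have hS0 : 0 < S := ENNReal.toReal_pos h0.ne' ht.ne
  set c₀ := (ch.nStar β 1).toReal with hc₀
  have hRS : ((ch.capacity β 1).toNNReal : ℝ≥0∞) = ch.capacity β 1 := ENNReal.coe_toNNReal ht.ne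
  by_contra hcon
  replace hcon := Filter.not_eventually.1 hcon
  have hη : ∀ j : ℕ, 0 < 1 / ((j : ℝ) + 2) := fun j => by positivity
  have hη1 : ∀ j : ℕ, 1 / ((j : ℝ) + 2) ≤ 1 := fun j => by
    rw [div_le_one (by positivity)]; linarith [(Nat.cast_nonneg j : (0 : ℝ) ≤ j)]
  have hηlt : ∀ j : ℕ, 1 / ((j : ℝ) + 2) < 1 := fun j => by
    rw [div_lt_one (by positivity)]; linarith [(Nat.cast_nonneg j : (0 : ℝ) ≤ j)]
  -- along a sequence of violations, the laws of the converse are nearly optimal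
  have hsel : ∀ j : ℕ, ∃ B : ℕ, j + 1 ≤ B ∧ ε B < S ∧
      ((C B).delay (ε B) : ℝ) < (1 - δ) * (ch.nStar β B).toReal ∧
      ∃ (P : PMF ch.alphabet) (n' : ℕ), 0 < n' ∧ n' ≤ (C B).delay (ε B) + 1 ∧
      ENNReal.ofReal ((1 - 1 / ((j : ℝ) + 2)) * B) / (n' * ch.expCost P) ≤ ch.objective β P ∧
      ENNReal.ofReal (1 - 1 / ((j : ℝ) + 2)) *
        (ch.capacity β 1 - ENNReal.ofReal (ε B)) ≤ ch.objective β P := by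
    intro j
    have hev := h.le_iSup_objective hβ (hη j) (hη1 j)
    rw [hRS] at hev
    obtain ⟨B, hB1, hB2, hB3, hB4⟩ := (hcon.and_eventually (hev.and
      ((eventually_ge_atTop (j + 1)).and (h.tendsto_zero.eventually_lt_const hS0)))).exists
    exact ⟨B, hB3, hB4, not_le.1 hB1, hB2⟩
  choose B hBj hεB hdel P n' hn0 hn' hinfo hobj using hsel
  have hBt : Tendsto B atTop atTop :=
    tendsto_atTop_mono (fun j => (Nat.le_succ j).trans (hBj j)) tendsto_id
  have hobj0 : ∀ j, ch.objective β (P j) ≠ 0 := by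
    intro j h
    have := hobj j
    rw [h, nonpos_iff_eq_zero, mul_eq_zero, ENNReal.ofReal_eq_zero, tsub_eq_zero_iff_le] at this
    rcases this with h1 | h1
    · linarith [hηlt j]
    · rw [← ENNReal.ofReal_toReal ht.ne, ENNReal.ofReal_le_ofReal_iff'] at h1
      rcases h1 with h1 | h1
      · exact absurd (hεB j) (not_lt.2 h1)
      · exact absurd hS0 (not_lt.2 h1)
  have hPt := fun j => expCost_ne_top_of_objective (hobj0 j)
  have hPK := fun j => costReal_pos_of_objective (hobj0 j)
  have hs' : ∀ {P : PMF ch.alphabet}, ch.expCost P ≠ ⊤ →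
      ∀ x ∈ P.support, (ch.Q x).support ⊆ (ch.Q ch.star).support :=
    fun hP x hx => hs x x.2 (cost_ne_top_of_mem_support hP hx)
  -- few channel uses force a high cost per channel use
  have hcost : ∀ j : ℕ, 1 - 1 / ((j : ℝ) + 2) ≤
      ((1 - δ) * c₀ + 1 / B j) * (S * ch.costReal (P j)) := by
    intro j
    have hBpos : 0 < B j := by have := hBj j; omega
    have hB0 : (0 : ℝ) < B j := by exact_mod_cast hBpos
    have hl2 : 0 < Real.log 2 := Real.log_pos one_lt_two
    have h1 : (n' j : ℝ) ≤ (1 - δ) * (B j * c₀) + 1 := by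
      have e : (ch.nStar β (B j)).toReal = B j * c₀ := by
        rw [nStar_eq_mul ch β hBpos, ENNReal.toReal_mul, ENNReal.toReal_natCast]
      have := hdel j
      rw [e] at this
      have h2 : (n' j : ℝ) ≤ ((C (B j)).delay (ε (B j)) : ℝ) + 1 := by exact_mod_cast hn' j
      linarith
    have hn0' : (0 : ℝ) < n' j := by exact_mod_cast hn0 j
    have h2 : (1 - 1 / ((j : ℝ) + 2)) * B j ≤ S * (n' j * ch.costReal (P j)) := by
      have h3 : ENNReal.ofReal ((1 - 1 / ((j : ℝ) + 2)) * B j) / (n' j * ch.expCost (P j)) ≤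
          ENNReal.ofReal S := by
        rw [ENNReal.ofReal_toReal ht.ne, hcap]
        exact (hinfo j).trans (le_iSup (ch.objective β) (P j))
      rw [expCost_eq_ofReal (hPt j), ← ENNReal.ofReal_natCast (n' j),
        ← ENNReal.ofReal_mul (Nat.cast_nonneg _), ENNReal.div_le_iff
        (ENNReal.ofReal_pos.2 (mul_pos hn0' (hPK j))).ne' ENNReal.ofReal_ne_top,
        ← ENNReal.ofReal_mul hS0.le] at h3
      exact (ENNReal.ofReal_le_ofReal_iff
        (mul_nonneg hS0.le (mul_nonneg hn0'.le (hPK j).le))).1 h3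
    have h3 : S * (n' j * ch.costReal (P j)) ≤
        ((1 - δ) * (B j * c₀) + 1) * (S * ch.costReal (P j)) := by
      rw [mul_left_comm]
      exact mul_le_mul_of_nonneg_right h1 (mul_nonneg hS0.le (hPK j).le)
    refine le_of_mul_le_mul_right ((h2.trans h3).trans (le_of_eq ?_)) hB0
    field_simp
  -- a limit of these laws is a maximizer whose cost is too high for its delay
  obtain ⟨L, φ, hφ, hlim⟩ := PMF.exists_tendsto_subseq P
  have hφt : Tendsto φ atTop atTop := hφ.tendsto_atTop
  have hlimη : Tendsto (fun j : ℕ => 1 - 1 / ((j : ℝ) + 2)) atTop (𝓝 (1 - 0)) :=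
    (tendsto_const_nhds.div_atTop
      (tendsto_atTop_add_const_right _ _ tendsto_natCast_atTop_atTop)).const_sub 1
  have hlimB : Tendsto (fun j : ℕ => 1 / (B j : ℝ)) atTop (𝓝 0) :=
    tendsto_const_nhds.div_atTop (tendsto_natCast_atTop_atTop.comp hBt)
  have hLcost : 1 - 0 ≤ ((1 - δ) * c₀ + 0) * (S * ch.costReal L) :=
    le_of_tendsto_of_tendsto' (hlimη.comp hφt)
      (((hlimB.comp hφt).const_add _).mul ((tendsto_costReal hlim).const_mul S))
      fun j => hcost (φ j)
  rw [sub_zero, add_zero] at hLcost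
  have hL : 0 < ch.costReal L := by
    refine lt_of_le_of_ne (costReal_nonneg L) fun h => ?_
    rw [← h, mul_zero, mul_zero] at hLcost
    linarith
  have hLobj := tendsto_objective hβ hlim (fun j => hPt (φ j)) (fun j => hPK (φ j)) hL hs
  have hLt := expCost_ne_top_of_tendsto hlim fun j => hPt (φ j)
  have hlimR : Tendsto (fun j : ℕ => ENNReal.ofReal (1 - 1 / ((j : ℝ) + 2)) *
      (ch.capacity β 1 - ENNReal.ofReal (ε (B j)))) atTop
      (𝓝 (ENNReal.ofReal (1 - 0) * (ch.capacity β 1 - ENNReal.ofReal 0))) := by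
    refine ENNReal.Tendsto.mul (ENNReal.tendsto_ofReal hlimη) (Or.inl (by simp))
      (ENNReal.Tendsto.sub tendsto_const_nhds
        (ENNReal.tendsto_ofReal (h.tendsto_zero.comp hBt)) (Or.inl ht.ne))
      (Or.inr ENNReal.ofReal_ne_top)
  rw [sub_zero, ENNReal.ofReal_one, one_mul, ENNReal.ofReal_zero, tsub_zero] at hlimR
  have hLmax : L ∈ ch.maximizers β := by
    intro P'
    refine le_trans ?_ (le_of_tendsto_of_tendsto' (hlimR.comp hφt) hLobj fun j => hobj (φ j))
    rw [hcap]
    exact le_iSup (ch.objective β) P'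
  have hc₀pos : 0 < c₀ := ENNReal.toReal_pos (nStar_one_ne_zero hsup0 ht.ne)
    (nStar_one_ne_top hsup0 h0.ne' ⟨L, hLmax⟩)
  have hc₀le : c₀ * (S * ch.costReal L) ≤ 1 := by
    have h1 := nStar_one_le hLmax
    rw [expCost_eq_ofReal hLt, ← ENNReal.ofReal_toReal ht.ne, ← hS, ← ENNReal.ofReal_mul hS0.le,
      ← ENNReal.ofReal_inv_of_pos (mul_pos hS0 hL)] at h1
    have h2 := ENNReal.toReal_le_of_le_ofReal (inv_nonneg.2 (mul_pos hS0 hL).le) h1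
    rwa [← one_div, le_div_iff₀ (mul_pos hS0 hL)] at h2
  nlinarith

end Channel

/-! ### Codebooks -/

section Feinstein

theorem PMF.mul_toOuterMeasure_le_of_forall {α : Type*} [Fintype α] {p q : PMF α} {G : Set α}
    {a : ℝ≥0∞} (h : ∀ y ∈ G, a * q y ≤ p y) : a * q.toOuterMeasure G ≤ p.toOuterMeasure G := by
  rw [PMF.toOuterMeasure_apply_fintype, PMF.toOuterMeasure_apply_fintype, Finset.mul_sum]
  refine Finset.sum_le_sum fun y _ => ?_
  by_cases hy : y ∈ G
  · rw [Set.indicator_of_mem hy, Set.indicator_of_mem hy]; exact h y hy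
  · simp [Set.indicator_of_notMem hy]

theorem PMF.toOuterMeasure_bind_fintype {X Y : Type*} [Fintype X] (P : PMF X) (W : X → PMF Y)
    (S : Set Y) : (P.bind W).toOuterMeasure S = ∑ x, P x * (W x).toOuterMeasure S := by
  rw [PMF.toOuterMeasure_bind_apply, tsum_fintype]

/-- Feinstein's lemma: codewords are chosen greedily, each with a decoding set disjoint from the
previous ones. -/
theorem feinstein {X Y : Type*} [Fintype X] [Nonempty X] (P : PMF X) (W : X → PMF Y)
    (G : X → Set Y) {θ ε : ℝ≥0∞} (hθ : ∀ x, (P.bind W).toOuterMeasure (G x) ≤ θ)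
    (hG : 1 - ε ≤ ∑ x, P x * (W x).toOuterMeasure (G x)) (M : ℕ) :
    ∃ (c : Fin M → X) (D : Fin M → Set Y), (∀ i, D i ⊆ G (c i)) ∧
      Pairwise (Function.onFun Disjoint D) ∧
      ∀ i, 1 - ε - M * θ ≤ (W (c i)).toOuterMeasure (D i) := by
  induction M with
  | zero => exact ⟨Fin.elim0, Fin.elim0, fun i => i.elim0, fun i => i.elim0, fun i => i.elim0⟩
  | succ M ih =>
    obtain ⟨c, D, h1, h2, h3⟩ := ih
    set U : Set Y := ⋃ i, D i with hU
    have hqU : (P.bind W).toOuterMeasure U ≤ M * θ := by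
      calc _ ≤ ∑ i, (P.bind W).toOuterMeasure (D i) := by
            rw [hU]
            exact (MeasureTheory.measure_iUnion_le D).trans (le_of_eq (tsum_fintype _))
        _ ≤ ∑ i : Fin M, θ := Finset.sum_le_sum fun i _ =>
            (MeasureTheory.measure_mono (h1 i)).trans (hθ (c i))
        _ = M * θ := by simp
    -- the best new codeword does at least as well as a random one
    obtain ⟨x, -, hx⟩ := Finset.exists_max_image Finset.univ
      (fun x => (W x).toOuterMeasure (G x \ U)) (Finset.univ_nonempty (α := X))
    have hx1 : 1 - ε - M * θ ≤ (W x).toOuterMeasure (G x \ U) := by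
      calc 1 - ε - M * θ ≤ ∑ x, P x * (W x).toOuterMeasure (G x) - M * θ := by gcongr
        _ ≤ ∑ x, P x * (W x).toOuterMeasure (G x \ U) := by
            rw [tsub_le_iff_right]
            calc ∑ x, P x * (W x).toOuterMeasure (G x)
                ≤ ∑ x, P x * ((W x).toOuterMeasure (G x \ U) + (W x).toOuterMeasure U) := by
                  gcongr with x
                  refine (MeasureTheory.measure_mono ?_).trans (MeasureTheory.measure_union_le _ _)
                  rw [Set.sdiff_union_self]
                  exact Set.subset_union_left
              _ ≤ _ := by
                  simp only [mul_add, Finset.sum_add_distrib]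
                  gcongr
                  rw [← PMF.toOuterMeasure_bind_fintype]; exact hqU
        _ ≤ ∑ z, P z * (W x).toOuterMeasure (G x \ U) := by
            exact Finset.sum_le_sum fun z _ => mul_le_mul_right (hx z (Finset.mem_univ z)) _
        _ = _ := by rw [← Finset.sum_mul, PMF.sum_coe, one_mul]
    refine ⟨Fin.cons x c, Fin.cons (G x \ U) D, ?_, ?_, ?_⟩
    · intro i
      refine Fin.cases ?_ (fun i => ?_) i
      · simp
      · simpa using h1 i
    · have hdis : ∀ i, Disjoint (G x \ U) (D i) := fun i =>
        Set.disjoint_sdiff_left.mono_right (Set.subset_iUnion D i)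
      intro i j hij
      induction i using Fin.cases with
      | zero =>
        induction j using Fin.cases with
        | zero => exact absurd rfl hij
        | succ j => simpa [Function.onFun] using hdis j
      | succ i =>
        induction j using Fin.cases with
        | zero => simpa [Function.onFun] using (hdis i).symm
        | succ j => simpa [Function.onFun] using h2 (fun h => hij (by rw [h]))
    · have hmono : 1 - ε - ((M + 1 : ℕ) : ℝ≥0∞) * θ ≤ 1 - ε - M * θ := by
        gcongr
        exact Nat.le_succ M
      intro i
      refine Fin.cases ?_ (fun i => ?_) i
      · simpa using hmono.trans hx1
      · simpa using hmono.trans (h3 i)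

end Feinstein

namespace Channel

variable {I Y : Type*} [Fintype Y] {ch : Channel I Y}

/-- The joint law of the input and the output. -/
noncomputable def jointLaw (ch : Channel I Y) (P : PMF ch.alphabet) : PMF (ch.alphabet × Y) :=
  P.bind fun x => (ch.Q x).map fun y => (x, y)

theorem jointLaw_apply (P : PMF ch.alphabet) (x : ch.alphabet) (y : Y) :
    ch.jointLaw P (x, y) = P x * ch.Q x y := bind_map_mk_apply P (fun x => ch.Q x) x y

theorem mem_support_jointLaw {P : PMF ch.alphabet} {z : ch.alphabet × Y} :
    z ∈ (ch.jointLaw P).support ↔ z.1 ∈ P.support ∧ z.2 ∈ (ch.Q z.1).support := by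
  rw [PMF.mem_support_iff, ← Prod.mk.eta (p := z), jointLaw_apply, mul_ne_zero_iff]
  rfl

theorem sum_jointLaw (P : PMF ch.alphabet) (f : ch.alphabet × Y → ℝ) :
    ∑ z, (ch.jointLaw P z).toReal * f z =
      ∑ x, (P x).toReal * ∑ y, (ch.Q x y).toReal * f (x, y) := by
  rw [Fintype.sum_prod_type]
  refine Finset.sum_congr rfl fun x _ => ?_
  rw [Finset.mul_sum]
  refine Finset.sum_congr rfl fun y _ => ?_
  rw [jointLaw_apply, ENNReal.toReal_mul, mul_assoc]

theorem bind_prodPMF (P : PMF ch.alphabet) (n : ℕ) :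
    ((prodPMF fun _ : Fin n => P).bind fun x => prodPMF fun i => ch.Q (x i)) =
      prodPMF fun _ : Fin n => ch.outputLaw P := by
  classical
  ext y
  rw [PMF.bind_apply, tsum_fintype, prodPMF_apply]
  simp only [prodPMF_apply, outputLaw_apply, ← Finset.prod_mul_distrib]
  rw [Fintype.prod_sum]

theorem sum_prodPMF_jointLaw (P : PMF ch.alphabet) (n : ℕ)
    (S : (Fin n → ch.alphabet) → Set (Fin n → Y)) :
    ∑ x, (prodPMF fun _ : Fin n => P) x *
      (prodPMF fun i => ch.Q (x i)).toOuterMeasure (S x) =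
      (prodPMF fun _ : Fin n => ch.jointLaw P).toOuterMeasure
        {z | (fun i => (z i).2) ∈ S fun i => (z i).1} := by
  classical
  rw [PMF.toOuterMeasure_apply_fintype, ← (Equiv.arrowProdEquivProdArrow (Fin n)
    (fun _ => ch.alphabet) (fun _ => Y)).symm.sum_comp, Fintype.sum_prod_type]
  refine Finset.sum_congr rfl fun x _ => ?_
  rw [PMF.toOuterMeasure_apply_fintype, Finset.mul_sum]
  refine Finset.sum_congr rfl fun y _ => ?_
  have e : (prodPMF fun _ : Fin n => ch.jointLaw P)
      ((Equiv.arrowProdEquivProdArrow (Fin n) (fun _ => ch.alphabet) (fun _ => Y)).symm (x, y)) =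
      (prodPMF fun _ : Fin n => P) x * (prodPMF fun i => ch.Q (x i)) y := by
    simp only [prodPMF_apply, ← Finset.prod_mul_distrib]
    exact Finset.prod_congr rfl fun i _ => jointLaw_apply P _ _
  by_cases h : y ∈ S x
  · rw [Set.indicator_of_mem h, Set.indicator_of_mem (by exact h), e]
  · rw [Set.indicator_of_notMem h, Set.indicator_of_notMem (by exact h), mul_zero]

/-- With high probability the likelihood of the output exceeds that under independent outputs of
law `r` by a factor with the exponent that the law of large numbers predicts. -/
theorem likelihood_law (P : PMF ch.alphabet) (r : PMF Y) (f : ch.alphabet × Y → ℝ)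
    (hf : ∀ z ∈ (ch.jointLaw P).support, ENNReal.ofReal (Real.exp (f z)) * r z.2 ≤ ch.Q z.1 z.2)
    {u δ : ℝ} (hu : u < ∑ z, (ch.jointLaw P z).toReal * f z) (hδ : 0 < δ) :
    ∀ᶠ n : ℕ in atTop, (prodPMF fun _ : Fin n => ch.jointLaw P).toOuterMeasure
      {z | ¬ ENNReal.ofReal (Real.exp (n * u)) * (prodPMF fun _ => r) (fun i => (z i).2) ≤
        (prodPMF fun i => ch.Q (z i).1) fun i => (z i).2} ≤ ENNReal.ofReal δ := by
  filter_upwards [weak_law (ch.jointLaw P) f (sub_pos.2 hu) hδ] with n hn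
  refine le_trans (PMF.toOuterMeasure_mono _ ?_) hn
  rintro z ⟨hz, hzs⟩
  rw [Set.mem_ofPred_eq] at hz ⊢
  by_contra hlt
  refine hz ?_
  have hzs' : ∀ i, z i ∈ (ch.jointLaw P).support := by
    rw [PMF.mem_support_iff, prodPMF_apply, Finset.prod_ne_zero_iff] at hzs
    exact fun i => hzs i (Finset.mem_univ i)
  have h1 : n * u ≤ ∑ i, f (z i) := by
    have := (abs_lt.1 (not_le.1 hlt)).1
    linarith
  calc ENNReal.ofReal (Real.exp (n * u)) * (prodPMF fun _ => r) (fun i => (z i).2)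
      ≤ ENNReal.ofReal (Real.exp (∑ i, f (z i))) * (prodPMF fun _ => r) (fun i => (z i).2) := by
        gcongr
    _ = ∏ i, (ENNReal.ofReal (Real.exp (f (z i))) * r (z i).2) := by
        rw [Real.exp_sum, ENNReal.ofReal_prod_of_nonneg fun i _ => (Real.exp_pos _).le,
          prodPMF_apply, Finset.prod_mul_distrib]
    _ ≤ _ := Finset.prod_le_prod' fun i _ => hf _ (hzs' i)

theorem ofReal_exp_log_div_mul {p q : ℝ≥0∞} (hp : p ≠ 0) (hp' : p ≠ ⊤) (hq : q ≠ 0) (hq' : q ≠ ⊤) :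
    ENNReal.ofReal (Real.exp (Real.log (p.toReal / q.toReal))) * q = p := by
  have h1 := ENNReal.toReal_pos hp hp'
  have h2 := ENNReal.toReal_pos hq hq'
  rw [Real.exp_log (by positivity)]
  nth_rewrite 2 [← ENNReal.ofReal_toReal hq']
  rw [← ENNReal.ofReal_mul (by positivity), div_mul_cancel₀ _ h2.ne', ENNReal.ofReal_toReal hp']

/-- The information density, as an exponent. -/
theorem exists_info_exponent (P : PMF ch.alphabet) :
    ∃ f : ch.alphabet × Y → ℝ, (∀ z ∈ (ch.jointLaw P).support,
      ENNReal.ofReal (Real.exp (f z)) * ch.outputLaw P z.2 ≤ ch.Q z.1 z.2) ∧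
      ∑ z, (ch.jointLaw P z).toReal * f z = ch.infoReal P := by
  refine ⟨fun z => Real.log ((ch.Q z.1 z.2).toReal / (ch.outputLaw P z.2).toReal),
    fun z hz => ?_, ?_⟩
  · rw [mem_support_jointLaw] at hz
    exact (ofReal_exp_log_div_mul hz.2 (PMF.apply_ne_top _ _)
      (ch.support_subset_outputLaw hz.1 hz.2) (PMF.apply_ne_top _ _)).le
  · rw [sum_jointLaw]; rfl

/-- The log-likelihood ratio against noise, as an exponent.  If some output of positive probability
cannot be produced by noise, it may be given any finite weight in the exponent. -/
theorem exists_noise_exponent (P : PMF ch.alphabet) {w : ℝ}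
    (hw : ENNReal.ofReal (w / Real.log 2) <
      ch.mutualInfo P + divBits (ch.outputLaw P) (ch.Q ch.star)) (hw0 : 0 ≤ w) :
    ∃ f : ch.alphabet × Y → ℝ, (∀ z ∈ (ch.jointLaw P).support,
      ENNReal.ofReal (Real.exp (f z)) * ch.Q ch.star z.2 ≤ ch.Q z.1 z.2) ∧
      w < ∑ z, (ch.jointLaw P z).toReal * f z := by
  classical
  have hl2 : 0 < Real.log 2 := Real.log_pos one_lt_two
  by_cases hs : ∀ x ∈ P.support, (ch.Q x).support ⊆ (ch.Q ch.star).support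
  · refine ⟨fun z => Real.log ((ch.Q z.1 z.2).toReal / (ch.Q ch.star z.2).toReal),
      fun z hz => ?_, ?_⟩
    · rw [mem_support_jointLaw] at hz
      exact (ofReal_exp_log_div_mul hz.2 (PMF.apply_ne_top _ _)
        (hs _ hz.1 hz.2) (PMF.apply_ne_top _ _)).le
    · rw [sum_jointLaw]
      rw [mutualInfo_add_divBits ch hs, ENNReal.ofReal_lt_ofReal_iff_of_nonneg (by positivity),
        div_lt_div_iff_of_pos_right hl2] at hw
      exact hw
  · push Not at hs
    obtain ⟨x, hx, hxs⟩ := hs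
    obtain ⟨y, hy, hys⟩ := Set.not_subset.1 hxs
    set g : ch.alphabet × Y → ℝ :=
      fun z => Real.log ((ch.Q z.1 z.2).toReal / (ch.Q ch.star z.2).toReal) with hg
    set a : ℝ := ∑ z, (ch.jointLaw P z).toReal * if z.2 ∈ (ch.Q ch.star).support then g z else 0
    set b : ℝ := ∑ z, (ch.jointLaw P z).toReal * if z.2 ∈ (ch.Q ch.star).support then 0 else 1
    have hb : 0 < b := by
      refine Finset.sum_pos' (fun z _ => mul_nonneg ENNReal.toReal_nonneg
        (by split_ifs <;> norm_num)) ⟨(x, y), Finset.mem_univ _, ?_⟩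
      simp only [if_neg hys, mul_one]
      exact PMF.toReal_pos (mem_support_jointLaw.2 ⟨hx, hy⟩)
    set T : ℝ := (w + 1 - a) / b with hT
    refine ⟨fun z => (if z.2 ∈ (ch.Q ch.star).support then g z else 0) +
      T * if z.2 ∈ (ch.Q ch.star).support then 0 else 1, fun z hz => ?_, ?_⟩
    · rw [mem_support_jointLaw] at hz
      by_cases h : z.2 ∈ (ch.Q ch.star).support
      · simp only [if_pos h, mul_zero, add_zero, hg]
        exact (ofReal_exp_log_div_mul hz.2 (PMF.apply_ne_top _ _) h (PMF.apply_ne_top _ _)).le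
      · rw [((ch.Q ch.star).apply_eq_zero_iff _).2 h, mul_zero]
        exact bot_le
    · have : ∑ z, (ch.jointLaw P z).toReal *
          ((if z.2 ∈ (ch.Q ch.star).support then g z else 0) +
            T * if z.2 ∈ (ch.Q ch.star).support then 0 else 1) = a + T * b := by
        rw [Finset.mul_sum, ← Finset.sum_add_distrib]
        exact Finset.sum_congr rfl fun z _ => by ring
      rw [this, hT, div_mul_cancel₀ _ hb.ne']
      linarith

/-- Codebooks of bounded cost with disjoint decoding sets that noise rarely hits: the decoding sets
consist of outputs whose likelihood exceeds that under the output law by `exp (n * v)` and that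
under noise by `exp (n * w)`. -/
theorem exists_codebook {P : PMF ch.alphabet} (hP : ch.expCost P ≠ ⊤) {v w k δ : ℝ}
    (hv : v < ch.infoReal P)
    (hw : ENNReal.ofReal (w / Real.log 2) <
      ch.mutualInfo P + divBits (ch.outputLaw P) (ch.Q ch.star)) (hw0 : 0 ≤ w)
    (hk : ch.costReal P < k) (hδ : 0 < δ) (hδ1 : δ < 1) :
    ∀ᶠ n : ℕ in atTop, ∀ M : ℕ, M * Real.exp (-(n * v)) ≤ δ / 2 →
      ∃ (c : Fin M → Fin n → ch.alphabet) (D : Fin M → Set (Fin n → Y)),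
        Pairwise (Function.onFun Disjoint D) ∧
        (∀ m, 1 - ENNReal.ofReal δ ≤ (prodPMF fun i => ch.Q (c m i)).toOuterMeasure (D m)) ∧
        (∀ m, (prodPMF fun _ => ch.Q ch.star).toOuterMeasure (D m) ≤
          ENNReal.ofReal (Real.exp (-(n * w)))) ∧
        ∀ m, ∑ i, ch.cost (c m i) ≤ ENNReal.ofReal (n * k) := by
  classical
  obtain ⟨f1, hf1, hE1⟩ := exists_info_exponent P
  obtain ⟨f2, hf2, hE2⟩ := exists_noise_exponent P hw hw0
  have hE3 : ∑ z, (ch.jointLaw P z).toReal * (ch.cost z.1).toReal = ch.costReal P := by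
    rw [sum_jointLaw]
    refine Finset.sum_congr rfl fun x _ => ?_
    dsimp only
    rw [← Finset.sum_mul, PMF.sum_toReal, one_mul]
  have hδ6 : 0 < δ / 6 := by positivity
  filter_upwards [likelihood_law P _ f1 hf1 (hE1 ▸ hv) hδ6, likelihood_law P _ f2 hf2 hE2 hδ6,
    weak_law (ch.jointLaw P) (fun z => (ch.cost z.1).toReal) (sub_pos.2 hk) hδ6] with n h1 h2 h3
  intro M hM
  have : Nonempty (Fin n → ch.alphabet) := by
    obtain ⟨x, _⟩ := P.support_nonempty
    exact ⟨fun _ => x⟩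
  let G : (Fin n → ch.alphabet) → Set (Fin n → Y) := fun x =>
    {y | ENNReal.ofReal (Real.exp (n * v)) * (prodPMF fun _ => ch.outputLaw P) y ≤
        (prodPMF fun i => ch.Q (x i)) y ∧
      ENNReal.ofReal (Real.exp (n * w)) * (prodPMF fun _ => ch.Q ch.star) y ≤
        (prodPMF fun i => ch.Q (x i)) y ∧
      ∑ i, ch.cost (x i) ≤ ENNReal.ofReal (n * k)}
  have hexp : ∀ {a b : ℝ≥0∞} {u : ℝ}, ENNReal.ofReal (Real.exp u) * a ≤ b → b ≤ 1 →
      a ≤ ENNReal.ofReal (Real.exp (-u)) := by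
    intro a b u hab hb
    rw [Real.exp_neg, ENNReal.ofReal_inv_of_pos (Real.exp_pos u)]
    rw [ENNReal.le_inv_iff_mul_le, mul_comm]
    exact hab.trans hb
  have hθ : ∀ x, ((prodPMF fun _ : Fin n => P).bind
      fun x => prodPMF fun i => ch.Q (x i)).toOuterMeasure (G x) ≤
        ENNReal.ofReal (Real.exp (-(n * v))) := by
    intro x
    rw [bind_prodPMF]
    exact hexp (PMF.mul_toOuterMeasure_le_of_forall (p := prodPMF fun i => ch.Q (x i))
      fun y hy => hy.1) (PMF.toOuterMeasure_le_one _ _)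
  have hG : 1 - ENNReal.ofReal (δ / 2) ≤ ∑ x, (prodPMF fun _ : Fin n => P) x *
      (prodPMF fun i => ch.Q (x i)).toOuterMeasure (G x) := by
    rw [sum_prodPMF_jointLaw]
    set S : Set (Fin n → ch.alphabet × Y) := {z | (fun i => (z i).2) ∈ G fun i => (z i).1} with hS
    rw [← PMF.toOuterMeasure_add_compl (prodPMF fun _ : Fin n => ch.jointLaw P) S,
      tsub_le_iff_right]
    gcongr
    have hsplit : ENNReal.ofReal (δ / 2) = ENNReal.ofReal (δ / 6) + ENNReal.ofReal (δ / 6) +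
        ENNReal.ofReal (δ / 6) := by
      rw [← ENNReal.ofReal_add hδ6.le hδ6.le, ← ENNReal.ofReal_add (by linarith) hδ6.le]
      congr 1; ring
    rw [hsplit]
    refine le_trans ?_ (add_le_add (add_le_add h1 h2) h3)
    refine le_trans ?_ ((MeasureTheory.measure_union_le _ _).trans
      (add_le_add (MeasureTheory.measure_union_le _ _) le_rfl))
    refine PMF.toOuterMeasure_mono _ ?_
    rintro z ⟨hz, hzs⟩
    by_contra hcon
    simp only [Set.mem_union, Set.mem_ofPred_eq, not_or, not_not] at hcon
    obtain ⟨⟨hc1, hc2⟩, hc3⟩ := hcon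
    refine hz ⟨hc1, hc2, ?_⟩
    have hzs' : ∀ i, z i ∈ (ch.jointLaw P).support := by
      rw [PMF.mem_support_iff, prodPMF_apply, Finset.prod_ne_zero_iff] at hzs
      exact fun i => hzs i (Finset.mem_univ i)
    have hfin : ∀ i, ch.cost (z i).1 = ENNReal.ofReal (ch.cost (z i).1).toReal := fun i =>
      (ENNReal.ofReal_toReal
        (cost_ne_top_of_mem_support hP (mem_support_jointLaw.1 (hzs' i)).1)).symm
    rw [Finset.sum_congr rfl fun i _ => hfin i,
      ← ENNReal.ofReal_sum_of_nonneg fun i _ => ENNReal.toReal_nonneg]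
    refine ENNReal.ofReal_le_ofReal ?_
    rw [hE3] at hc3
    have := (abs_lt.1 (not_le.1 hc3)).2
    linarith
  obtain ⟨c, D, hD1, hD2, hD3⟩ := feinstein _ _ G hθ hG M
  have hD3' : ∀ m, 1 - ENNReal.ofReal δ ≤
      (prodPMF fun i => ch.Q (c m i)).toOuterMeasure (D m) := by
    intro m
    refine le_trans ?_ (hD3 m)
    rw [tsub_tsub]
    gcongr
    rw [← ENNReal.ofReal_natCast, ← ENNReal.ofReal_mul (Nat.cast_nonneg _),
      ← ENNReal.ofReal_add (by positivity) (by positivity)]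
    exact ENNReal.ofReal_le_ofReal (by linarith)
  refine ⟨c, D, hD2, hD3', fun m => ?_, fun m => ?_⟩
  · exact hexp (PMF.mul_toOuterMeasure_le_of_forall (p := prodPMF fun i => ch.Q (c m i))
      fun y hy => (hD1 m hy).2.1) (PMF.toOuterMeasure_le_one _ _)
  · have hne : (D m).Nonempty := by
      by_contra h
      rw [Set.not_nonempty_iff_eq_empty] at h
      have := hD3' m
      rw [h, MeasureTheory.measure_empty, nonpos_iff_eq_zero, tsub_eq_zero_iff_le,
        ENNReal.one_le_ofReal] at this
      linarith
    obtain ⟨y, hy⟩ := hne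
    exact (hD1 m hy).2.2

end Channel

/-! ### Slotted receivers -/

/-- The parameters of a slotted receiver for words of length `n` in `A + n - 1` outputs. Time is
divided into slots of length `s`. In each slot that it visits, the receiver samples the first `p`
outputs. If they fail the test `pre`, it goes on to the next slot. Otherwise it samples `n` outputs
in a row and applies `dec` to them, which either yields a message or sends the receiver on to the
slot that comes `W` later. The functions `pre` and `dec` are given sequences of which only the first
`p` and `n` values matter. -/
structure SlotScheme (Y : Type*) (M : ℕ) where
  s : ℕ
  p : ℕ
  n : ℕ
  W : ℕ
  A : ℕ
  pre : (ℕ → Y) → Prop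
  dec : (ℕ → Y) → Option (Fin M)
  default : ℕ → Y
  fallback : Fin M
  p_pos : 0 < p
  p_le : p ≤ s
  p_lt : p < n
  n_le : n ≤ W * s
  A_pos : 0 < A
  pre_congr : ∀ v v', (∀ k < p, v k = v' k) → pre v → pre v'
  dec_congr : ∀ v v', (∀ k < n, v k = v' k) → dec v = dec v'

/-- The state of a slotted receiver: the current slot, the number of samples taken in it, their
values, and the decoded message, if any. -/
structure SlotState (Y : Type*) (M : ℕ) where
  slot : ℕ
  len : ℕ
  vals : ℕ → Y
  out : Option (Fin M)

namespace SlotScheme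

variable {Y : Type*} {M : ℕ} (S : SlotScheme Y M)

/-- The number of channel outputs. -/
abbrev N : ℕ := S.A + S.n - 1

theorem N_pos : 0 < S.N := by
  have := S.A_pos; have := S.p_lt; unfold N; omega

/-- The time `i`, or the last time if `i` is too large. -/
def clamp (i : ℕ) : Fin S.N := ⟨min i (S.N - 1), by have := S.N_pos; omega⟩

open Classical in
/-- The state after the sample `b`. -/
noncomputable def step (st : SlotState Y M) (b : Y) : SlotState Y M :=
  let v := Function.update st.vals st.len b
  if st.len + 1 = S.p ∧ ¬ S.pre v then ⟨st.slot + 1, 0, v, none⟩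
  else if st.len + 1 = S.n then
    if S.dec v = none then ⟨st.slot + S.W, 0, v, none⟩ else ⟨st.slot, st.len + 1, v, S.dec v⟩
  else ⟨st.slot, st.len + 1, v, none⟩

/-- The state after the samples `l`. -/
noncomputable def state (l : List Y) : SlotState Y M :=
  l.foldl S.step ⟨0, 0, S.default, none⟩

/-- The time of the next sample, starting from `0`. -/
def time (st : SlotState Y M) : ℕ := st.slot * S.s + st.len

/-- The receiver stops when it has decoded, or when the next slot comes too late for a word. -/
def Stopped (st : SlotState Y M) : Prop := st.out ≠ none ∨ S.A ≤ st.slot * S.s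

/-- The sampling time after the samples `l`. -/
noncomputable def nextTime (l : List Y) : Fin S.N := S.clamp (S.time (S.state l))

theorem state_observed_succ (y : Fin S.N → Y) (j : ℕ) :
    S.state (observed S.nextTime y (j + 1)) = S.step (S.state (observed S.nextTime y j))
      (y (S.clamp (S.time (S.state (observed S.nextTime y j))))) := by
  simp only [observed, state, List.foldl_append, List.foldl_cons, List.foldl_nil]
  rfl

theorem len_lt_step {st : SlotState Y M} (b : Y) (h : st.len < S.n)
    (hout : (S.step st b).out = none) : (S.step st b).len < S.n := by
  have := S.p_lt
  unfold step at hout ⊢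
  dsimp only at hout ⊢
  split_ifs at hout ⊢ with h1 h2 h3
  · simp only []; omega
  · simp only []; omega
  · exact absurd hout h3
  · simp only []; omega

theorem time_lt_step (st : SlotState Y M) (b : Y) :
    S.time st < S.time (S.step st b) := by
  have h1 := S.p_le
  have h2 := S.n_le
  unfold step time
  dsimp only
  split_ifs with h3 h4 h5
  · simp only [add_mul, one_mul, add_zero]; omega
  · simp only [add_mul, add_zero]; omega
  · simp only []; omega
  · simp only []; omega

section Run

variable (y : Fin S.N → Y)

/-- The state after `j` samples. -/
noncomputable def run (j : ℕ) : SlotState Y M := S.state (observed S.nextTime y j)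

/-- The output at time `i`. -/
def val (i : ℕ) : Y := y (S.clamp i)

theorem run_zero : S.run y 0 = ⟨0, 0, S.default, none⟩ := rfl

theorem run_succ (j : ℕ) :
    S.run y (j + 1) = S.step (S.run y j) (S.val y (S.time (S.run y j))) :=
  S.state_observed_succ y j

theorem len_run_lt {j : ℕ} (h : ∀ i, 1 ≤ i → i ≤ j → ¬ S.Stopped (S.run y i)) :
    (S.run y j).len < S.n := by
  induction j with
  | zero => rw [run_zero]; have := S.p_lt; simp only []; omega
  | succ j ih =>
    rw [run_succ]
    refine S.len_lt_step _ (ih fun i h1 h2 => h i h1 (by omega)) ?_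
    rw [← run_succ]
    have := h (j + 1) (by omega) le_rfl
    rw [Stopped, not_or, not_not] at this
    exact this.1

theorem slot_run_lt {j : ℕ} (h : ∀ i, 1 ≤ i → i ≤ j → ¬ S.Stopped (S.run y i)) :
    (S.run y j).slot * S.s < S.A := by
  rcases Nat.eq_zero_or_pos j with rfl | h0
  · rw [run_zero]; have := S.A_pos; simpa using this
  · have := h j h0 le_rfl
    rw [Stopped, not_or, not_le] at this
    exact this.2

theorem clamp_time {j : ℕ} (h : ∀ i, 1 ≤ i → i ≤ j → ¬ S.Stopped (S.run y i)) :
    (S.clamp (S.time (S.run y j)) : ℕ) = S.time (S.run y j) := by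
  have h1 := S.len_run_lt y h
  have h2 := S.slot_run_lt y h
  unfold clamp time N
  simp only []
  omega

theorem nextTime_lt {j : ℕ} (h : ∀ i, 1 ≤ i → i ≤ j + 1 → ¬ S.Stopped (S.run y i)) :
    S.nextTime (observed S.nextTime y j) < S.nextTime (observed S.nextTime y (j + 1)) := by
  have h' : ∀ i, 1 ≤ i → i ≤ j → ¬ S.Stopped (S.run y i) := fun i h1 h2 => h i h1 (by omega)
  have h1 := S.clamp_time y h
  have h2 := S.clamp_time y h'
  have h3 := S.time_lt_step (S.run y j) (S.val y (S.time (S.run y j)))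
  rw [← run_succ] at h3
  change (S.clamp (S.time (S.run y j)) : ℕ) < S.clamp (S.time (S.run y (j + 1)))
  omega

end Run

/-- The slotted receiver. -/
noncomputable def receiver : Receiver Y S.N M where
  next := S.nextTime
  stopSet := {l | S.Stopped (S.state l)}
  decode l := (S.state l).out.getD S.fallback
  increasing y _ h := S.nextTime_lt y h
  stops y := by
    by_contra! hcon
    have hns : ∀ i, 1 ≤ i → ¬ S.Stopped (S.run y i) := fun i hi => hcon i hi
    have key : ∀ j, j ≤ (S.nextTime (observed S.nextTime y j) : ℕ) := by
      intro j
      induction j with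
      | zero => omega
      | succ j ih =>
        have : (S.nextTime (observed S.nextTime y j) : ℕ) <
            S.nextTime (observed S.nextTime y (j + 1)) := S.nextTime_lt y fun i h1 _ => hns i h1
        omega
    have := key S.N
    omega

section Trajectory

variable (y : Fin S.N → Y)

/-- After `i` samples, the receiver is about to visit slot `j`. -/
def Reach (i j : ℕ) : Prop :=
  (S.run y i).slot = j ∧ (S.run y i).len = 0 ∧ (S.run y i).out = none ∧
    ∀ i', 1 ≤ i' → i' < i → ¬ S.Stopped (S.run y i')

/-- The outputs from the beginning of slot `j` on. -/
def window (j : ℕ) : ℕ → Y := fun k => S.val y (j * S.s + k)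

theorem reach_zero : S.Reach y 0 0 := by
  refine ⟨?_, ?_, ?_, fun i' _ h => absurd h (Nat.not_lt_zero _)⟩ <;> rw [run_zero]

variable {S y}

/-- While the test has not failed, the receiver takes the outputs of its slot one by one. -/
theorem run_within {i j k : ℕ} (h : S.Reach y i j)
    (hk : k < S.p ∨ k < S.n ∧ S.pre (S.window y j)) :
    (S.run y (i + k)).slot = j ∧ (S.run y (i + k)).len = k ∧ (S.run y (i + k)).out = none ∧
      ∀ k' < k, (S.run y (i + k)).vals k' = S.window y j k' := by
  have hp := S.p_lt
  induction k with
  | zero => exact ⟨h.1, h.2.1, h.2.2.1, fun k' h => absurd h (Nat.not_lt_zero _)⟩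
  | succ k ih =>
    obtain ⟨h1, h2, h3, h4⟩ := ih (hk.imp (by omega) fun h => ⟨by omega, h.2⟩)
    rw [← add_assoc, run_succ]
    set v := Function.update (S.run y (i + k)).vals k (S.val y (S.time (S.run y (i + k)))) with hv
    have hvals : ∀ k' < k + 1, v k' = S.window y j k' := by
      intro k' hk'
      rw [hv]
      rcases Nat.lt_succ_iff_lt_or_eq.1 hk' with h5 | rfl
      · rw [Function.update_of_ne (by omega)]
        exact h4 k' h5
      · rw [Function.update_self, time, h1, h2]
        rfl
    unfold step
    dsimp only
    rw [h1, h2, ← hv]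
    rw [if_neg, if_neg]
    · exact ⟨rfl, rfl, rfl, hvals⟩
    · omega
    · rintro ⟨h5, h6⟩
      rcases hk with hk | hk
      · omega
      · refine h6 (S.pre_congr _ _ (fun k' hk' => (hvals k' (by omega)).symm) hk.2)

theorem not_stopped_within {i j k : ℕ} (h : S.Reach y i j) (hj : j * S.s < S.A)
    (hk : k < S.p ∨ k < S.n ∧ S.pre (S.window y j)) : ¬ S.Stopped (S.run y (i + k)) := by
  obtain ⟨h1, h2, h3, -⟩ := run_within h hk
  rw [Stopped, h1, h3]
  simp only [ne_eq, not_true_eq_false, false_or, not_le]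
  exact hj

theorem not_stopped_before {i j K : ℕ} (h : S.Reach y i j) (hj : j * S.s < S.A)
    (hK : ∀ k < K, k < S.p ∨ k < S.n ∧ S.pre (S.window y j)) :
    ∀ i', 1 ≤ i' → i' < i + K → ¬ S.Stopped (S.run y i') := by
  intro i' h1 h2
  rcases Nat.lt_or_ge i' i with h3 | h3
  · exact h.2.2.2 i' h1 h3
  · obtain ⟨k, rfl⟩ := Nat.exists_eq_add_of_le h3
    exact not_stopped_within h hj (hK k (by omega))

/-- The values at the end of a phase of consecutive samples. -/
theorem vals_update {i j K : ℕ} (h : S.Reach y i j)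
    (hK : K < S.p ∨ K < S.n ∧ S.pre (S.window y j)) {k : ℕ} (hk : k < K + 1) :
    Function.update (S.run y (i + K)).vals (S.run y (i + K)).len
      (S.val y (S.time (S.run y (i + K)))) k = S.window y j k := by
  obtain ⟨h1, h2, h3, h4⟩ := run_within h hK
  rw [h2]
  rcases Nat.lt_succ_iff_lt_or_eq.1 hk with h5 | rfl
  · rw [Function.update_of_ne (by omega)]
    exact h4 k h5
  · rw [Function.update_self, time, h1, h2]
    rfl

theorem Reach.fail {i j : ℕ} (h : S.Reach y i j) (hj : j * S.s < S.A)
    (hF : ¬ S.pre (S.window y j)) : S.Reach y (i + S.p) (j + 1) := by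
  have hp := S.p_pos
  obtain ⟨K, hK⟩ : ∃ K, S.p = K + 1 := ⟨S.p - 1, by omega⟩
  have hKp : K < S.p ∨ K < S.n ∧ S.pre (S.window y j) := Or.inl (by omega)
  obtain ⟨h1, h2, h3, -⟩ := run_within h hKp
  obtain ⟨v, hv⟩ : ∃ v, S.run y (i + S.p) = ⟨j + 1, 0, v, none⟩ := by
    refine ⟨Function.update (S.run y (i + K)).vals (S.run y (i + K)).len
      (S.val y (S.time (S.run y (i + K)))), ?_⟩
    rw [hK, ← add_assoc, run_succ]
    unfold step
    dsimp only
    rw [if_pos, h1]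
    refine ⟨by omega, fun hpre => hF (S.pre_congr _ _ (fun k hk => ?_) hpre)⟩
    exact vals_update h hKp (by omega)
  refine ⟨by rw [hv], by rw [hv], by rw [hv], ?_⟩
  exact not_stopped_before h hj fun k hk => Or.inl hk

theorem run_end {i j : ℕ} (h : S.Reach y i j) (hF : S.pre (S.window y j)) :
    ∃ v, S.run y (i + S.n) = (if S.dec (S.window y j) = none then ⟨j + S.W, 0, v, none⟩ else
      ⟨j, S.n, v, S.dec (S.window y j)⟩) := by
  have hp := S.p_lt
  obtain ⟨K, hK⟩ : ∃ K, S.n = K + 1 := ⟨S.n - 1, by omega⟩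
  have hKp : K < S.p ∨ K < S.n ∧ S.pre (S.window y j) := Or.inr ⟨by omega, hF⟩
  obtain ⟨h1, h2, h3, -⟩ := run_within h hKp
  refine ⟨Function.update (S.run y (i + K)).vals (S.run y (i + K)).len
      (S.val y (S.time (S.run y (i + K)))), ?_⟩
  have e : S.run y (i + S.n) = S.run y (i + K + 1) := by rw [hK, add_assoc]
  rw [e, run_succ, ← S.dec_congr _ _ fun k hk => vals_update h hKp (k := k) (by omega)]
  unfold step
  dsimp only
  rw [if_neg, if_pos (by omega), h1]
  · rw [h2, ← hK]
  · rintro ⟨h5, h6⟩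
    exact h6 (S.pre_congr _ _ (fun k hk => (vals_update h hKp (by omega)).symm) hF)

theorem Reach.busy {i j : ℕ} (h : S.Reach y i j) (hj : j * S.s < S.A)
    (hF : S.pre (S.window y j)) (hD : S.dec (S.window y j) = none) :
    S.Reach y (i + S.n) (j + S.W) := by
  obtain ⟨v, hv⟩ := run_end h hF
  rw [if_pos hD] at hv
  refine ⟨by rw [hv], by rw [hv], by rw [hv], ?_⟩
  exact not_stopped_before h hj fun k hk => Or.inr ⟨hk, hF⟩

theorem Reach.done {i j : ℕ} (h : S.Reach y i j) (hj : j * S.s < S.A)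
    (hF : S.pre (S.window y j)) {m : Fin M} (hD : S.dec (S.window y j) = some m) :
    S.receiver.tau y = i + S.n ∧ S.receiver.decisionTime y = j * S.s + S.n ∧
      S.receiver.message y = m := by
  have hp := S.p_lt
  obtain ⟨v, hv⟩ := run_end h hF
  rw [if_neg (by rw [hD]; simp)] at hv
  have htau : S.receiver.tau y = i + S.n := by
    refine S.receiver.tau_eq (by omega) ?_ ?_
    · change S.Stopped (S.run y (i + S.n))
      rw [Stopped, hv, hD]
      exact Or.inl (by simp)
    · exact not_stopped_before h hj fun k hk => Or.inr ⟨hk, hF⟩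
  obtain ⟨K, hK⟩ : ∃ K, S.n = K + 1 := ⟨S.n - 1, by omega⟩
  have hKp : K < S.p ∨ K < S.n ∧ S.pre (S.window y j) := Or.inr ⟨by omega, hF⟩
  refine ⟨htau, ?_, ?_⟩
  · unfold Receiver.decisionTime
    rw [htau]
    have e : i + S.n - 1 = i + K := by omega
    rw [e]
    have h1 : (S.receiver.next (observed S.receiver.next y (i + K)) : ℕ) =
        S.time (S.run y (i + K)) := by
      refine S.clamp_time y fun i' h1 h2 => ?_
      exact not_stopped_before h hj (K := S.n) (fun k hk => Or.inr ⟨hk, hF⟩) i' h1 (by omega)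
    obtain ⟨e1, e2, -, -⟩ := run_within h hKp
    rw [h1, time, e1, e2]
    omega
  · unfold Receiver.message
    rw [htau]
    change (S.run y (i + S.n)).out.getD S.fallback = m
    rw [hv, hD]
    rfl

open Classical in
/-- If the receiver is not distracted before slot `J`, where the word is found, it decodes the word,
and the number of samples is controlled by the number of false alarms. -/
theorem decision_of_slot {J : ℕ} (hJ : J * S.s < S.A)
    (hbefore : ∀ j < J, S.pre (S.window y j) → S.dec (S.window y j) = none ∧ j + S.W ≤ J)
    (hF : S.pre (S.window y J)) {m : Fin M} (hD : S.dec (S.window y J) = some m) :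
    S.receiver.tau y ≤ J * S.p + S.n * ((Finset.range J).filter fun j =>
        S.pre (S.window y j)).card + S.n ∧
      S.receiver.decisionTime y = J * S.s + S.n ∧ S.receiver.message y = m := by
  have hs : 0 < S.s := lt_of_lt_of_le S.p_pos S.p_le
  have hW : 0 < S.W := by
    rcases Nat.eq_zero_or_pos S.W with h | h
    · have := S.n_le; have := S.p_lt; rw [h] at *; omega
    · exact h
  have key : ∀ k ≤ J, ∃ i j, k ≤ j ∧ j ≤ J ∧ S.Reach y i j ∧
      i ≤ j * S.p + S.n * ((Finset.range j).filter fun j => S.pre (S.window y j)).card := by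
    intro k
    induction k with
    | zero => exact fun _ => ⟨0, 0, le_rfl, Nat.zero_le _, S.reach_zero y, Nat.zero_le _⟩
    | succ k ih =>
      intro hk
      obtain ⟨i, j, h1, h2, h3, h4⟩ := ih (by omega)
      rcases Nat.lt_or_eq_of_le h1 with h5 | rfl
      · exact ⟨i, j, h5, h2, h3, h4⟩
      have hkA : k * S.s < S.A := lt_of_le_of_lt (Nat.mul_le_mul_right _ h2) hJ
      by_cases hFk : S.pre (S.window y k)
      · obtain ⟨h6, h7⟩ := hbefore k (by omega) hFk
        refine ⟨i + S.n, k + S.W, by omega, h7, h3.busy hkA hFk h6, ?_⟩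
        have hcard : ((Finset.range k).filter fun j => S.pre (S.window y j)).card + 1 ≤
            ((Finset.range (k + S.W)).filter fun j => S.pre (S.window y j)).card := by
          rw [← Finset.card_insert_of_notMem (a := k) (by simp)]
          refine Finset.card_le_card fun x hx => ?_
          rw [Finset.mem_insert, Finset.mem_filter, Finset.mem_range] at hx
          rw [Finset.mem_filter, Finset.mem_range]
          rcases hx with rfl | hx
          · exact ⟨by omega, hFk⟩
          · exact ⟨by omega, hx.2⟩
        calc i + S.n ≤ k * S.p + S.n *
              (((Finset.range k).filter fun j => S.pre (S.window y j)).card + 1) := by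
              rw [mul_add, mul_one]; omega
          _ ≤ _ := add_le_add (Nat.mul_le_mul_right _ (by omega)) (Nat.mul_le_mul_left _ hcard)
      · refine ⟨i + S.p, k + 1, le_rfl, hk, h3.fail hkA hFk, ?_⟩
        have hcard : ((Finset.range k).filter fun j => S.pre (S.window y j)).card ≤
            ((Finset.range (k + 1)).filter fun j => S.pre (S.window y j)).card :=
          Finset.card_le_card (Finset.filter_subset_filter _
            (Finset.range_subset_range.2 (by omega)))
        have := Nat.mul_le_mul_left S.n hcard
        rw [add_mul, one_mul]
        omega
  obtain ⟨i, j, h1, h2, h3, h4⟩ := key J le_rfl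
  obtain rfl : j = J := by omega
  obtain ⟨e1, e2, e3⟩ := h3.done hJ hF hD
  exact ⟨by rw [e1]; omega, e2, e3⟩

end Trajectory

end SlotScheme

/-! ### Slotted codes -/

namespace SlotScheme

variable {Y : Type*} {M : ℕ} (S : SlotScheme Y M)

theorem val_eq (y : Fin S.N → Y) {i : ℕ} (h : i < S.N) : S.val y i = y ⟨i, h⟩ := by
  unfold val clamp
  congr 1
  ext
  simp only []
  omega

/-- The outputs in a window have the law that the channel inputs in this window prescribe. -/
theorem window_prob [Fintype Y] (q : Fin S.N → PMF Y) {a len : ℕ} (h : a + len ≤ S.N)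
    (r : Fin len → PMF Y) (hr : ∀ k : Fin len, ∀ h : a + (k : ℕ) < S.N, q ⟨a + k, h⟩ = r k)
    (E : Set (Fin len → Y)) :
    (prodPMF q).toOuterMeasure {y | (fun k : Fin len => S.val y (a + k)) ∈ E} =
      (prodPMF r).toOuterMeasure E := by
  have hlt : ∀ k : Fin len, a + (k : ℕ) < S.N := fun k => by have := k.2; omega
  set e : Fin len → Fin S.N := fun k => ⟨a + k, hlt k⟩ with he
  have hinj : Function.Injective e := by
    intro k k' hkk
    simp only [he, Fin.mk.injEq] at hkk
    ext; omega
  have hq : q ∘ e = r := funext fun k => hr k (hlt k)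
  rw [← hq, ← prodPMF_map_comp q hinj, PMF.toOuterMeasure_map_apply]
  congr 1
  ext y
  have : (fun k : Fin len => S.val y (a + k)) = y ∘ e := funext fun k => S.val_eq y (hlt k)
  rw [Set.mem_ofPred_eq, this]
  rfl

end SlotScheme

/-- The ingredients of a slotted code: a codebook with disjoint decoding sets, a preamble that
consists of `p` copies of the symbol `x₀`, a test for the preamble, and the dimensions of the
slots. -/
structure SlotCode {I Y : Type*} (ch : Channel I Y) (B A : ℕ) where
  s : ℕ
  p : ℕ
  n₁ : ℕ
  W : ℕ
  x₀ : ch.alphabet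
  test : Set (Fin p → Y)
  word : Fin (2 ^ B) → Fin n₁ → ch.alphabet
  region : Fin (2 ^ B) → Set (Fin n₁ → Y)
  default : Y
  p_pos : 0 < p
  p_le : p ≤ s
  n₁_pos : 0 < n₁
  n_le : p + n₁ ≤ W * s
  A_pos : 0 < A
  disjoint : Pairwise (Function.onFun Disjoint region)

namespace SlotCode

variable {I Y : Type*} {ch : Channel I Y} {B A : ℕ} (K : SlotCode ch B A)

open Classical in
/-- The decoder: the message whose decoding set contains the outputs that follow the preamble. -/
noncomputable def dec (v : ℕ → Y) : Option (Fin (2 ^ B)) :=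
  if h : ∃ m, (fun k : Fin K.n₁ => v (K.p + k)) ∈ K.region m then some h.choose else none

theorem dec_eq_some {v : ℕ → Y} {m : Fin (2 ^ B)}
    (h : (fun k : Fin K.n₁ => v (K.p + k)) ∈ K.region m) : K.dec v = some m := by
  have hex : ∃ m, (fun k : Fin K.n₁ => v (K.p + k)) ∈ K.region m := ⟨m, h⟩
  rw [dec, dif_pos hex]
  congr 1
  by_contra hne
  exact Set.disjoint_left.1 (K.disjoint hne) hex.choose_spec h

theorem dec_eq_none {v : ℕ → Y} (h : ∀ m, (fun k : Fin K.n₁ => v (K.p + k)) ∉ K.region m) :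
    K.dec v = none := by
  rw [dec, dif_neg]
  exact fun ⟨m, hm⟩ => h m hm

/-- The receiver of a slotted code. -/
noncomputable abbrev scheme : SlotScheme Y (2 ^ B) where
  s := K.s
  p := K.p
  n := K.p + K.n₁
  W := K.W
  A := A
  pre v := (fun k : Fin K.p => v k) ∈ K.test
  dec := K.dec
  default := fun _ => K.default
  fallback := ⟨0, by positivity⟩
  p_pos := K.p_pos
  p_le := K.p_le
  p_lt := by have := K.n₁_pos; omega
  n_le := K.n_le
  A_pos := K.A_pos
  pre_congr v v' h hv := by
    have : (fun k : Fin K.p => v k) = fun k : Fin K.p => v' k := funext fun k => h k k.2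
    rwa [← this]
  dec_congr v v' h := by
    have : (fun k : Fin K.n₁ => v (K.p + k)) = fun k : Fin K.n₁ => v' (K.p + k) :=
      funext fun k => h _ (by have := k.2; omega)
    unfold dec
    rw [this]

/-- The first slot that begins at time `t` or later. -/
def slotAfter (t : ℕ) : ℕ := (t + K.s - 1) / K.s

theorem s_pos : 0 < K.s := lt_of_lt_of_le K.p_pos K.p_le

theorem le_slotAfter (t : ℕ) : t ≤ K.slotAfter t * K.s := by
  have hs := K.s_pos
  unfold slotAfter
  have h1 := Nat.div_add_mod (t + K.s - 1) K.s
  have h2 := Nat.mod_lt (t + K.s - 1) hs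
  rw [mul_comm]
  omega

theorem slotAfter_lt (t : ℕ) : K.slotAfter t * K.s < t + K.s := by
  have hs := K.s_pos
  unfold slotAfter
  have h1 := Nat.div_mul_le_self (t + K.s - 1) K.s
  omega

/-- The slotted code: transmissions start with the first slot after the arrival of the message. -/
noncomputable abbrev code : Code ch B A where
  n := K.p + K.n₁
  n_pos := by have := K.p_pos; omega
  codeword m i := if h : (i : ℕ) < K.p then K.x₀ else
    K.word m ⟨(i : ℕ) - K.p, by have := i.2; omega⟩
  start t _ := if h : K.slotAfter t * K.s < A then ⟨K.slotAfter t * K.s, h⟩ else t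
  le_start t _ := by
    split_ifs
    · exact K.le_slotAfter t
    · exact le_rfl
  receiver := PMF.pure K.scheme.receiver

theorem maxCost_code_le [Fintype Y] {k : ℝ≥0∞}
    (hk : ∀ m, ∑ i, ch.cost (K.word m i) ≤ k) : K.code.maxCost ≤ K.p * ch.cost K.x₀ + k := by
  refine iSup_le fun m => ?_
  change ∑ i : Fin (K.p + K.n₁), ch.cost (if h : (i : ℕ) < K.p then K.x₀ else
    K.word m ⟨(i : ℕ) - K.p, by have := i.2; omega⟩ : ch.alphabet) ≤ _
  rw [Fin.sum_univ_add]
  refine add_le_add (le_of_eq ?_) ((Finset.sum_le_sum fun i _ => ?_).trans (hk m))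
  · simp
  · rw [dif_neg (by simp)]
    refine le_of_eq ?_
    congr 3
    ext
    simp

section Inputs

variable {m : Fin (2 ^ B)} {t : Fin A} (hJ : K.slotAfter t * K.s < A)

theorem start_code (hJ : K.slotAfter t * K.s < A) :
    (K.code.start t m : ℕ) = K.slotAfter t * K.s := by
  change ((if h : K.slotAfter t * K.s < A then ⟨K.slotAfter t * K.s, h⟩ else t : Fin A) : ℕ) = _
  rw [dif_pos hJ]

theorem input_before (hJ : K.slotAfter t * K.s < A) {i : Fin (A + K.code.n - 1)}
    (hi : (i : ℕ) < K.slotAfter t * K.s) : K.code.input m t i = ch.star :=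
  Code.input_of_lt_start _ (by rw [K.start_code hJ]; exact hi)

theorem input_preamble (hJ : K.slotAfter t * K.s < A) {i : Fin (A + K.code.n - 1)} {k : ℕ}
    (hk : k < K.p) (hi : (i : ℕ) = K.slotAfter t * K.s + k) : K.code.input m t i = K.x₀ := by
  have hn : K.code.n = K.p + K.n₁ := rfl
  have hst := K.start_code (m := m) hJ
  rw [Code.input, dif_pos ⟨by omega, by omega⟩]
  congr 1
  change (if h : (i : ℕ) - (K.code.start t m : ℕ) < K.p then K.x₀ else _) = _
  rw [dif_pos (by omega)]

theorem input_word (hJ : K.slotAfter t * K.s < A) {i : Fin (A + K.code.n - 1)} (k : Fin K.n₁)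
    (hi : (i : ℕ) = K.slotAfter t * K.s + K.p + k) : K.code.input m t i = K.word m k := by
  have hn : K.code.n = K.p + K.n₁ := rfl
  have hst := K.start_code (m := m) hJ
  have hk := k.2
  rw [Code.input, dif_pos ⟨by omega, by omega⟩]
  congr 1
  change (if h : (i : ℕ) - (K.code.start t m : ℕ) < K.p then K.x₀ else
    K.word m ⟨(i : ℕ) - (K.code.start t m : ℕ) - K.p, _⟩) = _
  rw [dif_neg (by rw [hst]; omega)]
  congr 1
  ext
  change (i : ℕ) - (K.code.start t m : ℕ) - K.p = k
  omega

theorem slot_add_le {t : ℕ} (hJ : K.slotAfter t * K.s < A) :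
    K.slotAfter t * K.s + K.p + K.n₁ ≤ K.scheme.N := by
  change _ ≤ A + (K.p + K.n₁) - 1
  omega

end Inputs

variable [Fintype Y]

theorem probAt_code (m : Fin (2 ^ B)) (t : Fin A)
    (E : Receiver Y (A + K.code.n - 1) (2 ^ B) → Set (Fin (A + K.code.n - 1) → Y)) :
    K.code.probAt m t E =
      (prodPMF fun i => ch.Q (K.code.input m t i)).toOuterMeasure (E K.scheme.receiver) := by
  rw [Code.probAt_eq, mixProb, tsum_eq_single K.scheme.receiver]
  · change PMF.pure K.scheme.receiver K.scheme.receiver * _ = _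
    rw [PMF.pure_apply_self, one_mul]
  · intro r hr
    change PMF.pure K.scheme.receiver r * _ = _
    rw [PMF.pure_apply_of_ne _ _ hr, zero_mul]

section Estimates

variable {m : Fin (2 ^ B)} {t : Fin A}

/-- The law of the outputs when message `m` arrives at time `t`. -/
noncomputable def law (m : Fin (2 ^ B)) (t : Fin A) : PMF (Fin K.scheme.N → Y) :=
  prodPMF fun i => ch.Q (K.code.input m t i)

theorem law_falseAlarm (hJ : K.slotAfter t * K.s < A) {j : ℕ} (hj : j < K.slotAfter t) :
    (K.law m t).toOuterMeasure {y | K.scheme.pre (K.scheme.window y j)} =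
      (prodPMF fun _ => ch.Q ch.star).toOuterMeasure K.test := by
  have h1 : (j + 1) * K.s ≤ K.slotAfter t * K.s := Nat.mul_le_mul_right _ hj
  have h2 := K.slot_add_le hJ
  have h3 := K.p_le
  rw [add_mul, one_mul] at h1
  refine K.scheme.window_prob _ (a := j * K.s) (len := K.p) (by omega) _ (fun k h => ?_) K.test
  have hk := k.2
  rw [K.input_before hJ]
  simp only []
  omega

theorem law_preamble (hJ : K.slotAfter t * K.s < A) :
    (K.law m t).toOuterMeasure {y | ¬ K.scheme.pre (K.scheme.window y (K.slotAfter t))} =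
      (prodPMF fun _ => ch.Q K.x₀).toOuterMeasure K.testᶜ := by
  have h2 := K.slot_add_le hJ
  refine K.scheme.window_prob _ (a := K.slotAfter t * K.s) (len := K.p) (by omega) _
    (fun k h => ?_) K.testᶜ
  rw [K.input_preamble hJ k.2 rfl]

theorem law_word (hJ : K.slotAfter t * K.s < A) :
    (K.law m t).toOuterMeasure {y | (fun k : Fin K.n₁ =>
      K.scheme.window y (K.slotAfter t) (K.p + k)) ∉ K.region m} =
      (prodPMF fun i => ch.Q (K.word m i)).toOuterMeasure (K.region m)ᶜ := by
  have h2 := K.slot_add_le hJ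
  rw [← K.scheme.window_prob (fun i => ch.Q (K.code.input m t i))
    (a := K.slotAfter t * K.s + K.p) (len := K.n₁) (by omega) _ (fun k h => ?_) (K.region m)ᶜ]
  · rw [law]
    congr 1
    ext y
    simp only [SlotScheme.window, Set.mem_ofPred_eq, Set.mem_compl_iff, add_assoc]
  · rw [K.input_word hJ k rfl]

theorem law_noise (hJ : K.slotAfter t * K.s < A) {j : ℕ} (hj : j + K.W ≤ K.slotAfter t)
    (m' : Fin (2 ^ B)) :
    (K.law m t).toOuterMeasure {y | (fun k : Fin K.n₁ =>
      K.scheme.window y j (K.p + k)) ∈ K.region m'} =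
      (prodPMF fun _ => ch.Q ch.star).toOuterMeasure (K.region m') := by
  have h1 : (j + K.W) * K.s ≤ K.slotAfter t * K.s := Nat.mul_le_mul_right _ hj
  have h2 := K.slot_add_le hJ
  have h3 := K.n_le
  rw [add_mul] at h1
  rw [← K.scheme.window_prob (fun i => ch.Q (K.code.input m t i))
    (a := j * K.s + K.p) (len := K.n₁) (by omega) _ (fun k h => ?_) (K.region m')]
  · rw [law]
    congr 1
    ext y
    simp only [SlotScheme.window, Set.mem_ofPred_eq, add_assoc]
  · have hk := k.2
    rw [K.input_before hJ]
    simp only []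
    omega

open Classical in
/-- The number of slots before the transmission in which the receiver would be alarmed. -/
noncomputable def alarms (t : Fin A) (y : Fin K.scheme.N → Y) : ℕ :=
  ((Finset.range (K.slotAfter t)).filter fun j => K.scheme.pre (K.scheme.window y j)).card

theorem law_alarms (hJ : K.slotAfter t * K.s < A) (hJ0 : 0 < K.slotAfter t) {l : ℝ} (hl : 0 < l) :
    (K.law m t).toOuterMeasure {y | K.slotAfter t * l ≤ (K.alarms t y : ℝ)} ≤
      (prodPMF fun _ => ch.Q ch.star).toOuterMeasure K.test / ENNReal.ofReal l := by
  classical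
  have hJ0' : (0 : ℝ) < K.slotAfter t := by exact_mod_cast hJ0
  have hM := (K.law m t).mul_toOuterMeasure_le (fun y => (K.alarms t y : ℝ≥0∞))
    (ENNReal.ofReal (K.slotAfter t * l))
  have hset : {y | ENNReal.ofReal (K.slotAfter t * l) ≤ (K.alarms t y : ℝ≥0∞)} =
      {y | K.slotAfter t * l ≤ (K.alarms t y : ℝ)} := by
    ext y
    rw [Set.mem_ofPred_eq, Set.mem_ofPred_eq, ← ENNReal.ofReal_natCast,
      ENNReal.ofReal_le_ofReal_iff (Nat.cast_nonneg _)]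
  have hsum : ∑ y, K.law m t y * (K.alarms t y : ℝ≥0∞) =
      K.slotAfter t * (prodPMF fun _ => ch.Q ch.star).toOuterMeasure K.test := by
    have h1 : ∀ y, K.law m t y * (K.alarms t y : ℝ≥0∞) = ∑ j ∈ Finset.range (K.slotAfter t),
        {y | K.scheme.pre (K.scheme.window y j)}.indicator (K.law m t) y := by
      intro y
      rw [alarms, Finset.card_filter, Nat.cast_sum, Finset.mul_sum]
      refine Finset.sum_congr rfl fun j _ => ?_
      rw [Set.indicator_apply]
      simp only [Set.mem_ofPred_eq]
      split_ifs <;> simp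
    simp only [h1]
    rw [Finset.sum_comm]
    simp only [← PMF.toOuterMeasure_apply_fintype]
    rw [Finset.sum_congr rfl fun j hj => K.law_falseAlarm hJ (Finset.mem_range.1 hj)]
    simp
  rw [hset, hsum, ENNReal.ofReal_mul hJ0'.le, ENNReal.ofReal_natCast, mul_assoc] at hM
  have hM' := (ENNReal.mul_le_mul_iff_right (by exact_mod_cast hJ0.ne')
    (ENNReal.natCast_ne_top _)).1 hM
  rw [ENNReal.le_div_iff_mul_le (Or.inl (ENNReal.ofReal_pos.2 hl).ne')
    (Or.inl ENNReal.ofReal_ne_top), mul_comm]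
  exact hM'

/-- The failure probability of the slotted code: false alarms shortly before the transmission,
a missed preamble, a decoding error, decoding from noise, and too many false alarms. -/
noncomputable def failure (m : Fin (2 ^ B)) (κ : ℝ≥0∞) (l : ℝ) : ℝ≥0∞ :=
  K.W * (prodPMF fun _ => ch.Q ch.star).toOuterMeasure K.test +
    (prodPMF fun _ => ch.Q K.x₀).toOuterMeasure K.testᶜ +
    (prodPMF fun i => ch.Q (K.word m i)).toOuterMeasure (K.region m)ᶜ +
    A * (2 ^ B * κ) +
    (prodPMF fun _ => ch.Q ch.star).toOuterMeasure K.test / ENNReal.ofReal l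

theorem one_sub_failure_le {κ : ℝ≥0∞}
    (hκ : ∀ m, (prodPMF fun _ => ch.Q ch.star).toOuterMeasure (K.region m) ≤ κ)
    (hJ : K.slotAfter t * K.s < A) (hJ0 : 0 < K.slotAfter t) {l : ℝ} (hl : 0 < l) :
    1 - K.failure m κ l ≤ (K.law m t).toOuterMeasure
      {y | K.scheme.receiver.message y = m ∧
        K.scheme.receiver.decisionTime y = K.slotAfter t * K.s + (K.p + K.n₁) ∧
        (K.scheme.receiver.tau y : ℝ) ≤ K.slotAfter t * K.p +
          (K.p + K.n₁) * (K.slotAfter t * l) + (K.p + K.n₁)} := by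
  classical
  set G : Set (Fin K.scheme.N → Y) := {y | K.scheme.receiver.message y = m ∧
        K.scheme.receiver.decisionTime y = K.slotAfter t * K.s + (K.p + K.n₁) ∧
        (K.scheme.receiver.tau y : ℝ) ≤ K.slotAfter t * K.p +
          (K.p + K.n₁) * (K.slotAfter t * l) + (K.p + K.n₁)} with hG
  -- a false alarm so late that the word would be missed
  set E1 : Set (Fin K.scheme.N → Y) :=
    ⋃ j ∈ (Finset.range (K.slotAfter t)).filter fun j => K.slotAfter t < j + K.W,
      {y | K.scheme.pre (K.scheme.window y j)} with hE1
  -- an earlier slot in which noise is taken for a word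
  set E4 : Set (Fin K.scheme.N → Y) :=
    ⋃ j ∈ (Finset.range (K.slotAfter t)).filter fun j => j + K.W ≤ K.slotAfter t,
      ⋃ m' ∈ (Finset.univ : Finset (Fin (2 ^ B))),
        {y | (fun k : Fin K.n₁ => K.scheme.window y j (K.p + k)) ∈ K.region m'} with hE4
  have h1 : (K.law m t).toOuterMeasure E1 ≤
      K.W * (prodPMF fun _ => ch.Q ch.star).toOuterMeasure K.test := by
    refine (MeasureTheory.measure_biUnion_finset_le _ _).trans ?_
    rw [Finset.sum_congr rfl fun j hj =>
      K.law_falseAlarm hJ (Finset.mem_range.1 (Finset.mem_filter.1 hj).1), Finset.sum_const,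
      nsmul_eq_mul]
    gcongr
    calc _ ≤ (Finset.Ico (K.slotAfter t - K.W) (K.slotAfter t)).card :=
          Finset.card_le_card fun j hj => by
            rw [Finset.mem_filter, Finset.mem_range] at hj
            rw [Finset.mem_Ico]
            omega
      _ ≤ K.W := by rw [Nat.card_Ico]; omega
  have h4 : (K.law m t).toOuterMeasure E4 ≤ A * (2 ^ B * κ) := by
    refine (MeasureTheory.measure_biUnion_finset_le _ _).trans ?_
    calc _ ≤ ∑ j ∈ (Finset.range (K.slotAfter t)).filter fun j => j + K.W ≤ K.slotAfter t,
          ((2 : ℝ≥0∞) ^ B * κ) := by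
          refine Finset.sum_le_sum fun j hj => ?_
          refine (MeasureTheory.measure_biUnion_finset_le _ _).trans ?_
          rw [Finset.sum_congr rfl fun m' _ => K.law_noise hJ (Finset.mem_filter.1 hj).2 m']
          refine (Finset.sum_le_sum fun m' _ => hκ m').trans (le_of_eq ?_)
          simp
      _ ≤ A * (2 ^ B * κ) := by
          rw [Finset.sum_const, nsmul_eq_mul]
          gcongr
          refine (Finset.card_filter_le _ _).trans ?_
          rw [Finset.card_range]
          exact (Nat.le_mul_of_pos_right _ K.s_pos).trans hJ.le
  have hcompl : Gᶜ ⊆ E1 ∪ {y | ¬ K.scheme.pre (K.scheme.window y (K.slotAfter t))} ∪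
      {y | (fun k : Fin K.n₁ => K.scheme.window y (K.slotAfter t) (K.p + k)) ∉ K.region m} ∪ E4 ∪
      {y | K.slotAfter t * l ≤ (K.alarms t y : ℝ)} := by
    intro y hy
    by_contra hcon
    simp only [Set.mem_union, not_or] at hcon
    obtain ⟨⟨⟨⟨c1, c2⟩, c3⟩, c4⟩, c5⟩ := hcon
    rw [Set.mem_ofPred_eq, not_not] at c2 c3
    rw [Set.mem_ofPred_eq, not_le] at c5
    refine hy ?_
    have hbefore : ∀ j < K.slotAfter t, K.scheme.pre (K.scheme.window y j) →
        K.scheme.dec (K.scheme.window y j) = none ∧ j + K.scheme.W ≤ K.slotAfter t := by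
      intro j hj hpre
      have hjW : j + K.W ≤ K.slotAfter t := by
        by_contra! hlt
        refine c1 ?_
        rw [hE1, Set.mem_iUnion₂]
        exact ⟨j, by rw [Finset.mem_filter, Finset.mem_range]; exact ⟨hj, hlt⟩, hpre⟩
      refine ⟨K.dec_eq_none fun m' hm' => c4 ?_, hjW⟩
      rw [hE4, Set.mem_iUnion₂]
      refine ⟨j, by rw [Finset.mem_filter, Finset.mem_range]; exact ⟨hj, hjW⟩, ?_⟩
      rw [Set.mem_iUnion₂]
      exact ⟨m', Finset.mem_univ _, hm'⟩
    obtain ⟨r1, r2, r3⟩ := SlotScheme.decision_of_slot (S := K.scheme) (y := y)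
      (J := K.slotAfter t) hJ hbefore c2 (K.dec_eq_some c3)
    refine ⟨r3, r2, ?_⟩
    have r1' : (K.scheme.receiver.tau y : ℝ) ≤ K.slotAfter t * K.p +
        (K.p + K.n₁) * K.alarms t y + (K.p + K.n₁) := by exact_mod_cast r1
    refine r1'.trans ?_
    gcongr
  rw [← PMF.toOuterMeasure_add_compl (K.law m t) G, tsub_le_iff_right]
  gcongr
  refine (MeasureTheory.measure_mono hcompl).trans ?_
  refine (MeasureTheory.measure_union_le _ _).trans (add_le_add ?_ (K.law_alarms hJ hJ0 hl))
  refine (MeasureTheory.measure_union_le _ _).trans (add_le_add ?_ h4)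
  refine (MeasureTheory.measure_union_le _ _).trans (add_le_add ?_ (K.law_word hJ).le)
  exact (MeasureTheory.measure_union_le _ _).trans (add_le_add h1 (K.law_preamble hJ).le)

/-- With high probability, a slotted code decodes correctly and on time from few samples. -/
theorem le_prob_code {κ : ℝ≥0∞}
    (hκ : ∀ m, (prodPMF fun _ => ch.Q ch.star).toOuterMeasure (K.region m) ≤ κ)
    {l ρ : ℝ} (hl : 0 < l) {t₀ : ℕ} (ht₀ : 0 < t₀) (hρ0 : 0 ≤ ρ)
    (hρ : (K.p : ℝ) + (K.p + K.n₁) * l ≤ ρ / 2 * K.s) (hρ' : (K.p + K.n₁ : ℝ) ≤ ρ / 2 * t₀)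
    (m : Fin (2 ^ B)) :
    1 - (K.failure m κ l + (t₀ + K.s : ℕ) / A) ≤ K.code.prob m fun t r =>
      {y | r.message y = m ∧ (t : ℕ) + (K.p + K.n₁) ≤ r.decisionTime y ∧
        r.decisionTime y < t + K.s + (K.p + K.n₁) ∧
        (r.tau y : ℝ) / r.decisionTime y ≤ ρ} := by
  classical
  have hA := K.A_pos
  have hA0 : (A : ℝ≥0∞) ≠ 0 := by exact_mod_cast hA.ne'
  have hA1 : (A : ℝ≥0∞) ≠ ⊤ := ENNReal.natCast_ne_top A
  -- early arrivals would make the sampling frequency large, late ones leave no slot for the word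
  set good : Finset (Fin A) := Finset.univ.filter fun t => t₀ ≤ (t : ℕ) ∧ (t : ℕ) + K.s ≤ A
    with hgood
  have hcard : A ≤ good.card + (t₀ + K.s) := by
    have h1 := Finset.card_filter_add_card_filter_not (s := (Finset.univ : Finset (Fin A)))
      (fun t => t₀ ≤ (t : ℕ) ∧ (t : ℕ) + K.s ≤ A)
    rw [Finset.card_univ, Fintype.card_fin, ← hgood] at h1
    have h2 : (Finset.univ.filter fun t : Fin A => ¬ (t₀ ≤ (t : ℕ) ∧ (t : ℕ) + K.s ≤ A)).card ≤
        t₀ + K.s := by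
      rw [← Finset.card_map Fin.valEmbedding]
      calc _ ≤ (Finset.range t₀ ∪ Finset.Ico (A - K.s) A).card := by
            refine Finset.card_le_card fun i hi => ?_
            rw [Finset.mem_map] at hi
            obtain ⟨t, ht, rfl⟩ := hi
            rw [Finset.mem_filter] at ht
            have := t.2
            simp only [Fin.valEmbedding_apply, Finset.mem_union, Finset.mem_range, Finset.mem_Ico]
            omega
        _ ≤ t₀ + K.s := by
            refine (Finset.card_union_le _ _).trans ?_
            rw [Finset.card_range, Nat.card_Ico]
            omega
    omega
  have hgoodt : ∀ t ∈ good, 1 - K.failure m κ l ≤ K.code.probAt m t fun r =>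
      {y | r.message y = m ∧ (t : ℕ) + (K.p + K.n₁) ≤ r.decisionTime y ∧
        r.decisionTime y < t + K.s + (K.p + K.n₁) ∧
        (r.tau y : ℝ) / r.decisionTime y ≤ ρ} := by
    intro t ht
    rw [hgood, Finset.mem_filter] at ht
    have hlt := K.slotAfter_lt t
    have hle := K.le_slotAfter t
    have hJ0 : 0 < K.slotAfter t := by
      rcases Nat.eq_zero_or_pos (K.slotAfter t) with h | h
      · rw [h] at hle; omega
      · exact h
    rw [probAt_code]
    refine (K.one_sub_failure_le (m := m) hκ (t := t) (by omega) hJ0 hl).trans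
      (MeasureTheory.measure_mono ?_)
    rintro y ⟨h1, h2, h3⟩
    refine ⟨h1, by omega, by omega, ?_⟩
    have hJ0' : (0 : ℝ) < K.slotAfter t := by exact_mod_cast hJ0
    have hs0 : (0 : ℝ) < K.s := by exact_mod_cast K.s_pos
    have h4 : (t₀ : ℝ) ≤ K.slotAfter t * K.s := by exact_mod_cast ht.2.1.trans hle
    have h5 : (K.scheme.receiver.decisionTime y : ℝ) = K.slotAfter t * K.s + (K.p + K.n₁) := by
      exact_mod_cast h2
    have h6 : (0 : ℝ) ≤ K.p + K.n₁ := by positivity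
    rw [h5, div_le_iff₀ (by positivity)]
    calc (K.scheme.receiver.tau y : ℝ)
        ≤ K.slotAfter t * (K.p + (K.p + K.n₁) * l) + (K.p + K.n₁) := by linarith
      _ ≤ K.slotAfter t * (ρ / 2 * K.s) + ρ / 2 * t₀ := by gcongr
      _ ≤ K.slotAfter t * (ρ / 2 * K.s) + ρ / 2 * (K.slotAfter t * K.s) := by gcongr
      _ = ρ * (K.slotAfter t * K.s) := by ring
      _ ≤ _ := by gcongr; linarith
  calc 1 - (K.failure m κ l + (t₀ + K.s : ℕ) / A)
      = (1 - (t₀ + K.s : ℕ) / A) - K.failure m κ l := by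
        rw [add_comm, tsub_add_eq_tsub_tsub]
    _ ≤ (A : ℝ≥0∞)⁻¹ * good.card - K.failure m κ l := by
        gcongr
        rw [tsub_le_iff_right, div_eq_mul_inv, mul_comm ((t₀ + K.s : ℕ) : ℝ≥0∞), ← mul_add,
          ← ENNReal.inv_mul_cancel hA0 hA1]
        gcongr
        exact_mod_cast hcard
    _ ≤ (A : ℝ≥0∞)⁻¹ * good.card * (1 - K.failure m κ l) := by
        have hle1 : (A : ℝ≥0∞)⁻¹ * good.card ≤ 1 := by
          rw [← ENNReal.inv_mul_cancel hA0 hA1]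
          gcongr
          exact (Finset.card_le_univ _).trans (by rw [Fintype.card_fin])
        rw [ENNReal.mul_sub fun _ _ => ne_top_of_le_ne_top ENNReal.one_ne_top hle1, mul_one]
        gcongr
        exact mul_le_of_le_one_left' hle1
    _ = (A : ℝ≥0∞)⁻¹ * ∑ t ∈ good, (1 - K.failure m κ l) := by
        rw [Finset.sum_const, nsmul_eq_mul, mul_assoc]
    _ ≤ _ := by
        rw [Code.prob]
        gcongr
        exact (Finset.sum_le_sum hgoodt).trans
          (Finset.sum_le_sum_of_subset (Finset.subset_univ _))

end Estimates

end SlotCode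

/-! ### Detection of the preamble -/

/-- Two distinct laws can be told apart, with small error probabilities of both kinds, from
sufficiently many independent samples. -/
theorem exists_test {Y : Type*} [Fintype Y] {p q : PMF Y} (h : p ≠ q) {δ : ℝ} (hδ : 0 < δ) :
    ∀ᶠ n : ℕ in atTop, ∃ T : Set (Fin n → Y),
      (prodPMF fun _ => q).toOuterMeasure T ≤ ENNReal.ofReal δ ∧
      (prodPMF fun _ => p).toOuterMeasure Tᶜ ≤ ENNReal.ofReal δ := by
  classical
  obtain ⟨y₀, hy₀⟩ : ∃ y₀, (p y₀).toReal ≠ (q y₀).toReal := by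
    by_contra! hcon
    exact h (PMF.ext fun y =>
      (ENNReal.toReal_eq_toReal_iff' (p.apply_ne_top y) (q.apply_ne_top y)).1 (hcon y))
  set f : Y → ℝ := fun y => if y = y₀ then 1 else 0 with hf
  have hmean : ∀ r : PMF Y, ∑ a, (r a).toReal * f a = (r y₀).toReal := fun r => by simp [hf]
  set η := |(p y₀).toReal - (q y₀).toReal| / 2 with hη
  have hη0 : 0 < η := by
    have := abs_pos.2 (sub_ne_zero.2 hy₀)
    positivity
  filter_upwards [weak_law p f hη0 hδ, weak_law q f hη0 hδ] with n hp hq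
  rw [hmean] at hp hq
  -- count `y₀`; a count within `η * n` of its mean under `q` is far from its mean under `p`
  refine ⟨{z | η * n ≤ |∑ i, f (z i) - n * (q y₀).toReal|}, hq,
    (MeasureTheory.measure_mono fun z hz => ?_).trans hp⟩
  rw [Set.mem_compl_iff, Set.mem_ofPred_eq, not_le] at hz
  rw [Set.mem_ofPred_eq]
  have h1 : 2 * η * n ≤ |∑ i, f (z i) - n * (p y₀).toReal| +
      |∑ i, f (z i) - n * (q y₀).toReal| := by
    have h2 : 2 * η * n = |n * (p y₀).toReal - n * (q y₀).toReal| := by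
      rw [← mul_sub, abs_mul, abs_of_nonneg (Nat.cast_nonneg n : (0 : ℝ) ≤ n), hη]
      ring
    rw [h2]
    refine (abs_sub_le _ (∑ i, f (z i)) _).trans (le_of_eq ?_)
    rw [abs_sub_comm (n * (p y₀).toReal)]
  linarith

namespace Channel

variable {I Y : Type*} [Fintype Y] {ch : Channel I Y}

/-- An input law that carries information uses a symbol that can be told apart from the idle
symbol. -/
theorem exists_mem_support_ne {P : PMF ch.alphabet} (h : 0 < ch.infoReal P) :
    ∃ x ∈ P.support, ch.Q x ≠ ch.Q ch.star := by
  by_contra! hcon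
  have hs : ∀ x ∈ P.support, (ch.Q x).support ⊆ (ch.Q ch.star).support :=
    fun x hx => (hcon x hx).symm ▸ subset_rfl
  have h1 := infoReal_add_klReal ch hs
  have h2 := klReal_nonneg (ch.outputLaw_support_subset_iff.2 hs)
  have h3 : ∑ x, (P x).toReal * klReal (ch.Q x) (ch.Q ch.star) = 0 := by
    refine Finset.sum_eq_zero fun x _ => ?_
    by_cases hx : x ∈ P.support
    · rw [hcon x hx, klReal_self, mul_zero]
    · rw [(P.apply_eq_zero_iff x).2 hx]; simp
  linarith

end Channel

/-! ### Performance of slotted codes -/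

namespace Code

variable {I Y : Type*} [Fintype Y] {ch : Channel I Y} {B A : ℕ} (C : Code ch B A)

/-- A decision that is correct and made between `n` and `n + s` time units after the arrival of the
message, with probability `1 - δ`, bounds all performance measures. -/
theorem performance (hA : 0 < A) {n s : ℕ} {ρ δ : ℝ} (hρ : 0 ≤ ρ) (hδ : δ < 1 / 2)
    (h : ∀ m, 1 - ENNReal.ofReal δ ≤ C.prob m fun t r =>
      {y | r.message y = m ∧ (t : ℕ) + n ≤ r.decisionTime y ∧ r.decisionTime y < t + s + n ∧
        (r.tau y : ℝ) / r.decisionTime y ≤ ρ}) :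
    C.errorProb ≤ ENNReal.ofReal δ ∧ C.samplingFreq δ ≤ ρ ∧ n ≤ C.delay δ ∧
      C.delay δ ≤ n + s := by
  have hδ1 : ENNReal.ofReal δ < 2⁻¹ := by
    rw [← ENNReal.ofReal_ofNat, ← ENNReal.ofReal_inv_of_pos two_pos,
      ENNReal.ofReal_lt_ofReal_iff (by positivity)]
    linarith
  refine ⟨iSup_le fun m => ?_, C.samplingFreq_le_of_forall hρ fun m => (h m).trans
    (C.prob_mono m fun t r y hy => hy.2.2.2), ?_, Nat.sInf_le (le_iInf fun m => (h m).trans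
    (C.prob_mono m fun t r y hy => ?_))⟩
  · have h1 := C.prob_add_compl hA m fun _ r => {y | r.message y ≠ m}
    have h2 : 1 - ENNReal.ofReal δ ≤ C.prob m fun t r => {y | r.message y ≠ m}ᶜ :=
      (h m).trans (C.prob_mono m fun t r y hy => not_not.2 hy.1)
    rw [tsub_le_iff_right] at h2
    have h3 : C.prob m (fun t r => {y | r.message y ≠ m}ᶜ) ≠ ⊤ :=
      ne_top_of_le_ne_top ENNReal.one_ne_top (h1 ▸ le_add_self)
    rw [← h1, add_comm (C.prob m _)] at h2
    exact (ENNReal.add_le_add_iff_left h3).1 h2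
  · by_contra! hlt
    have m : Fin (2 ^ B) := ⟨0, by positivity⟩
    have h1 := C.delay_spec hA δ m
    have h2 : (C.prob m fun t r =>
        {y | (r.decisionTime y : ℤ) - ((t : ℤ) + 1) ≤ (C.delay δ : ℤ) - 1}ᶜ) ≥
        1 - ENNReal.ofReal δ := (h m).trans (C.prob_mono m fun t r y hy => by
      have := hy.2.1
      rw [Set.mem_compl_iff, Set.mem_ofPred_eq]
      omega)
    have h3 := add_le_add h1 h2
    rw [C.prob_add_compl hA] at h3
    have h4 : (2⁻¹ : ℝ≥0∞) < 1 - ENNReal.ofReal δ := by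
      rw [lt_tsub_iff_left, ← ENNReal.inv_two_add_inv_two]
      exact (ENNReal.add_lt_add_iff_right (by simp)).2 hδ1
    have h5 := ENNReal.add_lt_add h4 h4
    rw [ENNReal.inv_two_add_inv_two] at h5
    exact absurd h3 (not_le.2 h5)
  · have := hy.2.2.1
    rw [Set.mem_ofPred_eq]
    omega

end Code

/-! ### Asymptotics of the dimensions -/

theorem tendsto_two_rpow_mul_exp {c d : ℝ} (h : c * Real.log 2 < d) :
    Tendsto (fun B : ℕ => (2 : ℝ) ^ (c * B) * Real.exp (-(B * d))) atTop (𝓝 0) := by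
  have h1 : Tendsto (fun B : ℕ => Real.exp (-((d - c * Real.log 2) * B))) atTop (𝓝 0) :=
    Real.tendsto_exp_neg_atTop_nhds_zero.comp
      (tendsto_natCast_atTop_atTop.const_mul_atTop (sub_pos.2 h))
  refine h1.congr fun B => ?_
  rw [Real.rpow_def_of_pos two_pos, ← Real.exp_add]
  congr 1
  ring

theorem tendsto_sq_div_asyncLevel {β : ℝ} (hβ : 0 < β) :
    Tendsto (fun B : ℕ => (B : ℝ) ^ 2 / asyncLevel β B) atTop (𝓝 0) := by
  have hr : |(2 : ℝ) ^ (-β)| < 1 := by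
    rw [abs_of_pos (by positivity)]
    exact Real.rpow_lt_one_of_one_lt_of_neg one_lt_two (by linarith)
  have h1 := (tendsto_pow_const_mul_const_pow_of_abs_lt_one 2 hr).const_mul 2
  rw [mul_zero] at h1
  refine squeeze_zero (fun B => by positivity) (fun B => ?_) h1
  have hA := half_rpow_le_asyncLevel hβ B
  have hA0 : (0 : ℝ) < asyncLevel β B := by exact_mod_cast asyncLevel_pos hβ B
  have e : ((2 : ℝ) ^ (-β)) ^ B = (2 ^ (β * B))⁻¹ := by
    rw [← Real.rpow_natCast, ← Real.rpow_mul two_pos.le, ← Real.rpow_neg two_pos.le]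
    congr 1
    ring
  rw [e, div_le_iff₀ hA0]
  calc (B : ℝ) ^ 2 = 2 * (B ^ 2 * (2 ^ (β * B))⁻¹) * (2 ^ (β * B) / 2) := by field_simp
    _ ≤ _ := by gcongr

theorem tendsto_natCeil_mul_atTop {a : ℝ} (ha : 0 < a) :
    Tendsto (fun B : ℕ => ⌈a * B⌉₊) atTop atTop :=
  tendsto_nat_ceil_atTop.comp (tendsto_natCast_atTop_atTop.const_mul_atTop ha)

theorem tendsto_natCeil_mul_div {a : ℝ} (ha : 0 < a) :
    Tendsto (fun B : ℕ => (⌈a * B⌉₊ : ℝ) / B) atTop (𝓝 a) :=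
  (tendsto_nat_ceil_mul_div_atTop ha.le).comp tendsto_natCast_atTop_atTop

/-- The dimensions of a slotted code for `B` bits, divided by `B`: preambles of length `a`, words of
length `b` and slots that are `q` times as long as the preambles.  The relative losses in cost and
delay, and the fraction `l` of tolerable false alarms, are as required. -/
theorem exists_dimensions {r κ c δ ρ : ℝ} (hr : 0 < r) (hκ : 0 < κ) (hc : 0 ≤ c) (hδ : 0 < δ)
    (hδ1 : δ < 1 / 2) (hρ : 0 < ρ) :
    ∃ (θ a b l : ℝ) (q W : ℕ), 0 < θ ∧ 0 < a ∧ b = (1 + θ) / r ∧ 0 < l ∧ 4 / ρ ≤ q ∧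
      (a + b) * l < a ∧ a + b < W * a ∧ a * c + b * (κ * (1 + θ)) < (1 + δ) * (κ / r) ∧
      a + b + q * a < (1 + δ) / r := by
  -- slots `q` times longer than the preambles keep the sampling of idle slots below `ρ / 4`
  obtain ⟨q, hq⟩ : ∃ q : ℕ, 4 / ρ ≤ q := exists_nat_ge _
  have hq0 : (0 : ℝ) < q := lt_of_lt_of_le (by positivity) hq
  have hq1 : (1 : ℝ) ≤ q := Nat.one_le_cast.2 (by exact_mod_cast hq0)
  obtain ⟨θ, hθ⟩ : ∃ θ, θ = δ * κ / (2 * (1 + 3 * κ)) := ⟨_, rfl⟩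
  have hθ0 : 0 < θ := by rw [hθ]; positivity
  have hθκ : θ + 3 * θ * κ = δ * κ / 2 := by rw [hθ]; field_simp
  have hθδ : 3 * θ < δ := by
    refine lt_of_mul_lt_mul_right ?_ hκ.le
    have := mul_pos hδ hκ
    linarith
  obtain ⟨a, ha⟩ : ∃ a, a = θ / (r * q * (1 + c)) := ⟨_, rfl⟩
  have ha0 : 0 < a := by rw [ha]; positivity
  have haq : a * q ≤ θ / r := by
    rw [ha, div_mul_eq_mul_div, div_le_div_iff₀ (by positivity) hr]
    have := mul_nonneg (mul_pos (mul_pos hθ0 hq0) hr).le hc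
    linarith
  have hac : a * c ≤ θ / r := by
    rw [ha, div_mul_eq_mul_div, div_le_div_iff₀ (by positivity) hr]
    have : 1 * (1 + c) ≤ q * (1 + c) := by gcongr
    calc θ * c * r ≤ θ * (q * (1 + c)) * r := by gcongr; linarith
      _ = _ := by ring
  obtain ⟨b, hb⟩ : ∃ b, b = (1 + θ) / r := ⟨_, rfl⟩
  have hb0 : 0 < b := by rw [hb]; positivity
  obtain ⟨W, hW⟩ : ∃ W : ℕ, (a + b) / a < W := exists_nat_gt _
  rw [div_lt_iff₀ ha0] at hW
  refine ⟨θ, a, b, a / (2 * (a + b)), q, W, hθ0, ha0, hb, by positivity, hq, ?_, hW, ?_, ?_⟩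
  · rw [mul_div_assoc', div_lt_iff₀ (by positivity)]
    have := mul_pos (add_pos ha0 hb0) ha0
    linarith
  · have e : b * (κ * (1 + θ)) = (1 + θ) * (1 + θ) * κ / r := by rw [hb]; ring
    have e' : (1 + δ) * (κ / r) = (1 + δ) * κ / r := by ring
    rw [e, e']
    refine lt_of_le_of_lt (add_le_add_left hac _) ?_
    rw [← add_div, div_lt_div_iff_of_pos_right hr]
    have h1 : θ * (θ * κ) ≤ 1 * (θ * κ) := by gcongr; linarith
    have := mul_pos hδ hκ
    linarith
  · have h1 : a ≤ a * q := le_mul_of_one_le_right ha0.le hq1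
    calc a + b + q * a ≤ θ / r + (1 + θ) / r + θ / r := by linarith
      _ = (1 + 3 * θ) / r := by ring
      _ < _ := by gcongr

namespace SlotCode

variable {I Y : Type*} {ch : Channel I Y} {B A : ℕ} (K : SlotCode ch B A) [Fintype Y]

theorem failure_le {m : Fin (2 ^ B)} {δ₁ δ₂ e l γ : ℝ} (hδ₁ : 0 ≤ δ₁) (hδ₂ : 0 ≤ δ₂) (he : 0 ≤ e)
    (hl : 0 < l)
    (h1 : (prodPMF fun _ => ch.Q ch.star).toOuterMeasure K.test ≤ ENNReal.ofReal δ₁)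
    (h2 : (prodPMF fun _ => ch.Q K.x₀).toOuterMeasure K.testᶜ ≤ ENNReal.ofReal δ₁)
    (h3 : 1 - ENNReal.ofReal δ₂ ≤
      (prodPMF fun i => ch.Q (K.word m i)).toOuterMeasure (K.region m))
    (h4 : δ₁ * (K.W + 1 + 1 / l) + δ₂ + A * (2 ^ B * e) ≤ γ) :
    K.failure m (ENNReal.ofReal e) l ≤ ENNReal.ofReal γ := by
  have h3' : (prodPMF fun i => ch.Q (K.word m i)).toOuterMeasure (K.region m)ᶜ ≤
      ENNReal.ofReal δ₂ := by
    have h5 := PMF.toOuterMeasure_add_compl (prodPMF fun i => ch.Q (K.word m i)) (K.region m)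
    have h6 : (prodPMF fun i => ch.Q (K.word m i)).toOuterMeasure (K.region m) ≠ ⊤ :=
      ne_top_of_le_ne_top ENNReal.one_ne_top (h5 ▸ le_self_add)
    rw [tsub_le_iff_right, ← h5] at h3
    exact (ENNReal.add_le_add_iff_left h6).1 h3
  calc K.failure m (ENNReal.ofReal e) l
      ≤ K.W * ENNReal.ofReal δ₁ + ENNReal.ofReal δ₁ + ENNReal.ofReal δ₂ +
        A * (2 ^ B * ENNReal.ofReal e) + ENNReal.ofReal δ₁ / ENNReal.ofReal l := by
        unfold failure
        gcongr
    _ = ENNReal.ofReal (K.W * δ₁ + δ₁ + δ₂ + A * (2 ^ B * e) + δ₁ / l) := by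
        rw [ENNReal.ofReal_add (by positivity) (by positivity),
          ENNReal.ofReal_add (by positivity) (by positivity),
          ENNReal.ofReal_add (by positivity) (by positivity),
          ENNReal.ofReal_add (by positivity) (by positivity),
          ENNReal.ofReal_mul (by positivity), ENNReal.ofReal_mul (by positivity),
          ENNReal.ofReal_mul (by positivity), ENNReal.ofReal_div_of_pos hl,
          ENNReal.ofReal_natCast, ENNReal.ofReal_natCast, ENNReal.ofReal_pow two_pos.le,
          ENNReal.ofReal_ofNat]
    _ ≤ _ := by
        refine ENNReal.ofReal_le_ofReal (le_trans (le_of_eq ?_) h4)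
        ring

end SlotCode

/-! ### Achievability for a given input law -/

namespace Channel

variable {I Y : Type*} [Fintype Y] {ch : Channel I Y}

/-- The rate, in bits per channel use, that corresponds to the value `objective` of a law. -/
noncomputable def bitRate (ch : Channel I Y) (β : ℝ) (P : PMF ch.alphabet) : ℝ :=
  (ch.objective β P).toReal * ch.costReal P

theorem objective_ne_top {β : ℝ} {P : PMF ch.alphabet} (h : ch.objective β P ≠ 0) :
    ch.objective β P ≠ ⊤ := by
  refine ne_top_of_le_ne_top (ENNReal.div_ne_top (ch.mutualInfo_ne_top P) ?_) (min_le_left _ _)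
  rw [expCost_eq_ofReal (expCost_ne_top_of_objective h)]
  exact (ENNReal.ofReal_pos.2 (costReal_pos_of_objective h)).ne'

theorem bitRate_pos {β : ℝ} {P : PMF ch.alphabet} (h : ch.objective β P ≠ 0) :
    0 < ch.bitRate β P :=
  mul_pos (ENNReal.toReal_pos h (objective_ne_top h)) (costReal_pos_of_objective h)

theorem ofReal_bitRate {β : ℝ} {P : PMF ch.alphabet} (h : ch.objective β P ≠ 0) :
    ENNReal.ofReal (ch.bitRate β P) = ch.objective β P * ch.expCost P := by
  rw [bitRate, ENNReal.ofReal_mul ENNReal.toReal_nonneg, ENNReal.ofReal_toReal (objective_ne_top h),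
    expCost_eq_ofReal (expCost_ne_top_of_objective h)]

theorem bitRate_mul_log_le {β : ℝ} {P : PMF ch.alphabet} (h : ch.objective β P ≠ 0) :
    ch.bitRate β P * Real.log 2 ≤ ch.infoReal P := by
  have h1 : ENNReal.ofReal (ch.bitRate β P) ≤ ENNReal.ofReal (ch.infoReal P / Real.log 2) := by
    rw [ofReal_bitRate h, ← mutualInfo_eq]
    exact ENNReal.mul_le_of_le_div (min_le_left _ _)
  rwa [ENNReal.ofReal_le_ofReal_iff
    (div_nonneg (ch.infoReal_nonneg P) (Real.log_nonneg one_le_two)),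
    le_div_iff₀ (Real.log_pos one_lt_two)] at h1

theorem ofReal_mul_bitRate_le {β : ℝ} (hβ : 0 < β) {P : PMF ch.alphabet}
    (h : ch.objective β P ≠ 0) : ENNReal.ofReal ((1 + β) * ch.bitRate β P) ≤
      ch.mutualInfo P + divBits (ch.outputLaw P) (ch.Q ch.star) := by
  rw [ENNReal.ofReal_mul (by positivity), ofReal_bitRate h, mul_comm, mul_assoc]
  exact ENNReal.mul_le_of_le_div (min_le_right _ _)

/-- Slotted codes that use a given input law approach the value `objective` of that law, at every
sampling frequency, with a delay that is essentially the length of the codewords. -/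
theorem exists_code {β ρ : ℝ} (hβ : 0 < β) (hρ : 0 < ρ) {P : PMF ch.alphabet}
    (h : ch.objective β P ≠ 0) {δ η : ℝ} (hδ : 0 < δ) (hδ1 : δ < 1 / 2)
    (hη : 0 < η) (hη1 : η < 1 / 2) :
    ∀ᶠ B : ℕ in atTop, ∃ C : Code ch B (asyncLevel β B),
      C.errorProb ≤ ENNReal.ofReal δ ∧
      C.maxCost ≤ ENNReal.ofReal ((1 + η) * (B * (ch.costReal P / ch.bitRate β P))) ∧
      C.samplingFreq δ ≤ ρ ∧
      B / ch.bitRate β P ≤ C.delay δ ∧ C.delay δ ≤ (1 + η) * (B / ch.bitRate β P) := by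
  obtain ⟨x₀, hx₀, hne⟩ := exists_mem_support_ne (infoReal_pos_of_objective h)
  obtain ⟨y₀, -⟩ := (ch.Q x₀).support_nonempty
  have hP := expCost_ne_top_of_objective h
  have hK := costReal_pos_of_objective h
  have hr := bitRate_pos h
  have hrI := bitRate_mul_log_le h
  have hrD := ofReal_mul_bitRate_le hβ h
  set r := ch.bitRate β P
  set κ := ch.costReal P
  have hlog : 0 < Real.log 2 := Real.log_pos one_lt_two
  have hc0 : 0 ≤ (ch.cost x₀).toReal := ENNReal.toReal_nonneg
  obtain ⟨θ, a, b, l, q, W, hθ0, ha0, hb, hl0, hq, l1, hW, l3, l4⟩ :=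
    exists_dimensions hr hK hc0 hη hη1 hρ
  have hq0 : (0 : ℝ) < q := lt_of_lt_of_le (by positivity) hq
  have hb0 : 0 < b := by rw [hb]; positivity
  -- `v` is below the information of the law, yet words of length `b * B` carry more than `B` bits
  -- at rate `v`
  obtain ⟨v, hv⟩ : ∃ v, v = r * Real.log 2 / (1 + θ / 2) := ⟨_, rfl⟩
  have hv0 : 0 < v := by rw [hv]; positivity
  have hvI : v < ch.infoReal P := by
    rw [hv]
    exact lt_of_lt_of_le (div_lt_self (by positivity) (by linarith)) hrI
  have hvb : Real.log 2 < b * v := by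
    rw [hb, hv, div_mul_div_comm, lt_div_iff₀ (by positivity)]
    have := mul_pos (mul_pos hr hlog) hθ0
    linarith
  have hwD : ENNReal.ofReal ((1 + β) * v / Real.log 2) <
      ch.mutualInfo P + divBits (ch.outputLaw P) (ch.Q ch.star) := by
    refine lt_of_lt_of_le ((ENNReal.ofReal_lt_ofReal_iff (by positivity)).2 ?_) hrD
    rw [mul_div_assoc]
    gcongr
    rw [hv, div_div, div_lt_iff₀ (by positivity)]
    have := mul_pos (mul_pos hr hlog) hθ0
    linarith
  have hδ8 : 0 < δ / 8 := by positivity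
  obtain ⟨δ₁, hδ₁⟩ : ∃ δ₁, δ₁ = δ / 8 / (W + 1 + 1 / l) := ⟨_, rfl⟩
  have hδ₁0 : 0 < δ₁ := by rw [hδ₁]; positivity
  have hp := tendsto_natCeil_mul_div ha0
  have hn := tendsto_natCeil_mul_div hb0
  have hB : Tendsto (fun B : ℕ => (B : ℝ)) atTop atTop := tendsto_natCast_atTop_atTop
  have hkκ : κ < κ * (1 + θ) := lt_mul_of_one_lt_right hK (by linarith)
  have ev1 := ((hp.add hn).mul_const l).eventually_lt hp l1
  have ev2 := (hp.add hn).eventually_lt (hp.const_mul (W : ℝ)) hW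
  have ev3 := ((hp.mul_const (ch.cost x₀).toReal).add
    (hn.mul_const (κ * (1 + θ)))).eventually_lt_const l3
  have ev4 := ((hp.add hn).add (hp.const_mul (q : ℝ))).eventually_lt_const l4
  have ev5 := (hp.add hn).eventually_lt_const (lt_add_one (a + b))
  have ev6 := hB.eventually_ge_atTop (2 * (a + b + 1) / ρ)
  have ev7 := (hp.mul_const (q : ℝ)).eventually_lt_const (lt_add_one (a * q))
  have ev8 := hB.eventually_ge_atTop (a * q + 1)
  have ev9 := (tendsto_natCeil_mul_atTop ha0).eventually (exists_test hne hδ₁0)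
  have ev10 := (tendsto_natCeil_mul_atTop hb0).eventually
    (exists_codebook hP hvI hwD (by positivity) hkκ hδ8 (by linarith))
  have ev11 := (tendsto_two_rpow_mul_exp (c := 1) (by rwa [one_mul])).eventually_le_const
    (show (0 : ℝ) < δ / 8 / 2 by positivity)
  have ev12 := (tendsto_two_rpow_mul_exp (c := 1 + β) (d := (1 + β) * (b * v))
    (by gcongr)).eventually_le_const hδ8
  have ev13 := (tendsto_sq_div_asyncLevel hβ).eventually_le_const
    (show (0 : ℝ) < δ / 16 by positivity)
  filter_upwards [ev1, ev2, ev3, ev4, ev5, ev6, ev7, ev8, ev9, ev10, ev11, ev12, ev13,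
    eventually_gt_atTop 0] with B e1 e2 e3 e4 e5 e6 e7 e8 e9 e10 e11 e12 e13 hB0
  have hB0' : (0 : ℝ) < B := by exact_mod_cast hB0
  have hbB : b * B ≤ ⌈b * (B : ℝ)⌉₊ := Nat.le_ceil _
  have hp0 : 0 < ⌈a * (B : ℝ)⌉₊ := Nat.ceil_pos.2 (by positivity)
  have hn0 : 0 < ⌈b * (B : ℝ)⌉₊ := Nat.ceil_pos.2 (by positivity)
  generalize ⌈a * (B : ℝ)⌉₊ = p at *
  generalize ⌈b * (B : ℝ)⌉₊ = n at *
  obtain ⟨T, hT1, hT2⟩ := e9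
  have hexp : ∀ u : ℝ, 0 ≤ u → Real.exp (-(n * u)) ≤ Real.exp (-(B * (b * u))) := fun u hu => by
    rw [Real.exp_le_exp, neg_le_neg_iff]
    calc (B : ℝ) * (b * u) = b * B * u := by ring
      _ ≤ _ := by gcongr
  obtain ⟨word, D, hdisj, hD1, hD2, hcost⟩ := e10 (2 ^ B) (by
    refine le_trans ?_ e11
    rw [one_mul, Real.rpow_natCast]
    push_cast
    exact mul_le_mul_of_nonneg_left (hexp v hv0.le) (by positivity))
  have hA := asyncLevel_pos hβ B
  have hA0 : (0 : ℝ) < asyncLevel β B := by exact_mod_cast hA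
  have hpB : (p : ℝ) = p / B * B := by field_simp
  have hnB : (n : ℝ) = n / B * B := by field_simp
  generalize hx : (p : ℝ) / B = x at *
  generalize hz : (n : ℝ) / B = z at *
  have hp0' : (0 : ℝ) < p := by exact_mod_cast hp0
  have hqs : 2 * (p : ℝ) ≤ ρ / 2 * ((p * q : ℕ) : ℝ) := by
    rw [div_le_iff₀ hρ] at hq
    push_cast
    have := mul_le_mul_of_nonneg_right hq hp0'.le
    linarith
  have hpl : ((p : ℝ) + n) * l ≤ p := by
    rw [hpB, hnB, ← add_mul, mul_right_comm]
    exact mul_le_mul_of_nonneg_right e1.le hB0'.le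
  have hpW : p + n ≤ W * (p * q) := by
    have h1 : (p : ℝ) + n ≤ W * p := by
      rw [hpB, hnB, ← add_mul, ← mul_assoc]
      exact mul_le_mul_of_nonneg_right e2.le hB0'.le
    have h2 : p + n ≤ W * p := by exact_mod_cast h1
    exact h2.trans (Nat.mul_le_mul_left _ (Nat.le_mul_of_pos_right _ (by exact_mod_cast hq0)))
  have ht₀ : ((p : ℝ) + n) ≤ ρ / 2 * ((B ^ 2 : ℕ) : ℝ) := by
    rw [div_le_iff₀ hρ] at e6
    push_cast
    rw [hpB, hnB, ← add_mul, sq, ← mul_assoc]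
    refine mul_le_mul_of_nonneg_right ?_ hB0'.le
    linarith
  have hs : ((p * q : ℕ) : ℝ) ≤ B ^ 2 := by
    push_cast
    rw [hpB, sq, mul_right_comm]
    exact mul_le_mul_of_nonneg_right (by linarith) hB0'.le
  let K : SlotCode ch B (asyncLevel β B) :=
    { s := p * q, p := p, n₁ := n, W := W, x₀ := x₀, test := T, word := word, region := D
      default := y₀, p_pos := hp0
      p_le := Nat.le_mul_of_pos_right _ (by exact_mod_cast hq0)
      n₁_pos := hn0, n_le := hpW, A_pos := hA, disjoint := hdisj }
  have hfail : ∀ m, 1 - ENNReal.ofReal δ ≤ 1 - (K.failure m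
      (ENNReal.ofReal (Real.exp (-(n * ((1 + β) * v))))) l +
        ((B ^ 2 + p * q : ℕ) : ℝ≥0∞) / asyncLevel β B) := by
    intro m
    refine tsub_le_tsub_left ?_ _
    have h1 := K.failure_le (m := m) (δ₁ := δ₁) (δ₂ := δ / 8)
      (e := Real.exp (-(n * ((1 + β) * v)))) (l := l) (γ := 3 * (δ / 8)) hδ₁0.le hδ8.le
      (Real.exp_pos _).le hl0 hT1 hT2 (hD1 m) (by
        have h2 : δ₁ * (W + 1 + 1 / l) = δ / 8 := by
          rw [hδ₁]; exact div_mul_cancel₀ _ (by positivity)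
        have h3 : (asyncLevel β B : ℝ) * (2 ^ B * Real.exp (-(n * ((1 + β) * v)))) ≤ δ / 8 := by
          refine le_trans ?_ e12
          rw [← mul_assoc]
          have h4 : (asyncLevel β B : ℝ) * 2 ^ B ≤ 2 ^ ((1 + β) * B) := by
            rw [add_mul, one_mul, add_comm, Real.rpow_add two_pos, Real.rpow_natCast]
            gcongr
            exact Nat.floor_le (by positivity)
          refine mul_le_mul h4 ?_ (Real.exp_pos _).le (by positivity)
          refine (hexp _ (by positivity)).trans (le_of_eq ?_)
          congr 3
          ring
        change δ₁ * (W + 1 + 1 / l) + _ + _ ≤ _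
        linarith)
    have h5 : ((B ^ 2 + p * q : ℕ) : ℝ≥0∞) / asyncLevel β B ≤ ENNReal.ofReal (δ / 8) := by
      rw [← ENNReal.ofReal_natCast, ← ENNReal.ofReal_natCast,
        ← ENNReal.ofReal_div_of_pos hA0]
      refine ENNReal.ofReal_le_ofReal ?_
      rw [div_le_iff₀ hA0] at e13 ⊢
      rw [Nat.cast_add, Nat.cast_pow]
      linarith
    refine (add_le_add h1 h5).trans ?_
    rw [← ENNReal.ofReal_add (by positivity) (by positivity)]
    exact ENNReal.ofReal_le_ofReal (by linarith)
  have hgood := fun m => (hfail m).trans (K.le_prob_code hD2 hl0 (t₀ := B ^ 2) (by positivity)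
    hρ.le (by change (p : ℝ) + (p + n) * l ≤ ρ / 2 * ((p * q : ℕ) : ℝ); linarith) ht₀ m)
  obtain ⟨r1, r2, r3, r4⟩ := K.code.performance hA hρ.le hδ1 hgood
  refine ⟨K.code, r1, ?_, r2, ?_, ?_⟩
  · refine (K.maxCost_code_le hcost).trans ?_
    rw [← ENNReal.ofReal_toReal (cost_ne_top_of_mem_support hP hx₀), ← ENNReal.ofReal_natCast,
      ← ENNReal.ofReal_mul (Nat.cast_nonneg _),
      ← ENNReal.ofReal_add (by positivity) (by positivity)]
    refine ENNReal.ofReal_le_ofReal ?_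
    change (p : ℝ) * (ch.cost x₀).toReal + n * (κ * (1 + θ)) ≤ _
    rw [hpB, hnB]
    have := mul_le_mul_of_nonneg_right e3.le hB0'.le
    linarith
  · have h1 : ((p + n : ℕ) : ℝ) ≤ K.code.delay δ := by exact_mod_cast r3
    push_cast at h1
    refine le_trans ?_ (le_trans (le_trans hbB (by linarith)) h1)
    rw [hb, div_mul_eq_mul_div]
    gcongr
    exact le_mul_of_one_le_left hB0'.le (by linarith)
  · have h1 : (K.code.delay δ : ℝ) ≤ ((p + n + p * q : ℕ) : ℝ) := by exact_mod_cast r4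
    refine h1.trans ?_
    push_cast
    rw [hpB, hnB]
    have := mul_le_mul_of_nonneg_right e4.le hB0'.le
    have e : (1 + η) * (B / r) = (1 + η) / r * B := by ring
    rw [e]
    linarith

end Channel

/-! ### Passage to vanishing tolerances -/

/-- A property that holds eventually for each fixed tolerance holds eventually for some tolerances
that vanish. -/
theorem exists_tolerances {S : ℕ → Type*} [∀ B, Nonempty (S B)] (good : ∀ B, ℝ → S B → Prop)
    (h : ∀ δ : ℝ, 0 < δ → δ < 1 / 2 → ∀ᶠ B in atTop, ∃ C, good B δ C) :
    ∃ (C : ∀ B, S B) (ε : ℕ → ℝ), (∀ B, 0 < ε B) ∧ Tendsto ε atTop (𝓝 0) ∧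
      ∀ᶠ B in atTop, good B (ε B) (C B) := by
  classical
  set P : ℕ → ℕ → Prop := fun B k => ∃ C, good B (1 / ((k : ℝ) + 3)) C with hP
  have hev : ∀ k, ∀ᶠ B in atTop, P B k := fun k =>
    h _ (by positivity) (by
      rw [div_lt_div_iff₀ (by positivity) two_pos]
      have : (0 : ℝ) ≤ k := Nat.cast_nonneg k
      linarith)
  -- the smallest of the first `B` tolerances that suits `B`
  set κ : ℕ → ℕ := fun B => Nat.findGreatest (P B) B with hκ
  have hκt : Tendsto κ atTop atTop := tendsto_atTop.2 fun k => by
    filter_upwards [hev k, eventually_ge_atTop k] with B hB hk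
    exact Nat.le_findGreatest hk hB
  refine ⟨fun B => if hC : P B (κ B) then hC.choose else Classical.arbitrary _,
    fun B => 1 / ((κ B : ℝ) + 3), fun B => by positivity, ?_, ?_⟩
  · exact tendsto_const_nhds.div_atTop
      ((tendsto_natCast_atTop_atTop.comp hκt).atTop_add tendsto_const_nhds)
  · filter_upwards [hev 0] with B hB
    have hC : P B (κ B) := Nat.findGreatest_spec (Nat.zero_le B) hB
    rw [dif_pos hC]
    exact hC.choose_spec

/-- Codes exist: the receiver may decide after a single sample. -/
theorem Code.nonempty {I Y : Type*} {ch : Channel I Y} (x : ch.alphabet) {B A : ℕ} (hA : 0 < A) :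
    Nonempty (Code ch B A) :=
  ⟨{ n := 1
     n_pos := le_rfl
     codeword := fun _ _ => x
     start := fun t _ => t
     le_start := fun _ _ => le_rfl
     receiver := PMF.pure
      { next := fun _ => ⟨0, by omega⟩
        stopSet := Set.univ
        decode := fun _ => ⟨0, by positivity⟩
        increasing := fun _ _ h => absurd (Set.mem_univ _) (h 1 le_rfl (by omega))
        stops := fun _ => ⟨1, le_rfl, Set.mem_univ _⟩ } }⟩

namespace Channel

variable {I Y : Type*} [Fintype Y] {ch : Channel I Y}

/-- Codes whose performance for each fixed tolerance is as good as desired yield codes that achieve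
the rate `O`, with a delay asymptotic to `B * D`. -/
theorem exists_achieves (x : ch.alphabet) {β ρ O D : ℝ} (hβ : 0 < β) (hO : 0 < O) (hD : 0 < D)
    (h : ∀ δ η : ℝ, 0 < δ → δ < 1 / 2 → 0 < η → η < 1 / 2 → ∀ᶠ B : ℕ in atTop,
      ∃ C : Code ch B (asyncLevel β B), C.errorProb ≤ ENNReal.ofReal δ ∧
        C.maxCost ≤ ENNReal.ofReal ((1 + η) * (B / O)) ∧ C.samplingFreq δ ≤ ρ ∧
        B * D ≤ C.delay δ ∧ C.delay δ ≤ (1 + η) * (B * D)) :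
    ∃ C ε, ch.Achieves β ρ O.toNNReal C ε ∧
      Tendsto (fun B : ℕ => ((C B).delay (ε B) : ℝ) / (B * D)) atTop (𝓝 1) := by
  have hne : ∀ B, Nonempty (Code ch B (asyncLevel β B)) := fun B =>
    Code.nonempty x (asyncLevel_pos hβ B)
  obtain ⟨C, ε, hpos, hlim, hC⟩ := exists_tolerances
    (fun B δ (C : Code ch B (asyncLevel β B)) => C.errorProb ≤ ENNReal.ofReal δ ∧
      ENNReal.ofReal O - ENNReal.ofReal δ ≤ (B : ℝ≥0∞) / C.maxCost ∧ C.samplingFreq δ ≤ ρ ∧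
      1 / (B : ℝ) * Real.logb 2 (C.delay δ) ≤ δ ∧ B * D ≤ C.delay δ ∧
      C.delay δ ≤ (1 + δ) * (B * D)) (fun δ hδ hδ1 => by
    have hη : 0 < δ / (O + 1) := by positivity
    have hηδ : δ / (O + 1) ≤ δ := div_le_self hδ.le (by linarith)
    have hηO : δ / (O + 1) * O ≤ δ := by
      rw [div_mul_eq_mul_div, div_le_iff₀ (by positivity)]
      linarith
    have hlog : ∀ᶠ B : ℕ in atTop, Real.log (2 * D * B) / B ≤ δ * Real.log 2 := by
      have h1 : Tendsto (fun B : ℕ => Real.log (2 * D) / B + Real.log B / B) atTop (𝓝 (0 + 0)) := by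
        refine (tendsto_const_nhds.div_atTop tendsto_natCast_atTop_atTop).add ?_
        exact (Real.isLittleO_log_id_atTop.tendsto_div_nhds_zero).comp tendsto_natCast_atTop_atTop
      rw [add_zero] at h1
      filter_upwards [h1.eventually_le_const (mul_pos hδ (Real.log_pos one_lt_two)),
        eventually_gt_atTop 0] with B hB hB0
      rwa [Real.log_mul (by positivity) (by positivity), add_div]
    filter_upwards [h δ _ hδ hδ1 hη (lt_of_le_of_lt hηδ hδ1), hlog, eventually_gt_atTop 0] with
      B ⟨C, c1, c2, c3, c4, c5⟩ hB hB0
    have hB0' : (0 : ℝ) < B := by exact_mod_cast hB0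
    have c5' : (C.delay δ : ℝ) ≤ (1 + δ) * (B * D) := c5.trans (by gcongr)
    refine ⟨C, c1, ?_, c3, ?_, c4, c5'⟩
    · refine le_trans ?_ (ENNReal.div_le_div_left c2 _)
      rw [← ENNReal.ofReal_natCast, ← ENNReal.ofReal_div_of_pos (by positivity),
        ← ENNReal.ofReal_sub _ hδ.le]
      refine ENNReal.ofReal_le_ofReal ?_
      rw [le_div_iff₀ (by positivity)]
      rw [mul_div_assoc', mul_div_assoc', div_le_iff₀ hO]
      have h2 : (O - δ) * (1 + δ / (O + 1)) ≤ O := by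
        have := mul_pos hδ hη
        linarith
      have := mul_le_mul_of_nonneg_right h2 hB0'.le
      linarith
    · have hd : (0 : ℝ) < C.delay δ := lt_of_lt_of_le (by positivity) c4
      rw [Real.logb, one_div_mul_eq_div, div_right_comm, div_le_iff₀ (Real.log_pos one_lt_two)]
      refine le_trans ?_ hB
      gcongr
      refine c5'.trans ?_
      have : (1 + δ) * (B * D) ≤ 2 * (B * D) := by gcongr; linarith
      linarith)
  refine ⟨C, ε, ⟨hpos, hlim, ?_, ?_, ?_, ?_⟩, ?_⟩
  · exact hC.mono fun B hB => hB.1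
  · exact hC.mono fun B hB => hB.2.1
  · exact hC.mono fun B hB => hB.2.2.1.trans (le_add_of_nonneg_right (hpos B).le)
  · exact hC.mono fun B hB => hB.2.2.2.1
  · have h1 : Tendsto (fun B => 1 + ε B) atTop (𝓝 1) := by simpa using hlim.const_add 1
    refine tendsto_of_tendsto_of_tendsto_of_le_of_le' tendsto_const_nhds h1 ?_ ?_
    · filter_upwards [hC, eventually_gt_atTop 0] with B hB hB0
      have hB0' : (0 : ℝ) < B := by exact_mod_cast hB0
      rw [le_div_iff₀ (by positivity), one_mul]
      exact hB.2.2.2.2.1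
    · filter_upwards [hC, eventually_gt_atTop 0] with B hB hB0
      have hB0' : (0 : ℝ) < B := by exact_mod_cast hB0
      rw [div_le_iff₀ (by positivity)]
      exact hB.2.2.2.2.2

/-! ### The capacity and the delay -/

theorem objective_le_capacity {β ρ : ℝ} (hβ : 0 < β) (hρ : 0 < ρ) (P : PMF ch.alphabet) :
    ch.objective β P ≤ ch.capacity β ρ := by
  rcases eq_or_ne (ch.objective β P) 0 with h | h
  · rw [h]; exact zero_le
  obtain ⟨x, -⟩ := P.support_nonempty
  have hr := bitRate_pos h
  have hK := costReal_pos_of_objective h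
  have hO : 0 < (ch.objective β P).toReal := ENNReal.toReal_pos h (objective_ne_top h)
  have hratio : ∀ B : ℝ, B * (ch.costReal P / ch.bitRate β P) = B / (ch.objective β P).toReal := by
    intro B; rw [bitRate]; field_simp
  obtain ⟨C, ε, hC, -⟩ := exists_achieves (ρ := ρ) x hβ hO (inv_pos.2 hr) fun δ η hδ hδ1 hη hη1 =>
    (exists_code hβ hρ h hδ hδ1 hη hη1).mono fun B ⟨C, c1, c2, c3, c4, c5⟩ => by
      rw [hratio] at c2
      exact ⟨C, c1, c2, c3, c4, c5⟩
  refine le_trans (le_of_eq ?_)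
    (le_iSup₂ (f := fun (R : ℝ≥0) (_ : ∃ C ε, ch.Achieves β ρ R C ε) => (R : ℝ≥0∞)) _ ⟨C, ε, hC⟩)
  exact (ENNReal.ofReal_toReal (objective_ne_top h)).symm

theorem capacity_eq_iSup_objective {β ρ : ℝ} (hβ : 0 < β) (hρ : 0 < ρ) :
    ch.capacity β ρ = ⨆ P, ch.objective β P :=
  le_antisymm (capacity_le_iSup_objective hβ ρ) (iSup_le fun P => objective_le_capacity hβ hρ P)

/-- The delay `nStar` is attained at every sampling frequency. -/
theorem exists_achieves_nStar {β ρ : ℝ} (hβ : 0 < β) (hρ : 0 < ρ) (h0 : 0 < ch.capacity β 1)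
    (ht : ch.capacity β 1 < ⊤) (hne : (ch.maximizers β).Nonempty) :
    ∃ C ε, ch.Achieves β ρ (ch.capacity β 1).toNNReal C ε ∧
      Tendsto (fun B : ℕ => ((C B).delay (ε B) : ℝ) / (ch.nStar β B).toReal) atTop (𝓝 1) := by
  have hcap := capacity_eq_iSup_objective (ch := ch) hβ one_pos
  have hmax : ∀ P ∈ ch.maximizers β, ch.objective β P = ch.capacity β 1 := fun P hP => by
    rw [hcap, objective_eq_iSup_of_mem hP]
  have hN0 : ch.nStar β 1 ≠ 0 := nStar_one_ne_zero (hcap ▸ h0.ne') ht.ne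
  have hNt : ch.nStar β 1 ≠ ⊤ := nStar_one_ne_top (hcap ▸ h0.ne') h0.ne' hne
  have hD := ENNReal.toReal_pos hN0 hNt
  have hO := ENNReal.toReal_pos h0.ne' ht.ne
  have hinv : ∀ P ∈ ch.maximizers β, (ch.capacity β 1 * ch.expCost P)⁻¹ =
      ENNReal.ofReal (ch.bitRate β P)⁻¹ := fun P hP => by
    have h := (hmax P hP).trans_ne h0.ne'
    rw [← hmax P hP, ← ofReal_bitRate h, ENNReal.ofReal_inv_of_pos (bitRate_pos h)]
  obtain ⟨P₀, hP₀⟩ := hne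
  obtain ⟨x, -⟩ := P₀.support_nonempty
  obtain ⟨C, ε, hC, hlim⟩ := exists_achieves (ρ := ρ) x hβ hO hD fun δ η hδ hδ1 hη hη1 => by
    -- a maximizer whose delay is close to the infimum
    obtain ⟨P, hP, hPη⟩ : ∃ P ∈ ch.maximizers β,
        (ch.capacity β 1 * ch.expCost P)⁻¹ <
          ENNReal.ofReal ((1 + η / 3) * (ch.nStar β 1).toReal) := by
      have h1 : ch.nStar β 1 < ENNReal.ofReal ((1 + η / 3) * (ch.nStar β 1).toReal) := by
        rw [ENNReal.lt_ofReal_iff_toReal_lt hNt]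
        exact lt_mul_of_one_lt_left hD (by linarith)
      by_contra! hcon
      refine absurd h1 (not_lt.2 (le_iInf₂ fun P hP => ?_))
      rw [Nat.cast_one, one_div]
      exact hcon P hP
    have h := (hmax P hP).trans_ne h0.ne'
    have hr := bitRate_pos h
    have hK := costReal_pos_of_objective h
    rw [hinv P hP, ENNReal.ofReal_lt_ofReal_iff (by positivity)] at hPη
    have hle : (ch.nStar β 1).toReal ≤ (ch.bitRate β P)⁻¹ := by
      refine ENNReal.toReal_le_of_le_ofReal (by positivity) ?_
      rw [← hinv P hP]
      exact nStar_one_le hP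
    have hratio : ∀ B : ℝ, B * (ch.costReal P / ch.bitRate β P) =
        B / (ch.capacity β 1).toReal := by
      intro B; rw [bitRate, hmax P hP]; field_simp
    have hη3 : 0 < η / 3 := by positivity
    filter_upwards [exists_code hβ hρ h hδ hδ1 hη3 (by linarith)] with B ⟨C, c1, c2, c3, c4, c5⟩
    rw [hratio] at c2
    rw [div_eq_mul_inv] at c4 c5
    refine ⟨C, c1, c2.trans (ENNReal.ofReal_le_ofReal ?_), c3, le_trans ?_ c4, c5.trans ?_⟩
    · gcongr; linarith
    · gcongr
    · have h3 : (1 + η / 3) * (1 + η / 3) ≤ 1 + η := by nlinarith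
      calc (1 + η / 3) * (B * (ch.bitRate β P)⁻¹)
          ≤ (1 + η / 3) * (B * ((1 + η / 3) * (ch.nStar β 1).toReal)) := by gcongr
        _ = (1 + η / 3) * (1 + η / 3) * (B * (ch.nStar β 1).toReal) := by ring
        _ ≤ _ := by gcongr
  rw [show (ch.capacity β 1).toReal.toNNReal = (ch.capacity β 1).toNNReal from
    Real.toNNReal_coe] at hC
  refine ⟨C, ε, hC, hlim.congr' ?_⟩
  filter_upwards [eventually_gt_atTop 0] with B hB
  rw [nStar_eq_mul ch β hB, ENNReal.toReal_mul, ENNReal.toReal_natCast]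

end Channel

theorem mainTheorem2 {I Y : Type*} [Fintype Y] (ch : Channel I Y) (β ρ : ℝ)
    (hβ : 0 < β) (hρ : 0 < ρ) :
    ch.capacity β ρ = ch.capacity β 1 ∧
    (0 < ch.capacity β 1 → ch.capacity β 1 < ⊤ →
      ((ch.maximizers β).Nonempty →
        ∃ (C : ∀ B : ℕ, Code ch B (asyncLevel β B)) (ε : ℕ → ℝ),
          ch.Achieves β ρ (ch.capacity β 1).toNNReal C ε ∧
          Tendsto (fun B : ℕ => ((C B).delay (ε B) : ℝ) / (ch.nStar β B).toReal) atTop (𝓝 1)) ∧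
      ((∀ x ∈ ch.alphabet, ch.cost x ≠ ⊤ → (ch.Q x).support ⊆ (ch.Q ch.star).support) →
        (ch.maximizers β).Nonempty ∧
        ∀ (C : ∀ B : ℕ, Code ch B (asyncLevel β B)) (ε : ℕ → ℝ),
          ch.Achieves β 1 (ch.capacity β 1).toNNReal C ε →
          ∀ δ : ℝ, 0 < δ → ∀ᶠ B : ℕ in atTop,
            (1 - δ) * (ch.nStar β B).toReal ≤ ((C B).delay (ε B) : ℝ))) := by
  have hcap := Channel.capacity_eq_iSup_objective (ch := ch) hβ one_pos
  refine ⟨(Channel.capacity_eq_iSup_objective hβ hρ).trans hcap.symm, fun h0 ht =>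
    ⟨fun hne => Channel.exists_achieves_nStar hβ hρ h0 ht hne, fun hs => ⟨?_, fun C ε hC δ hδ =>
      hC.eventually_nStar_le hβ hcap h0 ht hs hδ⟩⟩⟩
  rw [hcap] at h0
  obtain ⟨P₀, hP₀⟩ := lt_iSup_iff.1 h0
  exact Channel.maximizers_nonempty hβ hs hP₀.ne'
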